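/- Let $\Bbbk$ be an algebraically closed field and let $\mathscr C$ be a (small) fiat 2-category over $\Bbbk$: it has finitely many objects; each $\mathscr C(\mathtt i,\mathtt j)$ is a finitary category (additive, $\Bbbk$-linear, with split idempotents, finite dimensional morphism spaces and finitely many isomorphism classes of indecomposable objects); horizontal composition is $\Bbbk$-bilinear; the identity 1-morphisms are indecomposable; and there is a $\Bbbk$-linear weak involution $*$, identical on objects and reversing the direction of both 1-morphisms and 2-morphisms, such that every 1-morphism $F$ is left adjoint to $F^*$. (Strictness of $\mathscr C$ and of its 2-representations is not needed.) Let $\mathbf M$ be a transitive 2-representation of $\mathscr C$, i.e. a $\Bbbk$-linear action on finitary categories $\mathbf M(\mathtt j)$ such that for every non-zero object $X$ of any $\mathbf M(\mathtt i)$ the inclusion into $\mathbf M$ of the additive closure of $\{F X\}$, $F$ running over all 1-morphisms with source $\mathtt i$, is an equivalence. Let $N\in\mathbf M(\mathtt i)$ be a non-zero object. For a finitary category $\mathcal A$, the injective abelianization $\underline{\mathcal A}$ has as objects the finite families $(f_a\colon X\to Y_a)_{a=1}^k$ of morphisms of $\mathcal A$, regarded as formal kernels $\bigcap_a\ker f_a$;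 morphisms from $(f_a)$ to $(f'_b\colon X'\to Y'_b)$ are the $g\colon X\to X'$ such that each $f'_b g$ has the form $\sum_a h_{a,b}f_a$, modulo those of the form $g=\sum_a q_a f_a$. Let $\underline{\mathscr C}$ have the same objects as $\mathscr C$ and 1-morphism categories $\underline{\mathscr C(\mathtt i,\mathtt j)}$, with $(\alpha_a\colon F\to G_a)\circ(\alpha'_b\colon F'\to G'_b)$ given by the family of all $F\alpha'_b\colon FF'\to FG'_b$ and all $\alpha_a F'\colon FF'\to G_aF'$. By the same formula $\underline{\mathscr C}$ acts on $\underline{\mathbf M}$, $\underline{\mathbf M}(\mathtt j)=\underline{\mathbf M(\mathtt j)}$. Both $\mathscr C\subset\underline{\mathscr C}$ and $\mathbf M\subset\underline{\mathbf M}$ via $X\mapsto(X,\emptyset)$. For $X\in\underline{\mathbf M}(\mathtt j)$, an internal hom $\underline{\mathrm{Hom}}(N,X)$ is a 1-morphism in $\underline{\mathscr C}(\mathtt i,\mathtt j)$ with an isomorphism $\mathrm{Hom}_{\underline{\mathscr C}(\mathtt i,\mathtt j)}(\underline{\mathrm{Hom}}(N,X),F)\cong\mathrm{Hom}_{\underline{\mathbf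 M}(\mathtt j)}(X,F N)$ natural in $F\in\underline{\mathscr C}(\mathtt i,\mathtt j)$; write $\mathrm{coev}_X\colon X\to\underline{\mathrm{Hom}}(N,X)\,N$ for the morphism corresponding to the identity. Then: 1. The internal hom $A^N=\underline{\mathrm{Hom}}(N,N)$ exists, and it is a coalgebra 1-morphism in $\underline{\mathscr C}(\mathtt i,\mathtt i)$, with comultiplication corresponding to $N\xrightarrow{\mathrm{coev}_N}A^N N\xrightarrow{A^N\mathrm{coev}_N}A^NA^N N$ and counit corresponding to $\mathrm{id}_N$. 2. Let $\mathrm{comod}(A^N)$ be the 2-representation of $\mathscr C$ whose value at $\mathtt j$ is the category of right $A^N$-comodule 1-morphisms $X\to XA^N$ with $X\in\underline{\mathscr C}(\mathtt i,\mathtt j)$, with $\mathscr C$ acting by composition. All internal homs $\underline{\mathrm{Hom}}(N,X)$ with $X\in\underline{\mathbf M}(\mathtt j)$ exist, and $\Theta=\underline{\mathrm{Hom}}(N,-)$, with the coactions and the isomorphisms $\underline{\mathrm{Hom}}(N,FX)\cong F\,\underline{\mathrm{Hom}}(N,X)$ (for $F$ in $\mathscr C$) corresponding to $(\underline{\mathrm{Hom}}(N,X)\,\mathrm{coev}_N)\circ\mathrm{coev}_X$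 and $F\,\mathrm{coev}_X$, is an equivalence of $\Bbbk$-linear 2-representations of $\mathscr C$ from $\underline{\mathbf M}$ to $\mathrm{comod}(A^N)$. 3. The injective objects of the categories $\mathrm{comod}(A^N)(\mathtt j)$ are stable under the action of $\mathscr C$, and $\Theta$ restricts to an equivalence of $\Bbbk$-linear 2-representations of $\mathscr C$ from $\mathbf M$ to the 2-representation $\mathrm{inj}(A^N)$ of injective $A^N$-comodule 1-morphisms. -/

import Mathlib

open CategoryTheory CategoryTheory.Limits CategoryTheory.Bicategory
open scoped CategoryTheory.Pseudofunctor.StrongTrans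

universe u v w

noncomputable section

/-! ### Injective abelianization of a linear category -/

/-- An object of the injective abelianization of `A`: an object `X` of `A` together with a finite
list of morphisms `f 0, …, f (k - 1)` of `A` with source `X`. It stands for the common kernel of
these morphisms. -/
structure InjAb (𝕜 : Type w) (A : Type u) [Category.{v} A] where
  X : A
  k : ℕ
  Y : Fin k → A
  f : ∀ a, X ⟶ Y a

namespace InjAb

section Hom

variable {𝕜 : Type w} [CommRing 𝕜] {A : Type u} [Category.{v} A] [Preadditive A] [Linear 𝕜 A]

/-- The morphisms `g : P.X ⟶ Z` of the form `∑ a, q a ∘ f a`. -/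
def null (P : InjAb 𝕜 A) (Z : A) : Submodule 𝕜 (P.X ⟶ Z) where
  carrier := {g | ∃ q : ∀ a, P.Y a ⟶ Z, g = ∑ a, P.f a ≫ q a}
  add_mem' := by
    rintro _ _ ⟨q, rfl⟩ ⟨q', rfl⟩
    exact ⟨fun a => q a + q' a, by simp [Finset.sum_add_distrib]⟩
  zero_mem' := ⟨fun _ => 0, by simp⟩
  smul_mem' := by
    rintro c _ ⟨q, rfl⟩
    exact ⟨fun a => c • q a, by simp [Finset.smul_sum]⟩

/-- The morphisms `g : P.X ⟶ Q.X` which are the first component of a tuple `(g, h)` with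
`h a b : P.Y a ⟶ Q.Y b` and `f' b ∘ g = ∑ a, h a b ∘ f a` for all `b`. -/
def adm (P Q : InjAb 𝕜 A) : Submodule 𝕜 (P.X ⟶ Q.X) where
  carrier := {g | ∃ h : ∀ a b, P.Y a ⟶ Q.Y b, ∀ b, g ≫ Q.f b = ∑ a, P.f a ≫ h a b}
  add_mem' := by
    rintro _ _ ⟨h, hh⟩ ⟨h', hh'⟩
    exact ⟨fun a b => h a b + h' a b, fun b => by
      simp [Finset.sum_add_distrib, hh, hh']⟩
  zero_mem' := ⟨fun _ _ => 0, by simp⟩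
  smul_mem' := by
    rintro c _ ⟨h, hh⟩
    exact ⟨fun a b => c • h a b, fun b => by simp [Finset.smul_sum, hh]⟩

lemma mem_adm {P Q : InjAb 𝕜 A} {g : P.X ⟶ Q.X} :
    g ∈ adm P Q ↔ ∀ b, g ≫ Q.f b ∈ null P (Q.Y b) :=
  ⟨fun ⟨h, hh⟩ b => ⟨fun a => h a b, hh b⟩, fun H =>
    ⟨fun a b => (H b).choose a, fun b => (H b).choose_spec⟩⟩

lemma f_comp_mem (P : InjAb 𝕜 A) {Z : A} (a : Fin P.k) (q : P.Y a ⟶ Z) :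
    P.f a ≫ q ∈ null P Z := by
  classical
  refine ⟨fun b => if h : b = a then eqToHom (by rw [h]) ≫ q else 0, ?_⟩
  rw [Finset.sum_eq_single a]
  · simp
  · intro b _ hb
    simp [hb]
  · simp

lemma null_le (P : InjAb 𝕜 A) {Z : A} {S : Submodule 𝕜 (P.X ⟶ Z)}
    (h : ∀ a (q : P.Y a ⟶ Z), P.f a ≫ q ∈ S) : null P Z ≤ S := by
  rintro _ ⟨q, rfl⟩
  exact Submodule.sum_mem _ fun a _ => h a (q a)

lemma null_comp {P : InjAb 𝕜 A} {Z Z' : A} {g : P.X ⟶ Z} (hg : g ∈ null P Z) (z : Z ⟶ Z') :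
    g ≫ z ∈ null P Z' := by
  obtain ⟨q, rfl⟩ := hg
  exact ⟨fun a => q a ≫ z, by simp [Preadditive.sum_comp]⟩

lemma adm_comp_null {P Q : InjAb 𝕜 A} {Z : A} {g : P.X ⟶ Q.X} (hg : g ∈ adm P Q)
    {q : Q.X ⟶ Z} (hq : q ∈ null Q Z) : g ≫ q ∈ null P Z := by
  obtain ⟨q, rfl⟩ := hq
  rw [Preadditive.comp_sum]
  refine Submodule.sum_mem _ fun b _ => ?_
  rw [← Category.assoc]
  exact null_comp (mem_adm.1 hg b) _

lemma id_mem_adm (P : InjAb 𝕜 A) : 𝟙 P.X ∈ adm P P :=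
  mem_adm.2 fun b => by simpa using f_comp_mem P b (𝟙 _)

lemma comp_mem_adm {P Q R : InjAb 𝕜 A} {g : P.X ⟶ Q.X} (hg : g ∈ adm P Q) {g' : Q.X ⟶ R.X}
    (hg' : g' ∈ adm Q R) : g ≫ g' ∈ adm P R :=
  mem_adm.2 fun b => by
    rw [Category.assoc]
    exact adm_comp_null hg (mem_adm.1 hg' b)

/-- Morphisms of the injective abelianization: tuples `(g, h)` modulo those for which
`g = ∑ a, q a ∘ f a` for some `q a : P.Y a ⟶ Q.X`. All tuples `(0, h)` are of this kind, so
that the class of `(g, h)` only depends on `g`. -/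
def Hom (P Q : InjAb 𝕜 A) : Type v :=
  adm P Q ⧸ (null P Q.X).comap (adm P Q).subtype

instance (P Q : InjAb 𝕜 A) : AddCommGroup (Hom P Q) :=
  inferInstanceAs (AddCommGroup (adm P Q ⧸ (null P Q.X).comap (adm P Q).subtype))

instance (P Q : InjAb 𝕜 A) : Module 𝕜 (Hom P Q) :=
  inferInstanceAs (Module 𝕜 (adm P Q ⧸ (null P Q.X).comap (adm P Q).subtype))

/-- The class of an admissible morphism. -/
def Hom.mk {P Q : InjAb 𝕜 A} (g : P.X ⟶ Q.X) (hg : g ∈ adm P Q) : Hom P Q :=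
  Submodule.Quotient.mk ⟨g, hg⟩

lemma Hom.mk_eq_mk {P Q : InjAb 𝕜 A} {g g' : P.X ⟶ Q.X} {hg : g ∈ adm P Q}
    {hg' : g' ∈ adm P Q} : Hom.mk g hg = Hom.mk g' hg' ↔ g - g' ∈ null P Q.X :=
  Submodule.Quotient.eq _

lemma Hom.mk_congr {P Q : InjAb 𝕜 A} {g g' : P.X ⟶ Q.X} {hg : g ∈ adm P Q}
    {hg' : g' ∈ adm P Q} (h : g = g') : Hom.mk g hg = Hom.mk g' hg' := by
  subst h; rfl

lemma Hom.exists_rep {P Q : InjAb 𝕜 A} (φ : Hom P Q) : ∃ g hg, φ = Hom.mk g hg := by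
  obtain ⟨⟨g, hg⟩, rfl⟩ := Submodule.Quotient.mk_surjective _ φ
  exact ⟨g, hg, rfl⟩

lemma Hom.mk_add {P Q : InjAb 𝕜 A} {g g' : P.X ⟶ Q.X} (hg : g ∈ adm P Q)
    (hg' : g' ∈ adm P Q) :
    Hom.mk g hg + Hom.mk g' hg' = Hom.mk (g + g') ((adm P Q).add_mem hg hg') := rfl

lemma Hom.smul_mk {P Q : InjAb 𝕜 A} (c : 𝕜) {g : P.X ⟶ Q.X} (hg : g ∈ adm P Q) :
    c • Hom.mk g hg = Hom.mk (c • g) ((adm P Q).smul_mem c hg) := rfl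

/-- A linear map on first components that respects admissible and null-homotopic morphisms
descends to classes. -/
def Hom.lift {A' : Type*} [Category A'] [Preadditive A'] [Linear 𝕜 A']
    {P Q : InjAb 𝕜 A} {P' Q' : InjAb 𝕜 A'} (L : (P.X ⟶ Q.X) →ₗ[𝕜] (P'.X ⟶ Q'.X))
    (h₁ : ∀ g ∈ adm P Q, L g ∈ adm P' Q') (h₂ : ∀ g ∈ null P Q.X, L g ∈ null P' Q'.X) :
    Hom P Q →ₗ[𝕜] Hom P' Q' :=
  Submodule.mapQ ((null P Q.X).comap (adm P Q).subtype)
    ((null P' Q'.X).comap (adm P' Q').subtype) (L.restrict h₁) fun g hg => h₂ g.1 hg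

instance category : Category.{v} (InjAb 𝕜 A) where
  Hom := Hom
  id P := Hom.mk (𝟙 P.X) (id_mem_adm P)
  comp {P Q R} φ ψ := Quotient.liftOn₂' φ ψ
    (fun g g' => Hom.mk (g.1 ≫ g'.1) (comp_mem_adm g.2 g'.2)) (by
      rintro ⟨g₁, h₁⟩ ⟨g₁', h₁'⟩ ⟨g₂, h₂⟩ ⟨g₂', h₂'⟩ e e'
      replace e := (Submodule.quotientRel_def _).1 e
      replace e' := (Submodule.quotientRel_def _).1 e'
      change g₁ - g₂ ∈ null P Q.X at e
      change g₁' - g₂' ∈ null Q R.X at e'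
      refine Hom.mk_eq_mk.2 ?_
      have : g₁ ≫ g₁' - g₂ ≫ g₂' = (g₁ - g₂) ≫ g₁' + g₂ ≫ (g₁' - g₂') := by simp
      dsimp only
      rw [this]
      exact Submodule.add_mem _ (null_comp e _) (adm_comp_null h₂ e'))
  id_comp φ := by
    obtain ⟨g, hg, rfl⟩ := Hom.exists_rep φ
    exact Hom.mk_congr (Category.id_comp _)
  comp_id φ := by
    obtain ⟨g, hg, rfl⟩ := Hom.exists_rep φ
    exact Hom.mk_congr (Category.comp_id _)
  assoc φ ψ χ := by
    obtain ⟨g, hg, rfl⟩ := Hom.exists_rep φ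
    obtain ⟨g', hg', rfl⟩ := Hom.exists_rep ψ
    obtain ⟨g'', hg'', rfl⟩ := Hom.exists_rep χ
    exact Hom.mk_congr (Category.assoc _ _ _)

/-- The morphism of the abelianization given by an admissible morphism. -/
def homMk {P Q : InjAb 𝕜 A} (g : P.X ⟶ Q.X) (hg : g ∈ adm P Q) : P ⟶ Q := Hom.mk g hg

lemma homMk_congr {P Q : InjAb 𝕜 A} {g g' : P.X ⟶ Q.X} {hg : g ∈ adm P Q}
    {hg' : g' ∈ adm P Q} (h : g = g') : homMk g hg = homMk g' hg' := Hom.mk_congr h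

lemma exists_rep {P Q : InjAb 𝕜 A} (φ : P ⟶ Q) : ∃ g hg, φ = homMk g hg := Hom.exists_rep φ

instance : Preadditive (InjAb 𝕜 A) where
  homGroup P Q := inferInstanceAs (AddCommGroup (Hom P Q))
  add_comp P Q R φ φ' ψ := by
    obtain ⟨g, hg, rfl⟩ := exists_rep φ
    obtain ⟨g', hg', rfl⟩ := exists_rep φ'
    obtain ⟨g'', hg'', rfl⟩ := exists_rep ψ
    exact homMk_congr (Preadditive.add_comp _ _ _ _ _ _)
  comp_add P Q R φ ψ ψ' := by
    obtain ⟨g, hg, rfl⟩ := exists_rep φ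
    obtain ⟨g', hg', rfl⟩ := exists_rep ψ
    obtain ⟨g'', hg'', rfl⟩ := exists_rep ψ'
    exact homMk_congr (Preadditive.comp_add _ _ _ _ _ _)

instance : Linear 𝕜 (InjAb 𝕜 A) where
  homModule P Q := inferInstanceAs (Module 𝕜 (Hom P Q))
  smul_comp P Q R c φ ψ := by
    obtain ⟨g, hg, rfl⟩ := exists_rep φ
    obtain ⟨g', hg', rfl⟩ := exists_rep ψ
    exact homMk_congr (Linear.smul_comp _ _ _ _ _ _)
  comp_smul P Q R φ c ψ := by
    obtain ⟨g, hg, rfl⟩ := exists_rep φ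
    obtain ⟨g', hg', rfl⟩ := exists_rep ψ
    exact homMk_congr (Linear.comp_smul _ _ _ _ _ _)

/-- Isomorphisms from isomorphisms of first components. -/
def isoMk {P Q : InjAb 𝕜 A} (e : P.X ≅ Q.X) (h₁ : e.hom ∈ adm P Q) (h₂ : e.inv ∈ adm Q P) :
    P ≅ Q where
  hom := homMk e.hom h₁
  inv := homMk e.inv h₂
  hom_inv_id := homMk_congr e.hom_inv_id
  inv_hom_id := homMk_congr e.inv_hom_id

variable (𝕜) in
/-- The embedding `X ↦ (X, 0, ∅)` of `A` into its abelianization, on objects. -/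
def of (X : A) : InjAb 𝕜 A := ⟨X, 0, Fin.elim0, fun a => a.elim0⟩

lemma mem_adm_of {P : InjAb 𝕜 A} {X : A} (g : P.X ⟶ X) : g ∈ adm P (of 𝕜 X) :=
  mem_adm.2 fun b => b.elim0

variable (𝕜 A) in
/-- The embedding `X ↦ (X, 0, ∅)` of `A` into its abelianization. -/
def ofFunctor : A ⥤ InjAb 𝕜 A where
  obj X := of 𝕜 X
  map {X Y} g := homMk (P := of 𝕜 X) (Q := of 𝕜 Y) g (mem_adm_of (P := of 𝕜 X) g)

/-- The object `X` with two lists of morphisms, put one after the other. -/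
abbrev append (X : A) {m n : ℕ} {Y : Fin m → A} (f : ∀ a, X ⟶ Y a) {Y' : Fin n → A}
    (f' : ∀ b, X ⟶ Y' b) : InjAb 𝕜 A where
  X := X
  k := m + n
  Y c := Sum.elim Y Y' (finSumFinEquiv.symm c)
  f c := Sum.rec (motive := fun s => X ⟶ Sum.elim Y Y' s) f f' (finSumFinEquiv.symm c)

section append

variable {X : A} {m n : ℕ} {Y : Fin m → A} {f : ∀ a, X ⟶ Y a} {Y' : Fin n → A}
    {f' : ∀ b, X ⟶ Y' b}

lemma append_mem_adm {P : InjAb 𝕜 A} {g : P.X ⟶ X} (h : ∀ a, g ≫ f a ∈ null P (Y a))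
    (h' : ∀ b, g ≫ f' b ∈ null P (Y' b)) : g ∈ adm P (append X f f') := by
  have key : ∀ s : Fin m ⊕ Fin n, g ≫ (Sum.rec (motive := fun s => X ⟶ Sum.elim Y Y' s) f f' s :
      X ⟶ Sum.elim Y Y' s) ∈ null P (Sum.elim Y Y' s) := by
    rintro (a | b)
    · exact h a
    · exact h' b
  exact mem_adm.2 fun c => key _

lemma append_null_le {Z : A} {S : Submodule 𝕜 (X ⟶ Z)} (h : ∀ a (q : Y a ⟶ Z), f a ≫ q ∈ S)
    (h' : ∀ b (q : Y' b ⟶ Z), f' b ≫ q ∈ S) :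
    null (𝕜 := 𝕜) (append X f f') Z ≤ S := by
  have key : ∀ (s : Fin m ⊕ Fin n) (q : Sum.elim Y Y' s ⟶ Z),
      (Sum.rec (motive := fun s => X ⟶ Sum.elim Y Y' s) f f' s : X ⟶ Sum.elim Y Y' s) ≫ q ∈
        S := by
    rintro (a | b)
    · exact h a
    · exact h' b
  exact null_le (append X f f') fun c => key _

variable (f f') in
lemma append_left_mem {Z : A} (a : Fin m) (q : Y a ⟶ Z) :
    f a ≫ q ∈ null (𝕜 := 𝕜) (append X f f') Z := by
  have key : ∀ s (hs : s = Sum.inl a), f a ≫ q =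
      (Sum.rec (motive := fun s => X ⟶ Sum.elim Y Y' s) f f' s : X ⟶ Sum.elim Y Y' s) ≫
        eqToHom (by rw [hs]; rfl) ≫ q := by
    rintro s rfl
    simp
  rw [key (finSumFinEquiv.symm (finSumFinEquiv (Sum.inl a))) (by simp)]
  exact f_comp_mem (𝕜 := 𝕜) (append X f f') _ _

variable (f f') in
lemma append_right_mem {Z : A} (b : Fin n) (q : Y' b ⟶ Z) :
    f' b ≫ q ∈ null (𝕜 := 𝕜) (append X f f') Z := by
  have key : ∀ s (hs : s = Sum.inr b), f' b ≫ q =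
      (Sum.rec (motive := fun s => X ⟶ Sum.elim Y Y' s) f f' s : X ⟶ Sum.elim Y Y' s) ≫
        eqToHom (by rw [hs]; rfl) ≫ q := by
    rintro s rfl
    simp
  rw [key (finSumFinEquiv.symm (finSumFinEquiv (Sum.inr b))) (by simp)]
  exact f_comp_mem (𝕜 := 𝕜) (append X f f') _ _

variable (f f') in
lemma append_left_mem' (a : Fin m) : f a ∈ null (𝕜 := 𝕜) (append X f f') (Y a) := by
  simpa using append_left_mem (𝕜 := 𝕜) f f' a (𝟙 _)

variable (f f') in
lemma append_right_mem' (b : Fin n) : f' b ∈ null (𝕜 := 𝕜) (append X f f') (Y' b) := by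
  simpa using append_right_mem (𝕜 := 𝕜) f f' b (𝟙 _)

end append

end Hom

end InjAb

/-! ### Linear bicategories and their injective abelianization -/

/-- A bicategory with preadditive categories of 1-morphisms is preadditive if horizontal
composition of 2-morphisms is biadditive. -/
class PreadditiveBicategory (C : Type u) [Bicategory.{w, v} C]
    [∀ i j : C, Preadditive (i ⟶ j)] : Prop where
  whiskerLeft_add {i j k : C} (F : i ⟶ j) {G H : j ⟶ k} (α β : G ⟶ H) :
    F ◁ (α + β) = F ◁ α + F ◁ β
  add_whiskerRight {i j k : C} {F G : i ⟶ j} (α β : F ⟶ G) (H : j ⟶ k) :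
    (α + β) ▷ H = α ▷ H + β ▷ H

/-- A preadditive bicategory with `𝕜`-linear categories of 1-morphisms is `𝕜`-linear if horizontal
composition of 2-morphisms is `𝕜`-bilinear. -/
class LinearBicategory (𝕜 : Type*) [CommRing 𝕜] (C : Type u) [Bicategory.{w, v} C]
    [∀ i j : C, Preadditive (i ⟶ j)] [PreadditiveBicategory C]
    [∀ i j : C, Linear 𝕜 (i ⟶ j)] : Prop where
  whiskerLeft_smul {i j k : C} (F : i ⟶ j) {G H : j ⟶ k} (c : 𝕜) (α : G ⟶ H) :
    F ◁ (c • α) = c • F ◁ α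
  smul_whiskerRight {i j k : C} {F G : i ⟶ j} (c : 𝕜) (α : F ⟶ G) (H : j ⟶ k) :
    (c • α) ▷ H = c • α ▷ H

/-- The objects of the injective abelianization of a bicategory `C`: the objects of `C`. -/
structure AbBicat (𝕜 : Type w) (C : Type u) where
  of ::
  as : C

namespace AbBicat

variable {𝕜 : Type w} [CommRing 𝕜] {C : Type u} [Bicategory.{v, v} C]
  [∀ i j : C, Preadditive (i ⟶ j)] [∀ i j : C, Linear 𝕜 (i ⟶ j)] 

/-- Composition of 1-morphisms: first `P = (F', k', G', α')`, then `Q = (F, k, G, α)`. In the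
order of composition of functions this is
`(F F', k' + k, (F G'_1, …, F G'_k', G_1 F', …, G_k F'), …)`. -/
abbrev comp {i j k : C} (P : InjAb 𝕜 (i ⟶ j)) (Q : InjAb 𝕜 (j ⟶ k)) : InjAb 𝕜 (i ⟶ k) :=
  InjAb.append (P.X ≫ Q.X) (fun a => P.f a ▷ Q.X) (fun b => P.X ◁ Q.f b)

variable [PreadditiveBicategory C] [LinearBicategory 𝕜 C]

variable (𝕜) in
/-- Left whiskering as a linear map. -/
def whiskerLeftₗ {i j k : C} (F : i ⟶ j) (G H : j ⟶ k) : (G ⟶ H) →ₗ[𝕜] (F ≫ G ⟶ F ≫ H) where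
  toFun α := F ◁ α
  map_add' := PreadditiveBicategory.whiskerLeft_add F
  map_smul' := LinearBicategory.whiskerLeft_smul F

variable (𝕜) in
/-- Right whiskering as a linear map. -/
def whiskerRightₗ {i j k : C} (F G : i ⟶ j) (H : j ⟶ k) : (F ⟶ G) →ₗ[𝕜] (F ≫ H ⟶ G ≫ H) where
  toFun α := α ▷ H
  map_add' α β := PreadditiveBicategory.add_whiskerRight α β H
  map_smul' c α := LinearBicategory.smul_whiskerRight c α H

section

open InjAb

variable {i j k l : C}

lemma whiskerLeft_null (P : InjAb 𝕜 (i ⟶ j)) {Q : InjAb 𝕜 (j ⟶ k)} {Z : j ⟶ k} {g : Q.X ⟶ Z}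
    (hg : g ∈ null Q Z) : P.X ◁ g ∈ null (comp P Q) (P.X ≫ Z) := by
  have : null Q Z ≤ (null (comp P Q) (P.X ≫ Z)).comap (whiskerLeftₗ 𝕜 P.X Q.X Z) := by
    refine null_le Q fun b q => ?_
    change P.X ◁ (Q.f b ≫ q) ∈ null (comp P Q) (P.X ≫ Z)
    rw [Bicategory.whiskerLeft_comp]
    exact append_right_mem (fun a => P.f a ▷ Q.X) (fun b => P.X ◁ Q.f b) b (P.X ◁ q)
  exact this hg

lemma whiskerRight_null {P : InjAb 𝕜 (i ⟶ j)} (Q : InjAb 𝕜 (j ⟶ k)) {Z : i ⟶ j} {g : P.X ⟶ Z}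
    (hg : g ∈ null P Z) : g ▷ Q.X ∈ null (comp P Q) (Z ≫ Q.X) := by
  have : null P Z ≤ (null (comp P Q) (Z ≫ Q.X)).comap (whiskerRightₗ 𝕜 P.X Z Q.X) := by
    refine null_le P fun a q => ?_
    change (P.f a ≫ q) ▷ Q.X ∈ null (comp P Q) (Z ≫ Q.X)
    rw [Bicategory.comp_whiskerRight]
    exact append_left_mem (fun a => P.f a ▷ Q.X) (fun b => P.X ◁ Q.f b) a (q ▷ Q.X)
  exact this hg

lemma whiskerLeft_adm (P : InjAb 𝕜 (i ⟶ j)) {Q Q' : InjAb 𝕜 (j ⟶ k)} {g : Q.X ⟶ Q'.X}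
    (hg : g ∈ adm Q Q') : P.X ◁ g ∈ adm (comp P Q) (comp P Q') := by
  refine append_mem_adm (fun a => ?_) fun b => ?_
  · rw [whisker_exchange]
    exact append_left_mem (fun a => P.f a ▷ Q.X) (fun b => P.X ◁ Q.f b) a (P.Y a ◁ g)
  · rw [← Bicategory.whiskerLeft_comp]
    exact whiskerLeft_null P (mem_adm.1 hg b)

lemma whiskerRight_adm {P P' : InjAb 𝕜 (i ⟶ j)} (Q : InjAb 𝕜 (j ⟶ k)) {g : P.X ⟶ P'.X}
    (hg : g ∈ adm P P') : g ▷ Q.X ∈ adm (comp P Q) (comp P' Q) := by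
  refine append_mem_adm (fun a => ?_) fun b => ?_
  · rw [← Bicategory.comp_whiskerRight]
    exact whiskerRight_null Q (mem_adm.1 hg a)
  · rw [← whisker_exchange]
    exact append_right_mem (fun a => P.f a ▷ Q.X) (fun b => P.X ◁ Q.f b) b (g ▷ Q.Y b)

/-- Left whiskering in the abelianization. -/
def whiskerLeft (P : InjAb 𝕜 (i ⟶ j)) {Q Q' : InjAb 𝕜 (j ⟶ k)} (φ : Q ⟶ Q') :
    comp P Q ⟶ comp P Q' :=
  Hom.lift (whiskerLeftₗ 𝕜 P.X Q.X Q'.X) (fun _ hg => whiskerLeft_adm P hg)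
    (fun _ hg => whiskerLeft_null P hg) φ

/-- Right whiskering in the abelianization. -/
def whiskerRight {P P' : InjAb 𝕜 (i ⟶ j)} (φ : P ⟶ P') (Q : InjAb 𝕜 (j ⟶ k)) :
    comp P Q ⟶ comp P' Q :=
  Hom.lift (whiskerRightₗ 𝕜 P.X P'.X Q.X) (fun _ hg => whiskerRight_adm Q hg)
    (fun _ hg => whiskerRight_null Q hg) φ

/-- The associator of the abelianization. -/
def associator (P : InjAb 𝕜 (i ⟶ j)) (Q : InjAb 𝕜 (j ⟶ k)) (R : InjAb 𝕜 (k ⟶ l)) :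
    comp (comp P Q) R ≅ comp P (comp Q R) :=
  isoMk (α_ P.X Q.X R.X)
    (by
      refine append_mem_adm (fun a => ?_) ?_
      · have : (α_ P.X Q.X R.X).hom ≫ P.f a ▷ (Q.X ≫ R.X) =
            (P.f a ▷ Q.X) ▷ R.X ≫ (α_ (P.Y a) Q.X R.X).hom := by simp
        exact this ▸ null_comp (whiskerRight_null R (append_left_mem' (fun a => P.f a ▷ Q.X) (fun b => P.X ◁ Q.f b) a)) _
      · have key : ∀ (s : Fin Q.k ⊕ Fin R.k), (α_ P.X Q.X R.X).hom ≫ P.X ◁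
            (Sum.rec (motive := fun s => Q.X ≫ R.X ⟶ Sum.elim (fun a => Q.Y a ≫ R.X)
              (fun b => Q.X ≫ R.Y b) s) (fun a => Q.f a ▷ R.X) (fun b => Q.X ◁ R.f b) s :
              Q.X ≫ R.X ⟶ Sum.elim (fun a => Q.Y a ≫ R.X) (fun b => Q.X ≫ R.Y b) s) ∈
            null (comp (comp P Q) R) (P.X ≫ Sum.elim (fun a => Q.Y a ≫ R.X)
              (fun b => Q.X ≫ R.Y b) s) := by
          rintro (b | c)
          · have : (α_ P.X Q.X R.X).hom ≫ P.X ◁ Q.f b ▷ R.X =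
              (P.X ◁ Q.f b) ▷ R.X ≫ (α_ P.X (Q.Y b) R.X).hom := by simp
            exact this ▸ null_comp (whiskerRight_null R (append_right_mem' (fun a => P.f a ▷ Q.X) (fun b => P.X ◁ Q.f b) b)) _
          · have : (α_ P.X Q.X R.X).hom ≫ P.X ◁ Q.X ◁ R.f c =
              (P.X ≫ Q.X) ◁ R.f c ≫ (α_ P.X Q.X (R.Y c)).hom := by simp
            exact this ▸ append_right_mem (fun a => (comp P Q).f a ▷ R.X)
              (fun b => (comp P Q).X ◁ R.f b) c _
        exact fun b => key _)
    (by
      refine append_mem_adm ?_ (fun c => ?_)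
      · have key : ∀ (s : Fin P.k ⊕ Fin Q.k), (α_ P.X Q.X R.X).inv ≫
            (Sum.rec (motive := fun s => P.X ≫ Q.X ⟶ Sum.elim (fun a => P.Y a ≫ Q.X)
              (fun b => P.X ≫ Q.Y b) s) (fun a => P.f a ▷ Q.X) (fun b => P.X ◁ Q.f b) s :
              P.X ≫ Q.X ⟶ Sum.elim (fun a => P.Y a ≫ Q.X) (fun b => P.X ≫ Q.Y b) s) ▷ R.X ∈
            null (comp P (comp Q R)) (Sum.elim (fun a => P.Y a ≫ Q.X)
              (fun b => P.X ≫ Q.Y b) s ≫ R.X) := by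
          rintro (a | b)
          · have : (α_ P.X Q.X R.X).inv ≫ P.f a ▷ Q.X ▷ R.X =
              P.f a ▷ (Q.X ≫ R.X) ≫ (α_ (P.Y a) Q.X R.X).inv := by simp
            exact this ▸ append_left_mem (fun a => P.f a ▷ (comp Q R).X)
              (fun b => P.X ◁ (comp Q R).f b) a _
          · have : (α_ P.X Q.X R.X).inv ≫ (P.X ◁ Q.f b) ▷ R.X =
              P.X ◁ (Q.f b ▷ R.X) ≫ (α_ P.X (Q.Y b) R.X).inv := by simp
            exact this ▸ null_comp (whiskerLeft_null (Q := comp Q R) P (append_left_mem' (fun a => Q.f a ▷ R.X) (fun b => Q.X ◁ R.f b) b)) _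
        exact fun b => key _
      · have : (α_ P.X Q.X R.X).inv ≫ (P.X ≫ Q.X) ◁ R.f c =
            P.X ◁ Q.X ◁ R.f c ≫ (α_ P.X Q.X (R.Y c)).inv := by simp
        exact this ▸ null_comp (whiskerLeft_null (Q := comp Q R) P (append_right_mem' (fun a => Q.f a ▷ R.X) (fun b => Q.X ◁ R.f b) c)) _)

/-- The left unitor of the abelianization. -/
def leftUnitor (P : InjAb 𝕜 (i ⟶ j)) : comp (InjAb.of 𝕜 (𝟙 i)) P ≅ P :=
  isoMk (λ_ P.X)
    (mem_adm.2 fun b => by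
      have : (λ_ P.X).hom ≫ P.f b = 𝟙 i ◁ P.f b ≫ (λ_ (P.Y b)).hom := by simp
      exact this ▸ append_right_mem (fun a => (InjAb.of 𝕜 (𝟙 i)).f a ▷ P.X)
        (fun b => 𝟙 i ◁ P.f b) b _)
    (append_mem_adm (fun a => a.elim0) fun b => by
      have : (λ_ P.X).inv ≫ 𝟙 i ◁ P.f b = P.f b ≫ (λ_ (P.Y b)).inv := by simp
      exact this ▸ f_comp_mem P b _)

/-- The right unitor of the abelianization. -/
def rightUnitor (P : InjAb 𝕜 (i ⟶ j)) : comp P (InjAb.of 𝕜 (𝟙 j)) ≅ P :=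
  isoMk (ρ_ P.X)
    (mem_adm.2 fun a => by
      have : (ρ_ P.X).hom ≫ P.f a = P.f a ▷ 𝟙 j ≫ (ρ_ (P.Y a)).hom := by simp
      exact this ▸ append_left_mem (fun a => P.f a ▷ 𝟙 j)
        (fun b => P.X ◁ (InjAb.of 𝕜 (𝟙 j)).f b) a _)
    (append_mem_adm (fun a => by
      have : (ρ_ P.X).inv ≫ P.f a ▷ 𝟙 j = P.f a ≫ (ρ_ (P.Y a)).inv := by simp
      exact this ▸ f_comp_mem P a _) (fun b => b.elim0))

end

/-- The injective abelianization of a linear bicategory. -/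
instance bicategory : Bicategory.{v, v} (AbBicat 𝕜 C) where
  Hom i j := InjAb 𝕜 (i.as ⟶ j.as)
  id i := InjAb.of 𝕜 (𝟙 i.as)
  comp P Q := comp P Q
  homCategory i j := inferInstanceAs (Category (InjAb 𝕜 (i.as ⟶ j.as)))
  whiskerLeft P _ _ φ := whiskerLeft P φ
  whiskerRight φ Q := whiskerRight φ Q
  associator P Q R := associator P Q R
  leftUnitor P := leftUnitor P
  rightUnitor P := rightUnitor P
  whiskerLeft_id P Q := InjAb.homMk_congr (Bicategory.whiskerLeft_id P.X Q.X)
  whiskerLeft_comp P _ _ _ φ ψ := by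
    obtain ⟨g, hg, rfl⟩ := InjAb.exists_rep φ
    obtain ⟨g', hg', rfl⟩ := InjAb.exists_rep ψ
    exact InjAb.homMk_congr (Bicategory.whiskerLeft_comp P.X g g')
  id_whiskerLeft φ := by
    obtain ⟨g, hg, rfl⟩ := InjAb.exists_rep φ
    exact InjAb.homMk_congr (Bicategory.id_whiskerLeft g)
  comp_whiskerLeft P Q _ _ φ := by
    obtain ⟨g, hg, rfl⟩ := InjAb.exists_rep φ
    exact InjAb.homMk_congr (Bicategory.comp_whiskerLeft P.X Q.X g)
  id_whiskerRight P Q := InjAb.homMk_congr (Bicategory.id_whiskerRight P.X Q.X)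
  comp_whiskerRight φ ψ Q := by
    obtain ⟨g, hg, rfl⟩ := InjAb.exists_rep φ
    obtain ⟨g', hg', rfl⟩ := InjAb.exists_rep ψ
    exact InjAb.homMk_congr (Bicategory.comp_whiskerRight g g' Q.X)
  whiskerRight_id φ := by
    obtain ⟨g, hg, rfl⟩ := InjAb.exists_rep φ
    exact InjAb.homMk_congr (Bicategory.whiskerRight_id g)
  whiskerRight_comp φ Q R := by
    obtain ⟨g, hg, rfl⟩ := InjAb.exists_rep φ
    exact InjAb.homMk_congr (Bicategory.whiskerRight_comp g Q.X R.X)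
  whisker_assoc P _ _ φ R := by
    obtain ⟨g, hg, rfl⟩ := InjAb.exists_rep φ
    exact InjAb.homMk_congr (Bicategory.whisker_assoc P.X g R.X)
  whisker_exchange φ ψ := by
    obtain ⟨g, hg, rfl⟩ := InjAb.exists_rep φ
    obtain ⟨g', hg', rfl⟩ := InjAb.exists_rep ψ
    exact InjAb.homMk_congr (Bicategory.whisker_exchange g g')
  pentagon P Q R S := InjAb.homMk_congr (Bicategory.pentagon P.X Q.X R.X S.X)
  triangle P Q := InjAb.homMk_congr (Bicategory.triangle P.X Q.X)

instance (i j : AbBicat 𝕜 C) : Preadditive (i ⟶ j) :=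
  inferInstanceAs (Preadditive (InjAb 𝕜 (i.as ⟶ j.as)))

instance (i j : AbBicat 𝕜 C) : Linear 𝕜 (i ⟶ j) :=
  inferInstanceAs (Linear 𝕜 (InjAb 𝕜 (i.as ⟶ j.as)))

instance : PreadditiveBicategory (AbBicat 𝕜 C) where
  whiskerLeft_add F _ _ α β := by
    obtain ⟨g, hg, rfl⟩ := InjAb.exists_rep α
    obtain ⟨g', hg', rfl⟩ := InjAb.exists_rep β
    exact InjAb.homMk_congr (PreadditiveBicategory.whiskerLeft_add F.X g g')
  add_whiskerRight α β H := by
    obtain ⟨g, hg, rfl⟩ := InjAb.exists_rep α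
    obtain ⟨g', hg', rfl⟩ := InjAb.exists_rep β
    exact InjAb.homMk_congr (PreadditiveBicategory.add_whiskerRight g g' H.X)

instance : LinearBicategory 𝕜 (AbBicat 𝕜 C) where
  whiskerLeft_smul F _ _ c α := by
    obtain ⟨g, hg, rfl⟩ := InjAb.exists_rep α
    exact InjAb.homMk_congr (LinearBicategory.whiskerLeft_smul F.X c g)
  smul_whiskerRight c α H := by
    obtain ⟨g, hg, rfl⟩ := InjAb.exists_rep α
    exact InjAb.homMk_congr (LinearBicategory.smul_whiskerRight c g H.X)

end AbBicat

namespace AbBicat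

variable (𝕜 : Type w) [CommRing 𝕜] (C : Type u) [Bicategory.{v, v} C]
  [∀ i j : C, Preadditive (i ⟶ j)] [∀ i j : C, Linear 𝕜 (i ⟶ j)] [PreadditiveBicategory C]
  [LinearBicategory 𝕜 C]

/-- The embedding of `C` into its injective abelianization. -/
def incl : C ⥤ᵖ AbBicat 𝕜 C where
  obj i := ⟨i⟩
  map F := InjAb.of 𝕜 F
  map₂ {i j F G} α := (InjAb.ofFunctor 𝕜 (i ⟶ j)).map α
  map₂_id {i j} F := (InjAb.ofFunctor 𝕜 (i ⟶ j)).map_id F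
  map₂_comp {i j _ _ _} α β := (InjAb.ofFunctor 𝕜 (i ⟶ j)).map_comp α β
  mapId i := Iso.refl _
  mapComp {i j k} F G := InjAb.isoMk (P := InjAb.of 𝕜 (F ≫ G))
    (Q := comp (InjAb.of 𝕜 F) (InjAb.of 𝕜 G)) (Iso.refl (F ≫ G))
    (InjAb.append_mem_adm (fun a => a.elim0) (fun a => a.elim0))
    (InjAb.mem_adm.2 fun a => a.elim0)
  map₂_whisker_left F G H α := by
    have : F ◁ α = 𝟙 _ ≫ F ◁ α ≫ 𝟙 _ := by simp
    exact InjAb.homMk_congr this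
  map₂_whisker_right α H := by
    have : α ▷ H = 𝟙 _ ≫ α ▷ H ≫ 𝟙 _ := by simp
    exact InjAb.homMk_congr this
  map₂_associator F G H := by
    have : (α_ F G H).hom = 𝟙 _ ≫ 𝟙 (F ≫ G) ▷ H ≫ (α_ F G H).hom ≫ F ◁ 𝟙 (G ≫ H) ≫ 𝟙 _ := by
      simp
    exact InjAb.homMk_congr this
  map₂_left_unitor {i _} F := by
    have : (λ_ F).hom = 𝟙 _ ≫ 𝟙 (𝟙 i) ▷ F ≫ (λ_ F).hom := by simp
    exact InjAb.homMk_congr this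
  map₂_right_unitor {_ j} F := by
    have : (ρ_ F).hom = 𝟙 _ ≫ F ◁ 𝟙 (𝟙 j) ≫ (ρ_ F).hom := by simp
    exact InjAb.homMk_congr this

end AbBicat

/-! ### Linear 2-representations and their injective abelianization -/

section Rep

universe v' u'

variable (𝕜 : Type w) [CommRing 𝕜] {C : Type u} [Bicategory.{v, v} C]
  [∀ i j : C, Preadditive (i ⟶ j)] [∀ i j : C, Linear 𝕜 (i ⟶ j)]

/-- A 2-representation of `C` on `𝕜`-linear categories is `𝕜`-linear if 1-morphisms act by
`𝕜`-linear functors and the action on 2-morphisms is `𝕜`-linear. -/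
class IsLinearRep (M : C ⥤ᵖ Cat.{v', u'}) [∀ i, Preadditive (M.obj i)]
    [∀ i, Linear 𝕜 (M.obj i)] : Prop where
  additive {i j : C} (F : i ⟶ j) : (M.map F).toFunctor.Additive
  linear {i j : C} (F : i ⟶ j) : (M.map F).toFunctor.Linear 𝕜
  map₂_add {i j : C} {F G : i ⟶ j} (α β : F ⟶ G) (X : M.obj i) :
    (M.map₂ (α + β)).toNatTrans.app X = (M.map₂ α).toNatTrans.app X + (M.map₂ β).toNatTrans.app X
  map₂_smul {i j : C} {F G : i ⟶ j} (c : 𝕜) (α : F ⟶ G) (X : M.obj i) :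
    (M.map₂ (c • α)).toNatTrans.app X = c • (M.map₂ α).toNatTrans.app X

namespace AbRep

variable {𝕜} {M : C ⥤ᵖ Cat.{v', u'}} [∀ i, Preadditive (M.obj i)] [∀ i, Linear 𝕜 (M.obj i)]

/-- The action of a 1-morphism `P = (F, k, G, α)` of the abelianization of `C` on an object
`U = (X, k', Y, f)` of the abelianization of `M`: it is
`(F X, k' + k, (F Y_1, …, F Y_k', G_1 X, …, G_k X), …)`. -/
abbrev act {i j : C} (P : InjAb 𝕜 (i ⟶ j)) (U : InjAb 𝕜 (M.obj i)) : InjAb 𝕜 (M.obj j) :=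
  InjAb.append ((M.map P.X).toFunctor.obj U.X) (fun a => (M.map P.X).toFunctor.map (U.f a))
    (fun b => (M.map₂ (P.f b)).toNatTrans.app U.X)

variable [IsLinearRep 𝕜 M]

open InjAb

variable {i j k : C}

/-- The action of a 1-morphism as a linear map. -/
def mapₗ (F : i ⟶ j) (X Y : M.obj i) :
    (X ⟶ Y) →ₗ[𝕜] ((M.map F).toFunctor.obj X ⟶ (M.map F).toFunctor.obj Y) where
  toFun g := (M.map F).toFunctor.map g
  map_add' _ _ := (IsLinearRep.additive (𝕜 := 𝕜) (M := M) F).map_add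
  map_smul' c g := (IsLinearRep.linear (𝕜 := 𝕜) (M := M) F).map_smul g c

/-- Evaluation of 2-morphisms at an object as a linear map. -/
def appₗ (F G : i ⟶ j) (X : M.obj i) :
    (F ⟶ G) →ₗ[𝕜] ((M.map F).toFunctor.obj X ⟶ (M.map G).toFunctor.obj X) where
  toFun α := (M.map₂ α).toNatTrans.app X
  map_add' α β := IsLinearRep.map₂_add 𝕜 α β X
  map_smul' c α := IsLinearRep.map₂_smul c α X

lemma map_null (P : InjAb 𝕜 (i ⟶ j)) {U : InjAb 𝕜 (M.obj i)} {Z : M.obj i} {g : U.X ⟶ Z}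
    (hg : g ∈ null U Z) :
    (M.map P.X).toFunctor.map g ∈ null (act P U) ((M.map P.X).toFunctor.obj Z) := by
  have : null U Z ≤ (null (act P U) ((M.map P.X).toFunctor.obj Z)).comap (mapₗ P.X U.X Z) := by
    refine null_le U fun b q => ?_
    change (M.map P.X).toFunctor.map (U.f b ≫ q) ∈ null (act P U) _
    rw [Functor.map_comp]
    exact append_left_mem (fun a => (M.map P.X).toFunctor.map (U.f a)) _ b _
  exact this hg

lemma app_null {P : InjAb 𝕜 (i ⟶ j)} (U : InjAb 𝕜 (M.obj i)) {G : i ⟶ j} {α : P.X ⟶ G}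
    (hα : α ∈ null P G) :
    (M.map₂ α).toNatTrans.app U.X ∈ null (act P U) ((M.map G).toFunctor.obj U.X) := by
  have : null P G ≤ (null (act P U) ((M.map G).toFunctor.obj U.X)).comap (appₗ P.X G U.X) := by
    refine null_le P fun b q => ?_
    change (M.map₂ (P.f b ≫ q)).toNatTrans.app U.X ∈ null (act P U) _
    rw [PrelaxFunctor.map₂_comp]
    exact append_right_mem (fun a => (M.map P.X).toFunctor.map (U.f a))
      (fun b => (M.map₂ (P.f b)).toNatTrans.app U.X) b _
  exact this hα

lemma map_adm (P : InjAb 𝕜 (i ⟶ j)) {U V : InjAb 𝕜 (M.obj i)} {g : U.X ⟶ V.X}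
    (hg : g ∈ adm U V) : (M.map P.X).toFunctor.map g ∈ adm (act P U) (act P V) := by
  refine append_mem_adm (fun a => ?_) fun b => ?_
  · rw [← Functor.map_comp]
    exact map_null P (mem_adm.1 hg a)
  · rw [NatTrans.naturality]
    exact append_right_mem (fun a => (M.map P.X).toFunctor.map (U.f a))
      (fun b => (M.map₂ (P.f b)).toNatTrans.app U.X) b _

lemma app_adm {P Q : InjAb 𝕜 (i ⟶ j)} (U : InjAb 𝕜 (M.obj i)) {α : P.X ⟶ Q.X}
    (hα : α ∈ adm P Q) : (M.map₂ α).toNatTrans.app U.X ∈ adm (act P U) (act Q U) := by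
  refine append_mem_adm (fun a => ?_) fun b => ?_
  · rw [← NatTrans.naturality]
    exact append_left_mem (fun a => (M.map P.X).toFunctor.map (U.f a)) _ a _
  · rw [← Cat.Hom₂.comp_app, ← PrelaxFunctor.map₂_comp]
    exact app_null U (mem_adm.1 hα b)

/-- The functor by which a 1-morphism of the abelianization acts. -/
def actFunctor (P : InjAb 𝕜 (i ⟶ j)) : InjAb 𝕜 (M.obj i) ⥤ InjAb 𝕜 (M.obj j) where
  obj U := act P U
  map {U V} φ := Hom.lift (mapₗ P.X U.X V.X) (fun _ hg => map_adm P hg)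
    (fun _ hg => map_null P hg) φ
  map_id U := by exact homMk_congr ((M.map P.X).toFunctor.map_id U.X)
  map_comp φ ψ := by
    obtain ⟨g, hg, rfl⟩ := exists_rep φ
    obtain ⟨g', hg', rfl⟩ := exists_rep ψ
    exact homMk_congr ((M.map P.X).toFunctor.map_comp g g')

/-- The natural transformation by which a 2-morphism of the abelianization acts. -/
def actTrans {P Q : InjAb 𝕜 (i ⟶ j)} (φ : P ⟶ Q) :
    actFunctor (M := M) P ⟶ actFunctor (M := M) Q where
  app U := Hom.lift (appₗ P.X Q.X U.X) (fun _ hα => app_adm U hα) (fun _ hα => app_null U hα) φ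
  naturality U V ψ := by
    obtain ⟨α, hα, rfl⟩ := exists_rep φ
    obtain ⟨g, hg, rfl⟩ := exists_rep ψ
    exact homMk_congr ((M.map₂ α).toNatTrans.naturality g)

/-- Compatibility of the action with identities. -/
def actId (i : C) : actFunctor (M := M) (InjAb.of 𝕜 (𝟙 i)) ≅ 𝟭 (InjAb 𝕜 (M.obj i)) :=
  NatIso.ofComponents (fun U => isoMk (P := act (InjAb.of 𝕜 (𝟙 i)) U) (Q := U)
      ((Cat.Hom.toNatIso (M.mapId i)).app U.X)
    (mem_adm.2 fun a => by
      have : (M.mapId i).hom.toNatTrans.app U.X ≫ U.f a = (M.map (𝟙 i)).toFunctor.map (U.f a) ≫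
          (M.mapId i).hom.toNatTrans.app (U.Y a) :=
        ((M.mapId i).hom.toNatTrans.naturality (U.f a)).symm
      exact this ▸ append_left_mem (fun a => (M.map (𝟙 i)).toFunctor.map (U.f a)) _ a _)
    (append_mem_adm (fun a => by
      have : (M.mapId i).inv.toNatTrans.app U.X ≫ (M.map (𝟙 i)).toFunctor.map (U.f a) =
          U.f a ≫ (M.mapId i).inv.toNatTrans.app (U.Y a) :=
        ((M.mapId i).inv.toNatTrans.naturality (U.f a)).symm
      exact this ▸ f_comp_mem U a _) (fun b => b.elim0))) (by
    intro U V φ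
    obtain ⟨g, hg, rfl⟩ := exists_rep φ
    exact homMk_congr ((M.mapId i).hom.toNatTrans.naturality g))

/-- Compatibility of the action with composition. -/
def actComp (P : InjAb 𝕜 (i ⟶ j)) (Q : InjAb 𝕜 (j ⟶ k)) :
    actFunctor (M := M) (AbBicat.comp P Q) ≅ actFunctor (M := M) P ⋙ actFunctor (M := M) Q :=
  NatIso.ofComponents (fun U => isoMk (P := act (AbBicat.comp P Q) U) (Q := act Q (act P U))
      ((Cat.Hom.toNatIso (M.mapComp P.X Q.X)).app U.X)
    (by
      refine append_mem_adm ?_ fun c => ?_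
      · have key : ∀ s : Fin U.k ⊕ Fin P.k, (M.mapComp P.X Q.X).hom.toNatTrans.app U.X ≫
            (M.map Q.X).toFunctor.map
              (Sum.rec (motive := fun s => (M.map P.X).toFunctor.obj U.X ⟶ Sum.elim
                (fun a => (M.map P.X).toFunctor.obj (U.Y a))
                (fun b => (M.map (P.Y b)).toFunctor.obj U.X) s)
                (fun a => (M.map P.X).toFunctor.map (U.f a))
                (fun b => (M.map₂ (P.f b)).toNatTrans.app U.X) s :
                (M.map P.X).toFunctor.obj U.X ⟶ Sum.elim
                (fun a => (M.map P.X).toFunctor.obj (U.Y a))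
                (fun b => (M.map (P.Y b)).toFunctor.obj U.X) s) ∈
            null (act (AbBicat.comp P Q) U) ((M.map Q.X).toFunctor.obj (Sum.elim
                (fun a => (M.map P.X).toFunctor.obj (U.Y a))
                (fun b => (M.map (P.Y b)).toFunctor.obj U.X) s)) := by
          rintro (a | b)
          · have : (M.mapComp P.X Q.X).hom.toNatTrans.app U.X ≫
                (M.map Q.X).toFunctor.map ((M.map P.X).toFunctor.map (U.f a)) =
                (M.map (P.X ≫ Q.X)).toFunctor.map (U.f a) ≫
                  (M.mapComp P.X Q.X).hom.toNatTrans.app (U.Y a) :=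
              ((M.mapComp P.X Q.X).hom.toNatTrans.naturality (U.f a)).symm
            exact this ▸ append_left_mem (fun a => (M.map (P.X ≫ Q.X)).toFunctor.map (U.f a)) _ a _
          · have : (M.mapComp P.X Q.X).hom.toNatTrans.app U.X ≫
                (M.map Q.X).toFunctor.map ((M.map₂ (P.f b)).toNatTrans.app U.X) =
                (M.map₂ (P.f b ▷ Q.X)).toNatTrans.app U.X ≫
                  (M.mapComp (P.Y b) Q.X).hom.toNatTrans.app U.X := by
              rw [M.map₂_whisker_right]
              simp
            exact this ▸ null_comp (app_null U (append_left_mem' _ _ b)) _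
        exact fun a => key _
      · have : (M.mapComp P.X Q.X).hom.toNatTrans.app U.X ≫
            (M.map₂ (Q.f c)).toNatTrans.app ((M.map P.X).toFunctor.obj U.X) =
            (M.map₂ (P.X ◁ Q.f c)).toNatTrans.app U.X ≫
              (M.mapComp P.X (Q.Y c)).hom.toNatTrans.app U.X := by
          rw [M.map₂_whisker_left]
          simp
        exact this ▸ null_comp (app_null U (append_right_mem' _ _ c)) _)
    (by
      refine append_mem_adm (fun a => ?_) ?_
      · have : (M.mapComp P.X Q.X).inv.toNatTrans.app U.X ≫
              (M.map (P.X ≫ Q.X)).toFunctor.map (U.f a) =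
            (M.map Q.X).toFunctor.map ((M.map P.X).toFunctor.map (U.f a)) ≫
                  (M.mapComp P.X Q.X).inv.toNatTrans.app (U.Y a) :=
              ((M.mapComp P.X Q.X).inv.toNatTrans.naturality (U.f a)).symm
        exact this ▸ null_comp (map_null (U := act P U) Q (append_left_mem' _ _ a)) _
      · have key : ∀ s : Fin P.k ⊕ Fin Q.k, (M.mapComp P.X Q.X).inv.toNatTrans.app U.X ≫
            (M.map₂ (Sum.rec (motive := fun s => P.X ≫ Q.X ⟶ Sum.elim (fun a => P.Y a ≫ Q.X)
              (fun b => P.X ≫ Q.Y b) s) (fun a => P.f a ▷ Q.X) (fun b => P.X ◁ Q.f b) s :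
              P.X ≫ Q.X ⟶ Sum.elim (fun a => P.Y a ≫ Q.X)
                (fun b => P.X ≫ Q.Y b) s)).toNatTrans.app U.X ∈
            null (act Q (act P U)) ((M.map (Sum.elim (fun a => P.Y a ≫ Q.X)
                (fun b => P.X ≫ Q.Y b) s)).toFunctor.obj U.X) := by
          rintro (a | b)
          · have : (M.mapComp P.X Q.X).inv.toNatTrans.app U.X ≫
                (M.map₂ (P.f a ▷ Q.X)).toNatTrans.app U.X =
                (M.map Q.X).toFunctor.map ((M.map₂ (P.f a)).toNatTrans.app U.X) ≫
                  (M.mapComp (P.Y a) Q.X).inv.toNatTrans.app U.X := by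
              rw [M.map₂_whisker_right]
              simp
            exact this ▸ null_comp (map_null (U := act P U) Q (append_right_mem' _ _ a)) _
          · have : (M.mapComp P.X Q.X).inv.toNatTrans.app U.X ≫
                (M.map₂ (P.X ◁ Q.f b)).toNatTrans.app U.X =
                (M.map₂ (Q.f b)).toNatTrans.app ((M.map P.X).toFunctor.obj U.X) ≫
                  (M.mapComp P.X (Q.Y b)).inv.toNatTrans.app U.X := by
              rw [M.map₂_whisker_left]
              simp
            exact this ▸ append_right_mem _
              (fun b => (M.map₂ (Q.f b)).toNatTrans.app ((M.map P.X).toFunctor.obj U.X)) b _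
        exact fun a => key _)) (by
    intro U V φ
    obtain ⟨g, hg, rfl⟩ := exists_rep φ
    exact homMk_congr ((M.mapComp P.X Q.X).hom.toNatTrans.naturality g))

end AbRep

variable (M : C ⥤ᵖ Cat.{v', u'}) [∀ i, Preadditive (M.obj i)] [∀ i, Linear 𝕜 (M.obj i)]
  [IsLinearRep 𝕜 M] [PreadditiveBicategory C]
  [LinearBicategory 𝕜 C]

open InjAb AbRep in
/-- The injective abelianization of a 2-representation of `C`, as a 2-representation of the
injective abelianization of `C`. -/
def abRep : AbBicat 𝕜 C ⥤ᵖ Cat.{v', max u' v'} where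
  obj i := Cat.of (InjAb 𝕜 (M.obj i.as))
  map P := (actFunctor (M := M) P).toCatHom
  map₂ φ := (actTrans (M := M) φ).toCatHom₂
  map₂_id P := Cat.Hom₂.ext <| NatTrans.ext <| funext fun U => by
    exact homMk_congr congr(($(M.map₂_id P.X)).toNatTrans.app U.X)
  map₂_comp φ ψ := Cat.Hom₂.ext <| NatTrans.ext <| funext fun U => by
    obtain ⟨g, hg, rfl⟩ := exists_rep φ
    obtain ⟨g', hg', rfl⟩ := exists_rep ψ
    exact homMk_congr congr(($(M.map₂_comp g g')).toNatTrans.app U.X)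
  mapId i := Cat.Hom.isoMk (actId (M := M) i.as)
  mapComp P Q := Cat.Hom.isoMk (actComp (M := M) P Q)
  map₂_whisker_left P _ _ φ := Cat.Hom₂.ext <| NatTrans.ext <| funext fun U => by
    obtain ⟨g, hg, rfl⟩ := exists_rep φ
    exact homMk_congr congr(($(M.map₂_whisker_left P.X g)).toNatTrans.app U.X)
  map₂_whisker_right φ Q := Cat.Hom₂.ext <| NatTrans.ext <| funext fun U => by
    obtain ⟨g, hg, rfl⟩ := exists_rep φ
    exact homMk_congr congr(($(M.map₂_whisker_right g Q.X)).toNatTrans.app U.X)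
  map₂_associator P Q R := Cat.Hom₂.ext <| NatTrans.ext <| funext fun U => by
    exact homMk_congr congr(($(M.map₂_associator P.X Q.X R.X)).toNatTrans.app U.X)
  map₂_left_unitor P := Cat.Hom₂.ext <| NatTrans.ext <| funext fun U => by
    exact homMk_congr congr(($(M.map₂_left_unitor P.X)).toNatTrans.app U.X)
  map₂_right_unitor P := Cat.Hom₂.ext <| NatTrans.ext <| funext fun U => by
    exact homMk_congr congr(($(M.map₂_right_unitor P.X)).toNatTrans.app U.X)

instance (i : AbBicat 𝕜 C) : Preadditive ((abRep 𝕜 M).obj i) :=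
  inferInstanceAs (Preadditive (InjAb 𝕜 (M.obj i.as)))

instance (i : AbBicat 𝕜 C) : Linear 𝕜 ((abRep 𝕜 M).obj i) :=
  inferInstanceAs (Linear 𝕜 (InjAb 𝕜 (M.obj i.as)))

variable (M : C ⥤ᵖ Cat.{v', max u' v'}) [∀ i, Preadditive (M.obj i)] [∀ i, Linear 𝕜 (M.obj i)]
  [IsLinearRep 𝕜 M]

open InjAb in
/-- The embedding of a 2-representation into its injective abelianization. -/
def toAbRep : M ⟶ (AbBicat.incl 𝕜 C).comp (abRep.{u, v, w, v', max u' v'} 𝕜 M) where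
  app i := (InjAb.ofFunctor 𝕜 (M.obj i)).toCatHom
  naturality {i j} F := Cat.Hom.isoMk (NatIso.ofComponents (fun X => isoMk
      (P := InjAb.of 𝕜 ((M.map F).toFunctor.obj X))
      (Q := AbRep.act (InjAb.of 𝕜 F) (InjAb.of 𝕜 X))
      (Iso.refl ((M.map F).toFunctor.obj X))
      (append_mem_adm (fun a => a.elim0) (fun a => a.elim0)) (mem_adm.2 fun a => a.elim0))
    (by
      intro X Y g
      have : (M.map F).toFunctor.map g ≫ 𝟙 _ = 𝟙 _ ≫ (M.map F).toFunctor.map g := by simp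
      exact homMk_congr this))
  naturality_naturality {i j F G} α := Cat.Hom₂.ext <| NatTrans.ext <| funext fun X => by
    have : (M.map₂ α).toNatTrans.app X ≫ 𝟙 _ = 𝟙 _ ≫ (M.map₂ α).toNatTrans.app X := by simp
    exact homMk_congr this
  naturality_id i := Cat.Hom₂.ext <| NatTrans.ext <| funext fun X => by
    have : 𝟙 _ ≫ (M.map₂ (𝟙 (𝟙 i))).toNatTrans.app X ≫ (M.mapId i).hom.toNatTrans.app X =
      (M.mapId i).hom.toNatTrans.app X ≫ 𝟙 _ ≫ 𝟙 _ := by simp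
    exact homMk_congr this
  naturality_comp {i j k} F G := Cat.Hom₂.ext <| NatTrans.ext <| funext fun X => by
    have : 𝟙 _ ≫ (M.map₂ (𝟙 (F ≫ G))).toNatTrans.app X ≫ (M.mapComp F G).hom.toNatTrans.app X =
      (M.mapComp F G).hom.toNatTrans.app X ≫ 𝟙 _ ≫ 𝟙 _ ≫ 𝟙 _ ≫
        (M.map G).toFunctor.map (𝟙 _) ≫ 𝟙 _ := by simp
    exact homMk_congr this

end Rep

/-! ### Comodule 1-morphisms -/

section Comod

variable {B : Type u} [Bicategory.{w, v} B] {i : B} (A : i ⟶ i) [Comonad A]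

/-- Right comodule 1-morphisms with target `j` over a coalgebra 1-morphism `A`. The composite
written `X A` in the order of composition of functions is `A ≫ X`. -/
structure RightComod (j : B) where
  obj : i ⟶ j
  coact : obj ⟶ A ≫ obj
  coassoc : coact ≫ A ◁ coact = coact ≫ Comonad.comul ▷ obj ≫ (α_ A A obj).hom
  counit : coact ≫ Comonad.counit ▷ obj ≫ (λ_ obj).hom = 𝟙 obj

namespace RightComod

variable {A} {j k : B}

/-- Morphisms of comodule 1-morphisms. -/
@[ext]
structure Hom (X Y : RightComod A j) where
  hom : X.obj ⟶ Y.obj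
  comm : hom ≫ Y.coact = X.coact ≫ A ◁ hom

instance category : Category (RightComod A j) where
  Hom := Hom
  id X := ⟨𝟙 X.obj, by simp⟩
  comp f g := ⟨f.hom ≫ g.hom, by
    rw [Category.assoc, g.comm, ← Category.assoc, f.comm]
    simp⟩
  id_comp f := Hom.ext (Category.id_comp f.hom)
  comp_id f := Hom.ext (Category.comp_id f.hom)
  assoc f g h := Hom.ext (Category.assoc f.hom g.hom h.hom)

section Linear

variable [∀ i j : B, Preadditive (i ⟶ j)] [PreadditiveBicategory B]

/-- Morphisms of comodules form a subgroup of all 2-morphisms. -/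
def homAddSubgroup (X Y : RightComod A j) : AddSubgroup (X.obj ⟶ Y.obj) where
  carrier := {f | f ≫ Y.coact = X.coact ≫ A ◁ f}
  add_mem' {f g} hf hg := by
    rw [Set.mem_ofPred_eq] at hf hg ⊢
    rw [PreadditiveBicategory.whiskerLeft_add, Preadditive.add_comp, Preadditive.comp_add, hf, hg]
  zero_mem' := by
    have : A ◁ (0 : X.obj ⟶ Y.obj) = 0 := by
      simpa using PreadditiveBicategory.whiskerLeft_add A (0 : X.obj ⟶ Y.obj) 0
    simp [this]
  neg_mem' {f} hf := by
    have : A ◁ (-f) = -A ◁ f := by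
      have h₀ : A ◁ (0 : X.obj ⟶ Y.obj) = 0 := by
        simpa using PreadditiveBicategory.whiskerLeft_add A (0 : X.obj ⟶ Y.obj) 0
      have := PreadditiveBicategory.whiskerLeft_add A f (-f)
      rw [add_neg_cancel, h₀] at this
      exact (neg_eq_of_add_eq_zero_right this.symm).symm
    rw [Set.mem_ofPred_eq] at hf ⊢
    rw [this, Preadditive.neg_comp, Preadditive.comp_neg, hf]

/-- Morphisms of comodules as a subgroup. -/
def homEquiv (X Y : RightComod A j) : (X ⟶ Y) ≃ homAddSubgroup X Y where
  toFun f := ⟨f.hom, f.comm⟩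
  invFun f := ⟨f.1, f.2⟩

instance : Preadditive (RightComod A j) where
  homGroup X Y := (homEquiv X Y).addCommGroup
  add_comp _ _ _ f f' g := Hom.ext (Preadditive.add_comp _ _ _ f.hom f'.hom g.hom)
  comp_add _ _ _ f g g' := Hom.ext (Preadditive.comp_add _ _ _ f.hom g.hom g'.hom)

variable {𝕜 : Type*} [CommRing 𝕜] [∀ i j : B, Linear 𝕜 (i ⟶ j)] [LinearBicategory 𝕜 B]

instance (X Y : RightComod A j) : SMul 𝕜 (X ⟶ Y) where
  smul c f := ⟨c • f.hom, by
    rw [LinearBicategory.whiskerLeft_smul, Linear.smul_comp, Linear.comp_smul, f.comm]⟩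

instance : Linear 𝕜 (RightComod A j) where
  homModule _ _ :=
    { one_smul f := Hom.ext (one_smul 𝕜 f.hom)
      mul_smul c d f := Hom.ext (mul_smul c d f.hom)
      smul_zero c := Hom.ext (smul_zero c)
      smul_add c f g := Hom.ext (smul_add c f.hom g.hom)
      add_smul c d f := Hom.ext (add_smul c d f.hom)
      zero_smul f := Hom.ext (zero_smul 𝕜 f.hom) }
  smul_comp _ _ _ c f g := Hom.ext (Linear.smul_comp _ _ _ c f.hom g.hom)
  comp_smul _ _ _ f c g := Hom.ext (Linear.comp_smul _ _ _ f.hom c g.hom)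

end Linear

/-- The action of a 1-morphism on a comodule 1-morphism, by composition. -/
abbrev act (X : RightComod A j) (F : j ⟶ k) : RightComod A k where
  obj := X.obj ≫ F
  coact := X.coact ▷ F ≫ (α_ A X.obj F).hom
  coassoc := by
    have := congr($(X.coassoc) ▷ F ≫ (α_ A (A ≫ X.obj) F).hom ≫ A ◁ (α_ A X.obj F).hom)
    simp at this ⊢
    rw [this]
  counit := by
    have := congr($(X.counit) ▷ F)
    simp at this ⊢
    rw [this]

/-- The functor by which a 1-morphism acts on comodule 1-morphisms. -/
def actFunctor (F : j ⟶ k) : RightComod A j ⥤ RightComod A k where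
  obj X := X.act F
  map f := ⟨f.hom ▷ F, by
    have := congr($(f.comm) ▷ F ≫ (α_ _ _ _).hom)
    simp at this
    simpa using this⟩
  map_id X := Hom.ext (Bicategory.id_whiskerRight X.obj F)
  map_comp f g := Hom.ext (Bicategory.comp_whiskerRight f.hom g.hom F)

/-- The natural transformation by which a 2-morphism acts on comodule 1-morphisms. -/
def actTrans {F G : j ⟶ k} (α : F ⟶ G) : actFunctor (A := A) F ⟶ actFunctor (A := A) G where
  app X := ⟨X.obj ◁ α, by
    change X.obj ◁ α ≫ X.coact ▷ G ≫ (α_ A X.obj G).hom =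
      (X.coact ▷ F ≫ (α_ A X.obj F).hom) ≫ A ◁ X.obj ◁ α
    simp [whisker_exchange_assoc]⟩
  naturality X Y f := Hom.ext (whisker_exchange f.hom α).symm

/-- Isomorphisms of comodule 1-morphisms. -/
def isoMk {X Y : RightComod A j} (e : X.obj ≅ Y.obj)
    (h : e.hom ≫ Y.coact = X.coact ≫ A ◁ e.hom) : X ≅ Y where
  hom := ⟨e.hom, h⟩
  inv := ⟨e.inv, by
    rw [Iso.inv_comp_eq, ← Category.assoc, h, Category.assoc, ← Bicategory.whiskerLeft_comp]
    simp⟩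
  hom_inv_id := Hom.ext e.hom_inv_id
  inv_hom_id := Hom.ext e.inv_hom_id

end RightComod

open RightComod in
/-- Right `A`-comodule 1-morphisms form a 2-representation, by composition of 1-morphisms. -/
def comod : B ⥤ᵖ Cat.{w, max v w} where
  obj j := Cat.of (RightComod A j)
  map F := (actFunctor (A := A) F).toCatHom
  map₂ α := (actTrans (A := A) α).toCatHom₂
  map₂_id F := Cat.Hom₂.ext <| NatTrans.ext <| funext fun X =>
    Hom.ext (Bicategory.whiskerLeft_id X.obj F)
  map₂_comp α β := Cat.Hom₂.ext <| NatTrans.ext <| funext fun X =>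
    Hom.ext (Bicategory.whiskerLeft_comp X.obj α β)
  mapId j := Cat.Hom.isoMk (NatIso.ofComponents (fun X => isoMk (X := X.act (𝟙 j)) (ρ_ X.obj) (by
      change (ρ_ X.obj).hom ≫ X.coact =
        (X.coact ▷ 𝟙 j ≫ (α_ A X.obj (𝟙 j)).hom) ≫ A ◁ (ρ_ X.obj).hom
      simp)) (fun {X Y} f => Hom.ext (by exact rightUnitor_naturality f.hom)))
  mapComp F G := Cat.Hom.isoMk (NatIso.ofComponents (fun X => isoMk (X := X.act (F ≫ G))
    (Y := (X.act F).act G) (α_ X.obj F G).symm (by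
      change (α_ X.obj F G).inv ≫ (X.coact ▷ F ≫ (α_ A X.obj F).hom) ▷ G ≫
          (α_ A (X.obj ≫ F) G).hom =
        (X.coact ▷ (F ≫ G) ≫ (α_ A X.obj (F ≫ G)).hom) ≫ A ◁ (α_ X.obj F G).inv
      simp)) (fun {X Y} f => Hom.ext (by
      exact associator_inv_naturality_left f.hom F G)))
  map₂_whisker_left F G H α := Cat.Hom₂.ext <| NatTrans.ext <| funext fun X => Hom.ext (by
    have : X.obj ◁ F ◁ α = (α_ X.obj F G).inv ≫ (X.obj ≫ F) ◁ α ≫ (α_ X.obj F H).hom := by simp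
    exact this)
  map₂_whisker_right {_ _ _ F G} α H := Cat.Hom₂.ext <| NatTrans.ext <| funext fun X =>
    Hom.ext (by
      have : X.obj ◁ α ▷ H = (α_ X.obj F H).inv ≫ (X.obj ◁ α) ▷ H ≫ (α_ X.obj G H).hom := by simp
      exact this)
  map₂_associator F G H := Cat.Hom₂.ext <| NatTrans.ext <| funext fun X => Hom.ext (by
    have : X.obj ◁ (α_ F G H).hom = (α_ X.obj (F ≫ G) H).inv ≫ (α_ X.obj F G).inv ▷ H ≫
        𝟙 _ ≫ (α_ (X.obj ≫ F) G H).hom ≫ (α_ X.obj F (G ≫ H)).hom := by simp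
    exact this)
  map₂_left_unitor {j _} F := Cat.Hom₂.ext <| NatTrans.ext <| funext fun X => Hom.ext (by
    have : X.obj ◁ (λ_ F).hom = (α_ X.obj (𝟙 j) F).inv ≫ (ρ_ X.obj).hom ▷ F ≫ 𝟙 _ := by simp
    exact this)
  map₂_right_unitor {_ k} F := Cat.Hom₂.ext <| NatTrans.ext <| funext fun X => Hom.ext (by
    have : X.obj ◁ (ρ_ F).hom = (α_ X.obj F (𝟙 k)).inv ≫ (ρ_ (X.obj ≫ F)).hom ≫ 𝟙 _ := by simp
    exact this)

end Comod

/-! ### Finitary and fiat 2-categories, transitive 2-representations -/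

/-- Finitary `𝕜`-linear categories: additive, idempotent split, with finite dimensional morphism
spaces and finitely many isomorphism classes of indecomposable objects. -/
class IsFinitary (𝕜 : Type*) [Field 𝕜] (A : Type u) [Category.{v} A] [Preadditive A]
    [Linear 𝕜 A] : Prop extends HasFiniteBiproducts A, IsIdempotentComplete A where
  finite_hom (X Y : A) : Module.Finite 𝕜 (X ⟶ Y)
  finite_indecomposables :
    haveI := hasBinaryBiproducts_of_finite_biproducts A
    ∃ S : Set A, S.Finite ∧ ∀ X : A, Indecomposable X → ∃ Y ∈ S, Nonempty (X ≅ Y)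

/-- Finitary 2-categories. -/
class IsFinitaryBicategory (𝕜 : Type*) [Field 𝕜] (C : Type u) [Bicategory.{w, v} C]
    [∀ i j : C, Preadditive (i ⟶ j)] [∀ i j : C, Linear 𝕜 (i ⟶ j)] : Prop where
  finite_objects : Finite C
  finitary_hom (i j : C) : IsFinitary 𝕜 (i ⟶ j)
  indecomposable_id (i : C) :
    haveI := (finitary_hom i i).toHasFiniteBiproducts
    haveI := hasBinaryBiproducts_of_finite_biproducts (i ⟶ i)
    Indecomposable (𝟙 i)

/-- A weak involution `*` of `C` reversing 1-morphisms and 2-morphisms (a `𝕜`-linear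
pseudofunctor to the bicategory with both kinds of morphisms reversed which is the identity on
objects, with an isomorphism from its square to the identity), together with adjunctions
`F ⊣ F*`. -/
structure FiatStructure (𝕜 : Type*) [Field 𝕜] (C : Type u) [Bicategory.{w, v} C]
    [∀ i j : C, Preadditive (i ⟶ j)] [∀ i j : C, Linear 𝕜 (i ⟶ j)] where
  star {i j : C} (F : i ⟶ j) : j ⟶ i
  starMap {i j : C} {F G : i ⟶ j} (α : F ⟶ G) : star G ⟶ star F
  starMap_id {i j : C} (F : i ⟶ j) : starMap (𝟙 F) = 𝟙 (star F)
  starMap_comp {i j : C} {F G H : i ⟶ j} (α : F ⟶ G) (β : G ⟶ H) :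
    starMap (α ≫ β) = starMap β ≫ starMap α
  starMap_add {i j : C} {F G : i ⟶ j} (α β : F ⟶ G) : starMap (α + β) = starMap α + starMap β
  starMap_smul {i j : C} {F G : i ⟶ j} (c : 𝕜) (α : F ⟶ G) : starMap (c • α) = c • starMap α
  starId (i : C) : star (𝟙 i) ≅ 𝟙 i
  starComp {i j k : C} (F : i ⟶ j) (G : j ⟶ k) : star (F ≫ G) ≅ star G ≫ star F
  starMap_whiskerLeft {i j k : C} (F : i ⟶ j) {G H : j ⟶ k} (α : G ⟶ H) :
    starMap (F ◁ α) = (starComp F H).hom ≫ starMap α ▷ star F ≫ (starComp F G).inv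
  starMap_whiskerRight {i j k : C} {F G : i ⟶ j} (α : F ⟶ G) (H : j ⟶ k) :
    starMap (α ▷ H) = (starComp G H).hom ≫ star H ◁ starMap α ≫ (starComp F H).inv
  starMap_associator {i j k l : C} (F : i ⟶ j) (G : j ⟶ k) (H : k ⟶ l) :
    starMap (α_ F G H).hom = (starComp F (G ≫ H)).hom ≫ (starComp G H).hom ▷ star F ≫
      (α_ (star H) (star G) (star F)).hom ≫ star H ◁ (starComp F G).inv ≫
        (starComp (F ≫ G) H).inv
  starMap_leftUnitor {i j : C} (F : i ⟶ j) :
    starMap (λ_ F).hom = (ρ_ (star F)).inv ≫ star F ◁ (starId i).inv ≫ (starComp (𝟙 i) F).inv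
  starMap_rightUnitor {i j : C} (F : i ⟶ j) :
    starMap (ρ_ F).hom = (λ_ (star F)).inv ≫ (starId j).inv ▷ star F ≫ (starComp F (𝟙 j)).inv
  invol {i j : C} (F : i ⟶ j) : star (star F) ≅ F
  invol_naturality {i j : C} {F G : i ⟶ j} (α : F ⟶ G) :
    starMap (starMap α) ≫ (invol G).hom = (invol F).hom ≫ α
  invol_id (i : C) : (invol (𝟙 i)).hom = starMap (starId i).inv ≫ (starId i).hom
  invol_comp {i j k : C} (F : i ⟶ j) (G : j ⟶ k) :
    (invol (F ≫ G)).hom = starMap (starComp F G).inv ≫ (starComp (star G) (star F)).hom ≫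
      (invol F).hom ▷ star (star G) ≫ F ◁ (invol G).hom
  adj {i j : C} (F : i ⟶ j) : Bicategory.Adjunction F (star F)

/-- Fiat 2-categories. -/
class IsFiat (𝕜 : Type*) [Field 𝕜] (C : Type u) [Bicategory.{w, v} C]
    [∀ i j : C, Preadditive (i ⟶ j)] [∀ i j : C, Linear 𝕜 (i ⟶ j)] : Prop
    extends IsFinitaryBicategory 𝕜 C where
  nonempty_fiatStructure : Nonempty (FiatStructure 𝕜 C)

section Transitive

universe v' u'

variable {C : Type u} [Bicategory.{v, v} C]

/-- The additive closure `G_M(X)` of the objects `F X` inside a 2-representation `M`: the objects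
`Y` such that `Y` is a direct summand of `F_0 X ⊕ … ⊕ F_(n - 1) X` for some 1-morphisms `F_a`. -/
def generated (M : C ⥤ᵖ Cat.{v', u'}) [∀ i, Preadditive (M.obj i)] {i : C} (X : M.obj i) :
    M.ObjectProperty where
  prop j Y := ∃ (n : ℕ) (F : Fin n → (i ⟶ j)) (s : ∀ a, Y ⟶ (M.map (F a)).toFunctor.obj X)
    (r : ∀ a, (M.map (F a)).toFunctor.obj X ⟶ Y), ∑ a, s a ≫ r a = 𝟙 Y

theorem generated_isClosedUnderMapObj (𝕜 : Type w) [CommRing 𝕜]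
    [∀ i j : C, Preadditive (i ⟶ j)] [∀ i j : C, Linear 𝕜 (i ⟶ j)]
    (M : C ⥤ᵖ Cat.{v', u'}) [∀ i, Preadditive (M.obj i)] [∀ i, Linear 𝕜 (M.obj i)]
    [IsLinearRep 𝕜 M] {i : C} (X : M.obj i) :
    (generated M X).IsClosedUnderMapObj where
  map_obj {j k} Y := by
    rintro ⟨n, F, s, r, h⟩ G
    refine ⟨n, fun a => F a ≫ G,
      fun a => (M.map G).toFunctor.map (s a) ≫ (M.mapComp (F a) G).inv.toNatTrans.app X,
      fun a => (M.mapComp (F a) G).hom.toNatTrans.app X ≫ (M.map G).toFunctor.map (r a), ?_⟩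
    have := IsLinearRep.additive (𝕜 := 𝕜) (M := M) G
    rw [← (M.map G).toFunctor.map_id, ← h, Functor.map_sum]
    refine Finset.sum_congr rfl fun a _ => ?_
    simp

/-- Finitary transitive 2-representations: for each non-zero object `X`, the inclusion of the
2-subrepresentation `G_M(X)` into `M` is an equivalence. -/
class IsTransitive (𝕜 : Type w) [Field 𝕜]
    [∀ i j : C, Preadditive (i ⟶ j)] [∀ i j : C, Linear 𝕜 (i ⟶ j)]
    (M : C ⥤ᵖ Cat.{v', u'}) [∀ i, Preadditive (M.obj i)] [∀ i, Linear 𝕜 (M.obj i)]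
    [IsLinearRep 𝕜 M] : Prop where
  finitary (i : C) : IsFinitary 𝕜 (M.obj i)
  isEquivalence {i : C} (X : M.obj i) (hX : ¬ IsZero X) (j : C) :
    haveI := generated_isClosedUnderMapObj 𝕜 M X
    ((generated M X).ι.app j).toFunctor.IsEquivalence

end Transitive

/-! ### Internal homs -/

section InternalHom

universe v' u'

variable {B : Type u} [Bicategory.{w, v} B] (R : B ⥤ᵖ Cat.{w, u'})

/-- For an object `N` of a 2-representation `R`, the functor `F ↦ F N`. -/
@[simps]
def evalAt {i : B} (N : R.obj i) (j : B) : (i ⟶ j) ⥤ R.obj j where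
  obj F := (R.map F).toFunctor.obj N
  map α := (R.map₂ α).toNatTrans.app N
  map_id F := by simp
  map_comp α β := by simp

variable {R}

/-- The 1-morphism `H` is the internal hom from `N` to `X`: there is an isomorphism
`Hom(H, F) ≃ Hom(X, F N)`, natural in the 1-morphism `F`. -/
abbrev InternalHom {i j : B} (N : R.obj i) (X : R.obj j) (H : i ⟶ j) :=
  (evalAt R N j ⋙ coyoneda.obj (Opposite.op X)).CorepresentableBy H

/-- The coevaluation `X ⟶ H N`, corresponding to the identity of `H`. -/
def InternalHom.coev {i j : B} {N : R.obj i} {X : R.obj j} {H : i ⟶ j} (e : InternalHom N X H) :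
    X ⟶ (R.map H).toFunctor.obj N :=
  e.homEquiv (𝟙 H)

/-- The coalgebra structure on the internal hom `A` from `N` to `N` is the canonical one: the
comultiplication corresponds to `N ⟶ A N ⟶ A A N`, and the counit to the identity of `N`. -/
structure InternalHom.IsCanonicalCoalgebra {i : B} {N : R.obj i} {A : i ⟶ i}
    (e : InternalHom N N A) [Comonad A] : Prop where
  comul : e.coev ≫ (R.map₂ (Comonad.comul (t := A))).toNatTrans.app N ≫
      (R.mapComp A A).hom.toNatTrans.app N = e.coev ≫ (R.map A).toFunctor.map e.coev
  counit : e.coev ≫ (R.map₂ (Comonad.counit (t := A))).toNatTrans.app N ≫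
      (R.mapId i).hom.toNatTrans.app N = 𝟙 N

end InternalHom

section Theta

variable {B : Type u} [Bicategory.{w, v} B] {R : B ⥤ᵖ Cat.{w, max v w}}
  {C : Type*} [Bicategory C] {I : C ⥤ᵖ B} {i : B} {N : R.obj i} {A : i ⟶ i} [Comonad A]

/-- The comodule 1-morphism that a morphism of 2-representations assigns to an object. -/
def comodOf (Θ : I.comp R ⟶ I.comp (comod A)) {j : C} (X : R.obj (I.obj j)) :
    RightComod A (I.obj j) :=
  (Θ.app j).toFunctor.obj X

/-- The morphism of comodule 1-morphisms that a morphism of 2-representations assigns to a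
morphism. -/
def comodMap (Θ : I.comp R ⟶ I.comp (comod A)) {j : C} {X Y : R.obj (I.obj j)}
    (f : X ⟶ Y) : comodOf Θ X ⟶ comodOf Θ Y :=
  (Θ.app j).toFunctor.map f

/-- The isomorphism `Θ (F X) ≅ F Θ(X)` that is part of a morphism of 2-representations. -/
def comodNat (Θ : I.comp R ⟶ I.comp (comod A)) {j k : C} (F : j ⟶ k)
    (X : R.obj (I.obj j)) :
    comodOf Θ ((R.map (I.map F)).toFunctor.obj X) ⟶ (comodOf Θ X).act (I.map F) :=
  (Θ.naturality F).hom.toNatTrans.app X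

/-- A morphism of 2-representations `Θ` to the `A`-comodule 1-morphisms, where `A` is the internal
hom from `N` to `N`, is the functor `Hom(N, -)`: the underlying 1-morphism of `Θ X` is the
internal hom from `N` to `X`, for a morphism `f : X ⟶ Y` the morphism `Θ f` corresponds to
`X ⟶ Y ⟶ Hom(N, Y) N`, the coaction of `A` on `Hom(N, X)` corresponds to
`X ⟶ Hom(N, X) N ⟶ Hom(N, X) A N`, and the isomorphism `Hom(N, F X) ≅ F Hom(N, X)` to
`F X ⟶ F Hom(N, X) N`. -/
structure InternalHomTrans (e : InternalHom N N A)
    (Θ : I.comp R ⟶ I.comp (comod A)) where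
  hom {j : C} (X : R.obj (I.obj j)) : InternalHom N X (comodOf Θ X).obj
  map {j : C} {X Y : R.obj (I.obj j)} (f : X ⟶ Y) :
    (hom X).coev ≫ (R.map₂ (comodMap Θ f).hom).toNatTrans.app N = f ≫ (hom Y).coev
  coact {j : C} (X : R.obj (I.obj j)) :
    (hom X).coev ≫ (R.map₂ (comodOf Θ X).coact).toNatTrans.app N ≫
        (R.mapComp A (comodOf Θ X).obj).hom.toNatTrans.app N =
      (hom X).coev ≫ (R.map (comodOf Θ X).obj).toFunctor.map e.coev
  naturality {j k : C} (F : j ⟶ k) (X : R.obj (I.obj j)) :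
    (hom ((R.map (I.map F)).toFunctor.obj X)).coev ≫
        (R.map₂ (comodNat Θ F X).hom).toNatTrans.app N ≫
        (R.mapComp (comodOf Θ X).obj (I.map F)).hom.toNatTrans.app N =
      (R.map (I.map F)).toFunctor.map (hom X).coev

end Theta

/-- The property of being an injective object, for the objects of a 2-representation. -/
def injectiveObjects {C : Type*} [Bicategory C] (R : C ⥤ᵖ Cat) : R.ObjectProperty where
  prop _ X := Injective X

section Equivalence

universe v' u'

/-- The values of `I.comp R` inherit the additive structure. -/
instance {C : Type*} [Bicategory C] {B : Type*} [Bicategory B] (I : C ⥤ᵖ B)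
    (R : B ⥤ᵖ Cat.{v', u'}) [∀ j, Preadditive (R.obj j)] (j : C) :
    Preadditive ((I.comp R).obj j) :=
  inferInstanceAs (Preadditive (R.obj (I.obj j)))

instance {𝕜 : Type*} [CommRing 𝕜] {C : Type*} [Bicategory C] {B : Type*} [Bicategory B]
    (I : C ⥤ᵖ B) (R : B ⥤ᵖ Cat.{v', u'}) [∀ j, Preadditive (R.obj j)]
    [∀ j, Linear 𝕜 (R.obj j)] (j : C) : Linear 𝕜 ((I.comp R).obj j) :=
  inferInstanceAs (Linear 𝕜 (R.obj (I.obj j)))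

instance {B : Type u} [Bicategory.{w, v} B] {i : B} (A : i ⟶ i) [Comonad A]
    [∀ i j : B, Preadditive (i ⟶ j)] [PreadditiveBicategory B] (j : B) :
    Preadditive ((comod A).obj j) :=
  inferInstanceAs (Preadditive (RightComod A j))

instance {𝕜 : Type*} [CommRing 𝕜] {B : Type u} [Bicategory.{w, v} B] {i : B} (A : i ⟶ i)
    [Comonad A] [∀ i j : B, Preadditive (i ⟶ j)] [PreadditiveBicategory B]
    [∀ i j : B, Linear 𝕜 (i ⟶ j)] [LinearBicategory 𝕜 B] (j : B) :
    Linear 𝕜 ((comod A).obj j) :=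
  inferInstanceAs (Linear 𝕜 (RightComod A j))

instance {C : Type*} [Bicategory C] {R : C ⥤ᵖ Cat.{v', u'}} [∀ j, Preadditive (R.obj j)]
    (P : R.ObjectProperty) [P.IsClosedUnderMapObj] (j : C) :
    Preadditive (P.fullsubcategory.obj j) :=
  inferInstanceAs (Preadditive (P.prop j).FullSubcategory)

instance {𝕜 : Type*} [CommRing 𝕜] {C : Type*} [Bicategory C] {R : C ⥤ᵖ Cat.{v', u'}}
    [∀ j, Preadditive (R.obj j)] [∀ j, Linear 𝕜 (R.obj j)]
    (P : R.ObjectProperty) [P.IsClosedUnderMapObj] (j : C) :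
    Linear 𝕜 (P.fullsubcategory.obj j) :=
  inferInstanceAs (Linear 𝕜 (P.prop j).FullSubcategory)

/-- A morphism of `𝕜`-linear 2-representations is an equivalence if it is given by `𝕜`-linear
equivalences of categories. -/
structure IsRepEquivalence (𝕜 : Type*) [CommRing 𝕜] {C : Type*} [Bicategory C]
    {M M' : C ⥤ᵖ Cat.{v', u'}} [∀ j, Preadditive (M.obj j)] [∀ j, Linear 𝕜 (M.obj j)]
    [∀ j, Preadditive (M'.obj j)] [∀ j, Linear 𝕜 (M'.obj j)] (Φ : M ⟶ M') : Prop where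
  isEquivalence (j : C) : (Φ.app j).toFunctor.IsEquivalence
  additive (j : C) : (Φ.app j).toFunctor.Additive
  linear (j : C) : (Φ.app j).toFunctor.Linear 𝕜

end Equivalence

end

/-! An internal hom from `N` to `X` is the same thing as a universal morphism `t : X ⟶ H N`, one
through which every `X ⟶ F N` factors by a unique 2-morphism `H ⟶ F` (`IsUniversal`). All structure
on internal homs (comultiplication, counit, coactions, functoriality, compatibility with the action)
is defined by such factorizations, and every axiom is checked after composing with `t`. Note that `A
≫ H` is the composite `H A` in the order of functions.

Existence. On 1-morphisms `F` of the original bicategory, `F ↦ Hom(X, F N)` is a linear functor on a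
finitary category with finite dimensional values. Since a finitary category has a generator `G`,
this functor has a finite presentation by functors `Hom(G ⊕ … ⊕ G, -)`, and such a presentation is
exactly a formal kernel, that is, an object of the abelianization
(`PreservesFormalKernels.exists_universal`). Evaluation at `N` preserves formal kernels, so
universality against the original 1-morphisms implies universality against all 1-morphisms of the
abelianization.

Compatibility with the action. If `F` has a right adjoint `F'`, then `Hom(F H, G) ≅ Hom(H, F' G) ≅
Hom(X, F' G N) ≅ Hom(F X, G N)`, so `F t` is again universal (`IsUniversal.ext`). In the case `X =
N` this extends to all formal kernels `F` by comparing presentations: `F A` is the internal hom from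
`N` to `F N` (`isUniversal_ext`).

Equivalence. This is an argument in the style of the comonadicity theorem. For a comodule `Y`, let
`E` be the kernel of the difference of the two morphisms `Y N ⟶ Y A N` given by the coaction and by
`N ⟶ A N`. Objects of `M` are injective in the abelianization, so `Hom(E, G N)` is the cokernel of
`Hom(Y A N, G N) ⟶ Hom(Y N, G N)`, which is that of `Hom(Y A A, G) ⟶ Hom(Y A, G)`. The coaction and
the counit split this diagram, and the cokernel is `Hom(Y, G)`. Hence `Y` is the internal hom from
`N` to `E` (`exists_comodule_kernel`), which gives essential surjectivity. By transitivity every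
object of `M` is a summand of a finite sum of objects `F N`, so morphisms to the objects `F N`
detect isomorphisms (`isIso_of_isUniversal`). Therefore every `X` is itself the kernel attached to
its internal hom, and the functor is fully faithful.

Injectives. Up to isomorphism, the injective objects of the abelianization of an idempotent complete
category are the objects of the category itself. Transporting this along the equivalence gives the
last claim. -/

noncomputable section

/-! ### Evaluating 2-representations at an object -/

namespace RepEval

universe v' u'

variable {B : Type u} [Bicategory.{w, v} B] {R : B ⥤ᵖ Cat.{v', u'}}

section

variable {i j : B}

lemma map₂_id_app (F : i ⟶ j) (X : R.obj i) :
    (R.map₂ (𝟙 F)).toNatTrans.app X = 𝟙 _ := by simp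

lemma map₂_comp_app {F G H : i ⟶ j} (α : F ⟶ G) (β : G ⟶ H) (X : R.obj i) :
    (R.map₂ (α ≫ β)).toNatTrans.app X =
      (R.map₂ α).toNatTrans.app X ≫ (R.map₂ β).toNatTrans.app X := by simp

lemma map₂_naturality {F G : i ⟶ j} (α : F ⟶ G) {X Y : R.obj i} (f : X ⟶ Y) :
    (R.map F).toFunctor.map f ≫ (R.map₂ α).toNatTrans.app Y =
      (R.map₂ α).toNatTrans.app X ≫ (R.map G).toFunctor.map f :=
  (R.map₂ α).toNatTrans.naturality f

lemma mapComp_hom_inv_app {k : B} (F : i ⟶ j) (G : j ⟶ k) (X : R.obj i) :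
    (R.mapComp F G).hom.toNatTrans.app X ≫ (R.mapComp F G).inv.toNatTrans.app X = 𝟙 _ := by
  simp

lemma mapComp_inv_hom_app {k : B} (F : i ⟶ j) (G : j ⟶ k) (X : R.obj i) :
    (R.mapComp F G).inv.toNatTrans.app X ≫ (R.mapComp F G).hom.toNatTrans.app X = 𝟙 _ := by
  simp

lemma mapComp_hom_naturality {k : B} (F : i ⟶ j) (G : j ⟶ k) {X Y : R.obj i} (f : X ⟶ Y) :
    (R.map (F ≫ G)).toFunctor.map f ≫ (R.mapComp F G).hom.toNatTrans.app Y =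
    (R.mapComp F G).hom.toNatTrans.app X ≫
      (R.map G).toFunctor.map ((R.map F).toFunctor.map f) :=
  (R.mapComp F G).hom.toNatTrans.naturality f

lemma mapComp_inv_whiskerRight {k : B} {F G : i ⟶ j} (α : F ⟶ G) (H : j ⟶ k) (X : R.obj i) :
    (R.mapComp F H).inv.toNatTrans.app X ≫ (R.map₂ (α ▷ H)).toNatTrans.app X =
      (R.map H).toFunctor.map ((R.map₂ α).toNatTrans.app X) ≫
        (R.mapComp G H).inv.toNatTrans.app X := by
  rw [R.map₂_whisker_right]
  simp

lemma mapComp_inv_whiskerLeft {k : B} (F : i ⟶ j) {G H : j ⟶ k} (α : G ⟶ H) (X : R.obj i) :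
    (R.mapComp F G).inv.toNatTrans.app X ≫ (R.map₂ (F ◁ α)).toNatTrans.app X =
      (R.map₂ α).toNatTrans.app ((R.map F).toFunctor.obj X) ≫
        (R.mapComp F H).inv.toNatTrans.app X := by
  rw [R.map₂_whisker_left]
  simp

/-- The associativity coherence of the pseudofunctor at one object, arranged for use in `ext_comp`.
-/
lemma mapComp_inv_associator {k l : B} (F : i ⟶ j) (G : j ⟶ k) (H : k ⟶ l) (X : R.obj i) :
    (R.mapComp G H).hom.toNatTrans.app ((R.map F).toFunctor.obj X) ≫
      (R.map H).toFunctor.map ((R.mapComp F G).inv.toNatTrans.app X) ≫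
        (R.mapComp (F ≫ G) H).inv.toNatTrans.app X ≫ (R.map₂ (α_ F G H).hom).toNatTrans.app X =
      (R.mapComp F (G ≫ H)).inv.toNatTrans.app X := by
  rw [R.map₂_associator]
  simp [← Functor.map_comp_assoc]

end

/-! ### Calculus of the morphisms `F X ⟶ (F H) N`. -/

section Ext

variable {i j k l : B} {N : R.obj i}

/-- Acting by `F` on a morphism `t : X ⟶ H N` gives a morphism `F X ⟶ (F H) N`. -/
def ext {X : R.obj j} {H : i ⟶ j} (t : X ⟶ (R.map H).toFunctor.obj N) (F : j ⟶ k) :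
    (R.map F).toFunctor.obj X ⟶ (R.map (H ≫ F)).toFunctor.obj N :=
  (R.map F).toFunctor.map t ≫ (R.mapComp H F).inv.toNatTrans.app N

lemma ext_mapComp_hom {X : R.obj j} {H : i ⟶ j} (t : X ⟶ (R.map H).toFunctor.obj N)
    (F : j ⟶ k) : ext t F ≫ (R.mapComp H F).hom.toNatTrans.app N =
      (R.map F).toFunctor.map t := by
  rw [ext, Category.assoc, mapComp_inv_hom_app]
  exact Category.comp_id _

lemma comp_ext {X Y : R.obj j} {H : i ⟶ j} (f : X ⟶ Y) (t : Y ⟶ (R.map H).toFunctor.obj N)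
    (F : j ⟶ k) : ext (f ≫ t) F = (R.map F).toFunctor.map f ≫ ext t F := by
  simp [ext]

lemma ext_whiskerRight {X : R.obj j} {H H' : i ⟶ j} (t : X ⟶ (R.map H).toFunctor.obj N)
    (φ : H ⟶ H') (F : j ⟶ k) :
    ext t F ≫ (R.map₂ (φ ▷ F)).toNatTrans.app N = ext (t ≫ (R.map₂ φ).toNatTrans.app N) F := by
  simp only [ext, Category.assoc, Functor.map_comp]
  rw [mapComp_inv_whiskerRight]

/-- The interchange law for `ext`: a 2-morphism between the acting 1-morphisms may be applied before
or after extending `t`. With `c : N ⟶ A N` in place of `t`, it says that `ext c F` is natural in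
`F`. -/
lemma ext_whiskerLeft {X : R.obj j} {H : i ⟶ j} (t : X ⟶ (R.map H).toFunctor.obj N)
    {F G : j ⟶ k} (α : F ⟶ G) :
    ext t F ≫ (R.map₂ (H ◁ α)).toNatTrans.app N = (R.map₂ α).toNatTrans.app X ≫ ext t G := by
  simp only [ext, Category.assoc]
  rw [mapComp_inv_whiskerLeft, ← Category.assoc, map₂_naturality, Category.assoc]

lemma ext_comp {X : R.obj j} {H : i ⟶ j} (t : X ⟶ (R.map H).toFunctor.obj N)
    (F : j ⟶ k) (G : k ⟶ l) :
    ext t (F ≫ G) = (R.mapComp F G).hom.toNatTrans.app X ≫ ext (ext t F) G ≫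
      (R.map₂ (α_ H F G).hom).toNatTrans.app N := by
  simp only [ext, Category.assoc, Functor.map_comp]
  rw [← mapComp_inv_associator, ← Category.assoc, mapComp_hom_naturality, Category.assoc]

lemma ext_ext {X : R.obj j} {H : i ⟶ j} (t : X ⟶ (R.map H).toFunctor.obj N)
    (F : j ⟶ k) (G : k ⟶ l) :
    ext (ext t F) G = (R.mapComp F G).inv.toNatTrans.app X ≫ ext t (F ≫ G) ≫
      (R.map₂ (α_ H F G).inv).toNatTrans.app N := by
  rw [ext_comp]
  simp only [Category.assoc]
  rw [← map₂_comp_app, Iso.hom_inv_id, map₂_id_app, Category.comp_id, ← Category.assoc,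
    mapComp_inv_hom_app, Category.id_comp]

lemma ext_id {X : R.obj j} {H : i ⟶ j} (t : X ⟶ (R.map H).toFunctor.obj N) :
    ext t (𝟙 j) ≫ (R.map₂ (ρ_ H).hom).toNatTrans.app N =
      (R.mapId j).hom.toNatTrans.app X ≫ t := by
  rw [R.map₂_right_unitor]
  simp [ext]

variable (N) in
/-- The canonical morphism from `N` to the action of the identity on `N`. -/
def unit : N ⟶ (R.map (𝟙 i)).toFunctor.obj N := (R.mapId i).inv.toNatTrans.app N

lemma ext_unit (F : i ⟶ j) :
    ext (unit N) F ≫ (R.map₂ (λ_ F).hom).toNatTrans.app N = 𝟙 _ := by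
  rw [R.map₂_left_unitor]
  simp [ext, unit, ← Functor.map_comp]

end Ext

end RepEval

/-! ### Universal morphisms -/

namespace RepEval

section Universal

universe v' u'

variable {B : Type u} [Bicategory.{w, v} B] {R : B ⥤ᵖ Cat.{v', u'}} {i j k l : B} {N : R.obj i}

/-- A morphism `t : X ⟶ H N` is universal if every morphism `X ⟶ F N` factors through `t` by a
unique 2-morphism `H ⟶ F`. -/
def IsUniversal {X : R.obj j} {H : i ⟶ j} (t : X ⟶ (R.map H).toFunctor.obj N) : Prop :=
  ∀ F : i ⟶ j, Function.Bijective fun φ : H ⟶ F => t ≫ (R.map₂ φ).toNatTrans.app N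

namespace IsUniversal

variable {X : R.obj j} {H : i ⟶ j} {t : X ⟶ (R.map H).toFunctor.obj N}

/-- The 2-morphism induced by a universal morphism. -/
def desc (ht : IsUniversal t) {F : i ⟶ j} (y : X ⟶ (R.map F).toFunctor.obj N) : H ⟶ F :=
  ((ht F).2 y).choose

lemma fac (ht : IsUniversal t) {F : i ⟶ j} (y : X ⟶ (R.map F).toFunctor.obj N) :
    t ≫ (R.map₂ (ht.desc y)).toNatTrans.app N = y :=
  ((ht F).2 y).choose_spec

lemma hom_ext (ht : IsUniversal t) {F : i ⟶ j} {φ ψ : H ⟶ F}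
    (h : t ≫ (R.map₂ φ).toNatTrans.app N = t ≫ (R.map₂ ψ).toNatTrans.app N) : φ = ψ :=
  (ht F).1 h

lemma fac_assoc (ht : IsUniversal t) {F : i ⟶ j} (y : X ⟶ (R.map F).toFunctor.obj N)
    {Z : R.obj j} (z : (R.map F).toFunctor.obj N ⟶ Z) :
    t ≫ (R.map₂ (ht.desc y)).toNatTrans.app N ≫ z = y ≫ z := by
  rw [← Category.assoc, ht.fac]

lemma desc_comp_desc (ht : IsUniversal t) {Y : R.obj j} {G : i ⟶ j}
    {s : Y ⟶ (R.map G).toFunctor.obj N} (hs : IsUniversal s) {F : i ⟶ j} (f : X ⟶ Y)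
    (y : Y ⟶ (R.map F).toFunctor.obj N) :
    ht.desc (f ≫ s) ≫ hs.desc y = ht.desc (f ≫ y) := by
  apply ht.hom_ext
  rw [map₂_comp_app, ht.fac_assoc, ht.fac, Category.assoc, hs.fac]

/-- Objects with a universal morphism from the same object are isomorphic. -/
def iso (ht : IsUniversal t) {G : i ⟶ j} {s : X ⟶ (R.map G).toFunctor.obj N}
    (hs : IsUniversal s) : H ≅ G where
  hom := ht.desc s
  inv := hs.desc t
  hom_inv_id := ht.hom_ext (by
    rw [map₂_comp_app, ht.fac_assoc, hs.fac, map₂_id_app, Category.comp_id])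
  inv_hom_id := hs.hom_ext (by
    rw [map₂_comp_app, hs.fac_assoc, ht.fac, map₂_id_app, Category.comp_id])

/-- If `F` has a right adjoint, then the action of `F` preserves universal morphisms. -/
theorem ext (ht : IsUniversal t) {F : j ⟶ k} {F' : k ⟶ j} (adj : Bicategory.Adjunction F F') :
    IsUniversal (RepEval.ext t F) := by
  -- The adjunction in the bicategory induces one between the categories of the 2-representation.
  -- Its unit and counit are spelled out through the 2-morphisms, so that the `ext` calculus applies
  -- to them.
  have hη (X : R.obj j) :
      (Adjunction.ofCat (R.mapAdjunction adj)).unit.app X =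
        (R.mapId j).inv.toNatTrans.app X ≫ (R.map₂ adj.unit).toNatTrans.app X ≫
          (R.mapComp F F').hom.toNatTrans.app X := by
    simp [Pseudofunctor.mapAdjunction]
  have hε (Y : R.obj k) :
      (Adjunction.ofCat (R.mapAdjunction adj)).counit.app Y =
        (R.mapComp F' F).inv.toNatTrans.app Y ≫ (R.map₂ adj.counit).toNatTrans.app Y ≫
          (R.mapId k).hom.toNatTrans.app Y := by
    simp [Pseudofunctor.mapAdjunction]
  intro G
  constructor
  · intro φ ψ h
    refine (adj.homEquiv₂ (g := H) (h := G)).injective (ht.hom_ext ?_)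
    -- The transpose of `χ` depends, after composing with `t`, only on `ext t F ≫ χ`. Injectivity
    -- follows, since both transposition and composition with `t` are injective.
    have key (χ : H ≫ F ⟶ G) :
        t ≫ (R.map₂ (adj.homEquiv₂ χ)).toNatTrans.app N =
          (R.mapId j).inv.toNatTrans.app X ≫ (R.map₂ adj.unit).toNatTrans.app X ≫
            (R.mapComp F F').hom.toNatTrans.app X ≫
              RepEval.ext (RepEval.ext t F ≫ (R.map₂ χ).toNatTrans.app N) F' := by
      have h₁ : t ≫ (R.map₂ (ρ_ H).inv).toNatTrans.app N =
          (R.mapId j).inv.toNatTrans.app X ≫ RepEval.ext t (𝟙 j) := by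
        have h₃ : t = (R.mapId j).inv.toNatTrans.app X ≫ RepEval.ext t (𝟙 j) ≫
            (R.map₂ (ρ_ H).hom).toNatTrans.app N := by
          rw [ext_id, ← Category.assoc, Cat.Hom.inv_hom_id_toNatTrans_app]
          exact (Category.id_comp t).symm
        nth_rw 1 [h₃]
        simp only [Category.assoc]
        rw [← map₂_comp_app, Iso.hom_inv_id, map₂_id_app, Category.comp_id]
      rw [Adjunction.homEquiv₂_apply]
      simp only [map₂_comp_app]
      rw [← Category.assoc t, h₁, ← ext_whiskerRight, ext_ext]
      simp only [Category.assoc]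
      rw [← Category.assoc (RepEval.ext t (𝟙 j)), ext_whiskerLeft, Category.assoc,
        ← Category.assoc ((R.mapComp F F').hom.toNatTrans.app X), mapComp_hom_inv_app,
        Category.id_comp]
    rw [key, key]
    exact congr(_ ≫ _ ≫ _ ≫ RepEval.ext $h F')
  · intro y
    -- The preimage of `y : F X ⟶ G N`: transpose `y` to `X ⟶ F' G N`, factor through `t`, and
    -- transpose the resulting 2-morphism `H ⟶ F' G` back.
    refine ⟨(adj.homEquiv₂ (g := H) (h := G)).symm (ht.desc
      ((Adjunction.ofCat (R.mapAdjunction adj)).unit.app X ≫ RepEval.ext y F')), ?_⟩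
    dsimp only
    rw [Adjunction.homEquiv₂_symm_apply]
    simp only [map₂_comp_app]
    rw [← Category.assoc, ext_whiskerRight, ht.fac, comp_ext, ext_ext]
    simp only [Category.assoc]
    rw [← Category.assoc ((R.map₂ (α_ G F' F).inv).toNatTrans.app N), ← map₂_comp_app,
      Iso.inv_hom_id, map₂_id_app, Category.id_comp, ← Category.assoc (RepEval.ext y (F' ≫ F)),
      ext_whiskerLeft, Category.assoc, ext_id]
    -- What remains of the composite is `y` preceded by the unit and the counit, which cancel by the
    -- triangle identity.
    have := (Adjunction.ofCat (R.mapAdjunction adj)).left_triangle_components X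
    have := congr($this ≫ y)
    rw [hε] at this
    simp only [Category.assoc, Category.id_comp] at this
    exact this

end IsUniversal

/-- Universal morphisms are internal homs. -/
def IsUniversal.internalHom {R : B ⥤ᵖ Cat.{w, u'}} {N : R.obj i} {X : R.obj j} {H : i ⟶ j}
    {t : X ⟶ (R.map H).toFunctor.obj N} (ht : IsUniversal t) : InternalHom N X H where
  homEquiv {F} := Equiv.ofBijective _ (ht F)
  homEquiv_comp φ ψ := by
    change t ≫ (R.map₂ (ψ ≫ φ)).toNatTrans.app N = (t ≫ _) ≫ (R.map₂ φ).toNatTrans.app N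
    rw [map₂_comp_app, Category.assoc]

lemma IsUniversal.internalHom_coev {R : B ⥤ᵖ Cat.{w, u'}} {N : R.obj i} {X : R.obj j}
    {H : i ⟶ j} {t : X ⟶ (R.map H).toFunctor.obj N} (ht : IsUniversal t) :
    ht.internalHom.coev = t := by
  change t ≫ (R.map₂ (𝟙 H)).toNatTrans.app N = t
  rw [map₂_id_app, Category.comp_id]

/-- By the Yoneda lemma, the given natural bijection is composition with the image of the identity.
-/
lemma isUniversal_coev {R : B ⥤ᵖ Cat.{w, u'}} {N : R.obj i} {X : R.obj j} {H : i ⟶ j}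
    (e : InternalHom N X H) : IsUniversal e.coev := by
  intro F
  have h : (fun φ : H ⟶ F => e.coev ≫ (R.map₂ φ).toNatTrans.app N) = e.homEquiv (Y := F) := by
    funext φ
    have := e.homEquiv_comp φ (𝟙 H)
    rw [Category.id_comp] at this
    exact this.symm
  rw [h]
  exact e.homEquiv.bijective

end Universal

end RepEval

/-! ### The coalgebra and comodules given by universal morphisms -/

namespace RepEval

universe v' u'

section Coalgebra

variable {B : Type u} [Bicategory.{w, v} B] {R : B ⥤ᵖ Cat.{v', u'}} {i j k l : B} {N : R.obj i}
  {A : i ⟶ i} {c : N ⟶ (R.map A).toFunctor.obj N}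

/-- Up to an associator, applying `F` to `X ⟶ H N ⟶ H A N` gives `F X ⟶ F H N ⟶ F H A N`. This
drives coassociativity and the compatibility of coactions with the action of `F`. -/
lemma map_comp_ext {X : R.obj j} {H : i ⟶ j} (F : j ⟶ k)
    (t : X ⟶ (R.map H).toFunctor.obj N) (c : N ⟶ (R.map A).toFunctor.obj N) :
    ext (t ≫ ext c H) F = ext t F ≫ ext c (H ≫ F) ≫
      (R.map₂ (α_ A H F).inv).toNatTrans.app N := by
  rw [comp_ext, ext_ext, ← Category.assoc ((R.map F).toFunctor.map t)]
  rfl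

/-- The coaction on the internal hom induced by `X ⟶ H N ⟶ H A N`. -/
def IsUniversal.coact {X : R.obj j} {H : i ⟶ j} {t : X ⟶ (R.map H).toFunctor.obj N}
    (ht : IsUniversal t) (c : N ⟶ (R.map A).toFunctor.obj N) : H ⟶ A ≫ H :=
  ht.desc (t ≫ RepEval.ext c H)

/-- The comonad given by a universal morphism. -/
abbrev IsUniversal.comonad (hc : IsUniversal c) : Comonad A :=
  have comul : c ≫ (R.map₂ (hc.coact c)).toNatTrans.app N = c ≫ RepEval.ext c A := hc.fac _
  have counit : c ≫ (R.map₂ (hc.desc (unit N))).toNatTrans.app N = unit N := hc.fac _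
  { comul := hc.coact c
    counit := hc.desc (unit N)
    counit_comul := by
      change hc.coact c ≫ hc.desc (unit N) ▷ A = (λ_ A).inv
      rw [← cancel_mono (λ_ A).hom, Iso.inv_hom_id]
      apply hc.hom_ext
      simp only [map₂_comp_app, map₂_id_app, Category.comp_id]
      rw [← Category.assoc, ← Category.assoc, comul, Category.assoc c, ext_whiskerRight, counit,
        Category.assoc, ext_unit, Category.comp_id]
    comul_counit := by
      change hc.coact c ≫ A ◁ hc.desc (unit N) = (ρ_ A).inv
      rw [← cancel_mono (ρ_ A).hom, Iso.inv_hom_id]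
      apply hc.hom_ext
      simp only [map₂_comp_app, map₂_id_app, Category.comp_id]
      rw [← Category.assoc, ← Category.assoc, comul, Category.assoc c, ext_whiskerLeft,
        ← Category.assoc, counit, Category.assoc, ext_id, unit, ← Category.assoc,
        Cat.Hom.inv_hom_id_toNatTrans_app]
      exact Category.id_comp c
    comul_assoc := by
      change hc.coact c ≫ A ◁ hc.coact c = hc.coact c ≫ hc.coact c ▷ A ≫ (α_ A A A).hom
      -- After composing with `c`, both sides become the iterated morphism `N ⟶ A N ⟶ A A N ⟶ A A A
      -- N`.
      apply hc.hom_ext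
      simp only [map₂_comp_app]
      rw [← Category.assoc c, ← Category.assoc c, comul, Category.assoc c, Category.assoc c,
        ext_whiskerLeft, ← Category.assoc c, comul, ← Category.assoc (RepEval.ext c A),
        ext_whiskerRight, comul, map_comp_ext]
      simp only [Category.assoc]
      rw [← map₂_comp_app, Iso.inv_hom_id, map₂_id_app, Category.comp_id] }

/-- The morphism `c : N ⟶ A N` is compatible with the coalgebra structure of `A`, that is, it
makes `N` a comodule. -/
structure IsCanonical (c : N ⟶ (R.map A).toFunctor.obj N) [Comonad A] : Prop where
  comul : c ≫ (R.map₂ (Comonad.comul (t := A))).toNatTrans.app N = c ≫ ext c A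
  counit : c ≫ (R.map₂ (Comonad.counit (t := A))).toNatTrans.app N = unit N

lemma IsUniversal.isCanonical (hc : IsUniversal c) :
    letI := hc.comonad
    IsCanonical c :=
  letI := hc.comonad
  { comul := hc.fac _
    counit := hc.fac _ }

variable [Comonad A]

/-- With `ext_counit`, this is the comodule structure of `N` after acting by an arbitrary `H`. -/
lemma IsCanonical.ext_comul (hcan : IsCanonical c) (H : i ⟶ j) :
    ext c H ≫ (R.map₂ (Comonad.comul (t := A) ▷ H)).toNatTrans.app N ≫
      (R.map₂ (α_ A A H).hom).toNatTrans.app N = ext c H ≫ ext c (A ≫ H) := by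
  rw [← Category.assoc, ext_whiskerRight, hcan.comul, map_comp_ext]
  simp only [Category.assoc]
  rw [← map₂_comp_app, Iso.inv_hom_id, map₂_id_app, Category.comp_id]

lemma IsCanonical.ext_counit (hcan : IsCanonical c) (H : i ⟶ j) :
    ext c H ≫ (R.map₂ (Comonad.counit (t := A) ▷ H)).toNatTrans.app N ≫
      (R.map₂ (λ_ H).hom).toNatTrans.app N = 𝟙 _ := by
  rw [← Category.assoc, ext_whiskerRight, hcan.counit, ext_unit]

/-- The comodule 1-morphism given by an internal hom. -/
abbrev comodule (hcan : IsCanonical c) {X : R.obj j} {H : i ⟶ j}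
    {t : X ⟶ (R.map H).toFunctor.obj N} (ht : IsUniversal t) : RightComod A j where
  obj := H
  coact := ht.coact c
  coassoc := by
    have coact : t ≫ (R.map₂ (ht.coact c)).toNatTrans.app N = t ≫ ext c H := ht.fac _
    apply ht.hom_ext
    simp only [map₂_comp_app]
    rw [← Category.assoc t, ← Category.assoc t, coact, Category.assoc t, Category.assoc t,
      ext_whiskerLeft, ← Category.assoc t, coact, hcan.ext_comul, Category.assoc]
  counit := by
    have coact : t ≫ (R.map₂ (ht.coact c)).toNatTrans.app N = t ≫ ext c H := ht.fac _
    apply ht.hom_ext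
    simp only [map₂_comp_app, map₂_id_app, Category.comp_id]
    rw [← Category.assoc t, coact, Category.assoc t, hcan.ext_counit, Category.comp_id]

/-- A 2-morphism between comodule 1-morphisms `H` and `H'`, where `H` is an internal hom from `N`
to `X`, is a morphism of comodules if the corresponding morphism `X ⟶ H' N` equalizes the two
morphisms to `H' A N`. -/
lemma comm_of_isUniversal (hcan : IsCanonical c) {X : R.obj j} {H : i ⟶ j}
    {t : X ⟶ (R.map H).toFunctor.obj N} (ht : IsUniversal t) (Y : RightComod A j)
    (φ : H ⟶ Y.obj)
    (h : t ≫ (R.map₂ φ).toNatTrans.app N ≫ (R.map₂ Y.coact).toNatTrans.app N =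
      t ≫ (R.map₂ φ).toNatTrans.app N ≫ ext c Y.obj) :
    φ ≫ Y.coact = (comodule hcan ht).coact ≫ A ◁ φ := by
  have coact : t ≫ (R.map₂ (ht.coact c)).toNatTrans.app N = t ≫ ext c H := ht.fac _
  apply ht.hom_ext
  simp only [map₂_comp_app]
  rw [h, ← ext_whiskerLeft, ← Category.assoc t, ← coact, Category.assoc t]

lemma comodule_coact_fac (hcan : IsCanonical c) {X : R.obj j} {H : i ⟶ j}
    {t : X ⟶ (R.map H).toFunctor.obj N} (ht : IsUniversal t) :
    t ≫ (R.map₂ (comodule hcan ht).coact).toNatTrans.app N = t ≫ ext c H := ht.fac _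

end Coalgebra

/-! ### The functor of internal homs and its compatibility with the action, for a chosen internal
hom of each object. -/

section Theta

variable {B : Type u} [Bicategory.{w, v} B] {R : B ⥤ᵖ Cat.{w, max v w}}
  {C : Type*} [Bicategory C] {I : C ⥤ᵖ B} {i : B} {N : R.obj i} {A : i ⟶ i} [Comonad A]
  {c : N ⟶ (R.map A).toFunctor.obj N} (hcan : IsCanonical c)
  {H : ∀ {j : C} (_ : R.obj (I.obj j)), i ⟶ I.obj j}
  {t : ∀ {j : C} (X : R.obj (I.obj j)), X ⟶ (R.map (H X)).toFunctor.obj N}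
  (ht : ∀ {j : C} (X : R.obj (I.obj j)), IsUniversal (t X))
  (hext : ∀ {j k : C} (F : j ⟶ k) (X : R.obj (I.obj j)), IsUniversal (ext (t X) (I.map F)))

/-- The functor `X ↦ Hom(N, X)` with values in comodule 1-morphisms. -/
def homFunctor (j : C) : R.obj (I.obj j) ⥤ RightComod A (I.obj j) where
  obj X := comodule hcan (ht X)
  map {X Y} f := ⟨(ht X).desc (f ≫ t Y), comm_of_isUniversal hcan (ht X) (comodule hcan (ht Y)) _
    -- Both composites are `X ⟶ Y ⟶ H(Y) N ⟶ H(Y) A N`, because the coaction on `H(Y)` is `ext c`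
    -- after `t Y`.
    (by
      have h := comodule_coact_fac hcan (ht Y)
      rw [← Category.assoc, ← Category.assoc, (ht X).fac, Category.assoc, h, Category.assoc])⟩
  map_id X := RightComod.Hom.ext ((ht X).hom_ext (by
    rw [(ht X).fac]
    change _ = t X ≫ (R.map₂ (𝟙 (H X))).toNatTrans.app N
    rw [map₂_id_app, Category.comp_id, Category.id_comp]))
  map_comp {X Y Z} f g := RightComod.Hom.ext (by
    exact congr((ht X).desc $(Category.assoc f g (t Z))).trans
      ((ht X).desc_comp_desc (ht Y) f (g ≫ t Z)).symm)

/-- The isomorphism `Hom(N, F X) ≅ F Hom(N, X)`. -/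
def homNatIso {j k : C} (F : j ⟶ k) :
    (R.map (I.map F)).toFunctor ⋙ homFunctor (I := I) hcan ht k ≅
      homFunctor (I := I) hcan ht j ⋙ RightComod.actFunctor (I.map F) :=
  NatIso.ofComponents
    (fun X => RightComod.isoMk (X := comodule hcan (ht ((R.map (I.map F)).toFunctor.obj X)))
      (Y := (comodule hcan (ht X)).act (I.map F))
      ((ht ((R.map (I.map F)).toFunctor.obj X)).iso (hext F X))
      (comm_of_isUniversal hcan (ht _) ((comodule hcan (ht X)).act (I.map F)) _ (by
        change t ((R.map (I.map F)).toFunctor.obj X) ≫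
          (R.map₂ ((ht ((R.map (I.map F)).toFunctor.obj X)).desc
            (ext (t X) (I.map F)))).toNatTrans.app N ≫
          (R.map₂ ((ht X).coact c ▷ I.map F ≫ (α_ A (H X) (I.map F)).hom)).toNatTrans.app N = _
        rw [(ht _).fac_assoc, map₂_comp_app, ← Category.assoc, ext_whiskerRight]
        rw [IsUniversal.coact, (ht X).fac, map_comp_ext]
        erw [(ht ((R.map (I.map F)).toFunctor.obj X)).fac_assoc]
        simp only [Category.assoc]
        rw [← map₂_comp_app, Iso.inv_hom_id, map₂_id_app, Category.comp_id])))
    (by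
      intro X Y f
      apply RightComod.Hom.ext
      apply (ht _).hom_ext
      change _ ≫ (R.map₂ ((ht ((R.map (I.map F)).toFunctor.obj X)).desc
        ((R.map (I.map F)).toFunctor.map f ≫ t _) ≫ (ht _).desc (ext (t Y) _))).toNatTrans.app N =
        _ ≫ (R.map₂ ((ht ((R.map (I.map F)).toFunctor.obj X)).desc (ext (t X) (I.map F)) ≫
          (ht X).desc (f ≫ t Y) ▷ I.map F)).toNatTrans.app N
      rw [map₂_comp_app, map₂_comp_app, (ht _).fac_assoc, (ht _).fac_assoc, Category.assoc,
        (ht _).fac, ext_whiskerRight, (ht X).fac, comp_ext])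

end Theta

end RepEval

/-! ### Internal homs as a morphism of 2-representations. -/

namespace RepEval

universe v' u'

section Theta

variable {B : Type u} [Bicategory.{w, v} B] {R : B ⥤ᵖ Cat.{w, max v w}}
  {C : Type*} [Bicategory C] {I : C ⥤ᵖ B} {i : B} {N : R.obj i} {A : i ⟶ i} [Comonad A]
  {c : N ⟶ (R.map A).toFunctor.obj N} (hcan : IsCanonical c)
  {H : ∀ {j : C} (_ : R.obj (I.obj j)), i ⟶ I.obj j}
  {t : ∀ {j : C} (X : R.obj (I.obj j)), X ⟶ (R.map (H X)).toFunctor.obj N}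
  (ht : ∀ {j : C} (X : R.obj (I.obj j)), IsUniversal (t X))
  (hext : ∀ {j k : C} (F : j ⟶ k) (X : R.obj (I.obj j)), IsUniversal (ext (t X) (I.map F)))

/-- This lemma and the next two are the coherence axioms of a strong transformation, read off on
underlying 1-morphisms. Each compares 2-morphisms out of an internal hom, hence can be tested after
the universal morphism. -/
lemma desc_whiskerLeft {j k : C} {F G : j ⟶ k} (η : F ⟶ G) (X : R.obj (I.obj j)) :
    (ht _).desc ((R.map₂ (I.map₂ η)).toNatTrans.app X ≫ t _) ≫
        (ht _).desc (ext (t X) (I.map G)) =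
      (ht _).desc (ext (t X) (I.map F)) ≫ H X ◁ I.map₂ η := by
  rw [(ht _).desc_comp_desc (ht _)]
  apply (ht _).hom_ext
  rw [(ht _).fac, map₂_comp_app, (ht _).fac_assoc, ext_whiskerLeft]

lemma desc_id (j : C) (X : R.obj (I.obj j)) :
    (ht _).desc (ext (t X) (I.map (𝟙 j))) ≫ H X ◁ (I.mapId j).hom ≫ (ρ_ (H X)).hom =
      (ht _).desc (((R.map₂ (I.mapId j).hom).toNatTrans.app X ≫
        (R.mapId _).hom.toNatTrans.app X) ≫ t X) := by
  apply (ht _).hom_ext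
  rw [(ht _).fac, map₂_comp_app, (ht _).fac_assoc, map₂_comp_app, ← Category.assoc,
    ext_whiskerLeft, Category.assoc, ext_id, Category.assoc]

lemma desc_comp {j k l : C} (F : j ⟶ k) (G : k ⟶ l) (X : R.obj (I.obj j)) :
    (ht _).desc (ext (t X) (I.map (F ≫ G))) ≫ H X ◁ (I.mapComp F G).hom ≫
        (α_ (H X) (I.map F) (I.map G)).inv =
      (ht _).desc (((R.map₂ (I.mapComp F G).hom).toNatTrans.app X ≫
        (R.mapComp _ _).hom.toNatTrans.app X) ≫ t _) ≫
        (ht _).desc (ext (t ((R.map (I.map F)).toFunctor.obj X)) (I.map G)) ≫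
        (ht _).desc (ext (t X) (I.map F)) ▷ I.map G := by
  rw [← Category.assoc ((ht _).desc (_ ≫ t _)), (ht _).desc_comp_desc (ht _)]
  apply (ht _).hom_ext
  simp only [map₂_comp_app]
  rw [(ht _).fac_assoc, (ht _).fac_assoc, ← Category.assoc, ext_whiskerLeft]
  simp only [Category.assoc]
  rw [ext_whiskerRight, (ht _).fac, ext_ext,
    ← Category.assoc ((R.mapComp _ _).hom.toNatTrans.app X), mapComp_hom_inv_app, Category.id_comp]

/-- The internal homs from `N` as a morphism of 2-representations. -/
def homTrans : I.comp R ⟶ I.comp (comod A) where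
  app j := (homFunctor (I := I) hcan ht j).toCatHom
  naturality F := Cat.Hom.isoMk (homNatIso (I := I) hcan ht hext F)
  naturality_naturality {j k F G} η := Cat.Hom₂.ext <| NatTrans.ext <| funext fun X =>
    RightComod.Hom.ext (desc_whiskerLeft (I := I) ht η X)
  naturality_id j := Cat.Hom₂.ext <| NatTrans.ext <| funext fun X =>
    RightComod.Hom.ext (by
      refine (desc_id (I := I) ht j X).trans ?_
      refine Eq.trans ?_ congr(_ ≫ $((Category.comp_id (𝟙 (H X))).symm))
      exact (Category.comp_id _).symm)
  naturality_comp {j k l} F G := Cat.Hom₂.ext <| NatTrans.ext <| funext fun X =>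
    RightComod.Hom.ext (by
      refine (desc_comp (I := I) ht F G X).trans ?_
      -- The two sides now differ only by the identities that come from the associators of `Cat` and
      -- from functors applied to identities.
      refine congr(_ ≫ $(?_))
      refine Eq.trans ?_ (Category.id_comp _).symm
      refine congr(_ ≫ $(?_))
      exact ((Category.id_comp _).trans (Category.comp_id _)).symm)

/-- The morphism `homTrans` is given by internal homs. -/
def homTransData {e : InternalHom N N A} (hcan : IsCanonical e.coev) :
    InternalHomTrans e (homTrans (I := I) hcan ht hext) where
  hom X := (ht X).internalHom
  map {j X Y} f := by
    refine (congr($((ht X).internalHom_coev) ≫ _)).trans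
      (Eq.trans ?_ congr(f ≫ $((ht Y).internalHom_coev)).symm)
    exact (ht X).fac _
  coact {j} X := by
    refine (congr($((ht X).internalHom_coev) ≫ _)).trans
      (Eq.trans ?_ congr($((ht X).internalHom_coev) ≫ _).symm)
    have h := congr($(comodule_coact_fac hcan (ht X)) ≫
      (R.mapComp A (H X)).hom.toNatTrans.app N)
    rw [Category.assoc, Category.assoc, ext_mapComp_hom] at h
    exact h
  naturality {j k} F X := by
    refine (congr($((ht _).internalHom_coev) ≫ _)).trans
      (Eq.trans ?_ congr((R.map (I.map F)).toFunctor.map $((ht _).internalHom_coev)).symm)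
    exact ((ht _).fac_assoc (ext (t X) (I.map F)) _).trans (ext_mapComp_hom _ _)

/-- The two formulations differ only in the side on which the structure isomorphisms `mapComp` and
`mapId` are written. -/
lemma isCanonicalCoalgebra {e : InternalHom N N A} (hcan : IsCanonical e.coev) :
    e.IsCanonicalCoalgebra where
  comul := by
    rw [← Category.assoc, hcan.comul, Category.assoc, ext_mapComp_hom]
  counit := by
    rw [← Category.assoc, hcan.counit, unit, Cat.Hom.inv_hom_id_toNatTrans_app]
    rfl

end Theta

end RepEval

/-! ### Exactness in the injective abelianization -/

namespace InjAb

section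

variable {𝕜 : Type w} [CommRing 𝕜] {A : Type u} [Category.{v} A] [Preadditive A] [Linear 𝕜 A]

lemma homMk_eq_homMk {P Q : InjAb 𝕜 A} {g g' : P.X ⟶ Q.X} {hg : g ∈ adm P Q}
    {hg' : g' ∈ adm P Q} : homMk g hg = homMk g' hg' ↔ g - g' ∈ null P Q.X :=
  Hom.mk_eq_mk

lemma homMk_zero (P Q : InjAb 𝕜 A) : homMk (0 : P.X ⟶ Q.X) (adm P Q).zero_mem = 0 := rfl

lemma homMk_add {P Q : InjAb 𝕜 A} {g g' : P.X ⟶ Q.X} (hg : g ∈ adm P Q) (hg' : g' ∈ adm P Q) :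
    homMk (g + g') ((adm P Q).add_mem hg hg') = homMk g hg + homMk g' hg' := rfl

lemma homMk_eq_zero {P Q : InjAb 𝕜 A} {g : P.X ⟶ Q.X} {hg : g ∈ adm P Q} :
    homMk g hg = 0 ↔ g ∈ null P Q.X := by
  rw [← homMk_zero, homMk_eq_homMk, sub_zero]

/-- Objects of `A` are recognized by an empty family rather than by the form `of 𝕜 X`: the result of
acting by `of 𝕜 F` on `of 𝕜 N` has an empty family, but is an `append` and not literally an `of`. -/
lemma mem_adm_of_isEmpty {P W : InjAb 𝕜 A} [IsEmpty (Fin W.k)] (g : P.X ⟶ W.X) : g ∈ adm P W :=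
  mem_adm.2 fun b => isEmptyElim b

lemma null_eq_bot {P : InjAb 𝕜 A} [IsEmpty (Fin P.k)] {Z : A} {g : P.X ⟶ Z} (hg : g ∈ null P Z) :
    g = 0 := by
  obtain ⟨q, rfl⟩ := hg
  simp

instance (X : A) : IsEmpty (Fin (of 𝕜 X).k) := inferInstanceAs (IsEmpty (Fin 0))

/-- Morphisms between objects of `A`, as morphisms in the abelianization. -/
def ofHom {X Y : A} (g : X ⟶ Y) : of 𝕜 X ⟶ of 𝕜 Y :=
  homMk (P := of 𝕜 X) (Q := of 𝕜 Y) g (mem_adm_of_isEmpty _)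

lemma ofHom_comp {X Y Z : A} (g : X ⟶ Y) (g' : Y ⟶ Z) :
    ofHom (𝕜 := 𝕜) (g ≫ g') = ofHom g ≫ ofHom g' := rfl

lemma ofHom_id (X : A) : ofHom (𝕜 := 𝕜) (𝟙 X) = 𝟙 _ := rfl

lemma ofHom_add {X Y : A} (g g' : X ⟶ Y) : ofHom (𝕜 := 𝕜) (g + g') = ofHom g + ofHom g' := rfl

lemma ofHom_smul {X Y : A} (r : 𝕜) (g : X ⟶ Y) : ofHom (𝕜 := 𝕜) (r • g) = r • ofHom g := rfl

lemma ofHom_injective {X Y : A} : Function.Injective (ofHom (𝕜 := 𝕜) (X := X) (Y := Y)) := by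
  intro g g' h
  exact sub_eq_zero.1 (null_eq_bot (P := of 𝕜 X) (homMk_eq_homMk.1 h))

lemma ofHom_surjective {X Y : A} : Function.Surjective (ofHom (𝕜 := 𝕜) (X := X) (Y := Y)) := by
  intro φ
  obtain ⟨g, hg, rfl⟩ := exists_rep φ
  exact ⟨g, rfl⟩

variable (𝕜) in
lemma ofHom_sum {X Y : A} {ι : Type*} (s : Finset ι) (g : ι → (X ⟶ Y)) :
    ofHom (𝕜 := 𝕜) (∑ a ∈ s, g a) = ∑ a ∈ s, ofHom (g a) :=
  map_sum (AddMonoidHom.mk' (ofHom (𝕜 := 𝕜) (X := X) (Y := Y)) ofHom_add) g s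

/-- The inclusion of a formal kernel. -/
def incl (P : InjAb 𝕜 A) : P ⟶ of 𝕜 P.X :=
  homMk (Q := of 𝕜 P.X) (𝟙 P.X) (mem_adm_of_isEmpty _)

lemma incl_comp_ofHom_eq_zero {P : InjAb 𝕜 A} {Z : A} {g : P.X ⟶ Z} (hg : g ∈ null P Z) :
    incl P ≫ ofHom g = 0 := by
  refine homMk_eq_zero.2 ?_
  change 𝟙 P.X ≫ g ∈ null P Z
  rwa [Category.id_comp]

lemma exists_eq_incl_comp_ofHom {P : InjAb 𝕜 A} {Z : A} (φ : P ⟶ of 𝕜 Z) :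
    ∃ g : P.X ⟶ Z, φ = incl P ≫ ofHom g := by
  obtain ⟨g, hg, rfl⟩ := exists_rep φ
  exact ⟨g, homMk_congr (Category.id_comp g).symm⟩

lemma incl_comp_ofHom (P : InjAb 𝕜 A) (b : Fin P.k) : incl P ≫ ofHom (P.f b) = 0 :=
  incl_comp_ofHom_eq_zero (by simpa using f_comp_mem P b (𝟙 _))

/-- Equality of two classes depends only on their first components and on the family of the source,
and composing with `incl P` changes neither. -/
instance mono_incl (P : InjAb 𝕜 A) : Mono (incl P) where
  right_cancellation {Q} φ ψ h := by
    obtain ⟨g, hg, rfl⟩ := exists_rep φ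
    obtain ⟨g', hg', rfl⟩ := exists_rep ψ
    have := homMk_eq_homMk.1 h
    simp only [of, Category.comp_id] at this
    exact homMk_eq_homMk.2 this

/-- Together with `mono_incl` this makes `P` an actual common kernel of its family: the vanishing of
the composites is precisely admissibility. -/
lemma exists_lift {P Q : InjAb 𝕜 A} (x : Q ⟶ of 𝕜 P.X) (h : ∀ b, x ≫ ofHom (P.f b) = 0) :
    ∃ y : Q ⟶ P, y ≫ incl P = x := by
  obtain ⟨g, hg, rfl⟩ := exists_rep x
  refine ⟨homMk g (mem_adm.2 fun b => homMk_eq_zero.1 (h b)), ?_⟩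
  exact homMk_congr (Category.comp_id _)

/-- Morphisms in the abelianization are isomorphisms if they induce bijections of the spaces of
morphisms to objects of `A`. -/
theorem isIso_of_bijective {P Q : InjAb 𝕜 A} (φ : P ⟶ Q)
    (h : ∀ Z : A, Function.Bijective fun q : Q ⟶ of 𝕜 Z => φ ≫ q) : IsIso φ := by
  -- The sought inverse followed by `incl P`. It factors through the kernel `P`, as injectivity of
  -- composition with `φ` shows that it is killed by the family of `P`.
  obtain ⟨r, hr : φ ≫ r = incl P⟩ := (h P.X).2 (incl P)
  obtain ⟨s, rfl⟩ := exists_lift r fun b => (h _).1 (by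
    dsimp only
    rw [← Category.assoc, hr, incl_comp_ofHom, comp_zero])
  refine ⟨s, ?_, ?_⟩
  · rw [← cancel_mono (incl P), Category.assoc, hr, Category.id_comp]
  · rw [← cancel_mono (incl Q)]
    refine (h _).1 ?_
    dsimp only
    have : φ ≫ s = 𝟙 P := by rw [← cancel_mono (incl P), Category.assoc, hr, Category.id_comp]
    rw [Category.assoc, ← Category.assoc φ, this, Category.id_comp, Category.id_comp]

/-- Kernels in the abelianization, and their exactness with respect to objects of `A`. -/
theorem exists_kernel {P Q : InjAb 𝕜 A} (φ : P ⟶ Q) :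
    ∃ (E : InjAb 𝕜 A) (κ : E ⟶ P), κ ≫ φ = 0 ∧
      (∀ {S : InjAb 𝕜 A} (ψ : S ⟶ P), ψ ≫ φ = 0 → ∃ χ : S ⟶ E, χ ≫ κ = ψ) ∧
      ∀ (W : InjAb 𝕜 A) [IsEmpty (Fin W.k)], (∀ y : E ⟶ W, ∃ x : P ⟶ W, κ ≫ x = y) ∧
        ∀ x : P ⟶ W, κ ≫ x = 0 → ∃ q : Q ⟶ W, x = φ ≫ q := by
  obtain ⟨g, hg, rfl⟩ := exists_rep φ
  -- The kernel of `φ` is `P` with the representative `g` added to its family as one further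
  -- equation.
  let g₁ : ∀ _ : Fin 1, P.X ⟶ Q.X := fun _ => g
  let E : InjAb 𝕜 A := append P.X P.f g₁
  have hκ : 𝟙 P.X ∈ adm E P := mem_adm.2 fun b => by
    rw [Category.id_comp]
    exact append_left_mem' P.f g₁ b
  refine ⟨E, homMk (P := E) (𝟙 P.X) hκ, ?_, fun {S} ψ hψ => ?_, fun W _ => ⟨fun y => ?_, fun x hx => ?_⟩⟩
  · refine homMk_eq_zero.2 ?_
    rw [Category.id_comp]
    exact append_right_mem' P.f g₁ 0
  · obtain ⟨s, hs, rfl⟩ := exists_rep ψ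
    refine ⟨homMk s (append_mem_adm (mem_adm.1 hs) fun _ => homMk_eq_zero.1 hψ), ?_⟩
    exact homMk_congr (Category.comp_id _)
  · obtain ⟨y, hy, rfl⟩ := exists_rep y
    exact ⟨homMk (P := P) y (mem_adm_of_isEmpty _), homMk_congr (Category.id_comp _)⟩
  · obtain ⟨x, hx', rfl⟩ := exists_rep x
    have hx := homMk_eq_zero.1 hx
    rw [Category.id_comp] at hx
    -- Null morphisms of the enlarged family are null morphisms of `P` plus multiples of `g`. This
    -- is the exactness of `Hom(-, W)` at `P`.
    have key : ∀ y ∈ null E W.X, ∃ q : Q.X ⟶ W.X, y - g ≫ q ∈ null P W.X := by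
      let S : Submodule 𝕜 (P.X ⟶ W.X) :=
        null P W.X ⊔ (⊤ : Submodule 𝕜 (Q.X ⟶ W.X)).map (Linear.leftComp 𝕜 W.X g)
      have hS : null E W.X ≤ S := append_null_le
        (fun a q => Submodule.mem_sup_left (f_comp_mem P a q))
        (fun _ q => Submodule.mem_sup_right ⟨q, trivial, rfl⟩)
      intro y hy
      obtain ⟨y₁, h₁, _, ⟨q, -, rfl⟩, rfl⟩ := Submodule.mem_sup.1 (hS hy)
      exact ⟨q, by simpa using h₁⟩
    obtain ⟨q, hq⟩ := key x hx
    exact ⟨homMk q (mem_adm_of_isEmpty _), homMk_eq_homMk.2 hq⟩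

/-- A monomorphism has zero kernel, so every morphism to `W` vanishes on the kernel and extends by
the exactness in `exists_kernel`. -/
instance injective_of_isEmpty (W : InjAb 𝕜 A) [IsEmpty (Fin W.k)] : Injective W where
  factors {P Q} y φ _ := by
    obtain ⟨E, κ, h₀, -, hW⟩ := exists_kernel φ
    have : κ = 0 := by rw [← cancel_mono φ, h₀, zero_comp]
    obtain ⟨q, hq⟩ := (hW W).2 y (by rw [this, zero_comp])
    exact ⟨q, hq.symm⟩

/-- Injective objects of the abelianization come from `A`. -/
theorem exists_iso_of_injective [IsIdempotentComplete A] (J : InjAb 𝕜 A) [Injective J] :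
    ∃ Z : A, Nonempty (J ≅ of 𝕜 Z) := by
  -- An injective `J` is a retract of `of 𝕜 J.X`. The corresponding idempotent lives on `J.X` in `A`
  -- and splits there.
  let r : of 𝕜 J.X ⟶ J := Injective.factorThru (𝟙 J) (incl J)
  have hr : incl J ≫ r = 𝟙 J := Injective.comp_factorThru _ _
  obtain ⟨g, hg⟩ := ofHom_surjective (r ≫ incl J)
  have hgg : g ≫ g = g := ofHom_injective (𝕜 := 𝕜) (by
    rw [ofHom_comp, hg, Category.assoc, ← Category.assoc (incl J), hr, Category.id_comp])
  obtain ⟨Z, i, p, hip, hpi⟩ := IsIdempotentComplete.idempotents_split J.X g hgg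
  refine ⟨Z, ⟨incl J ≫ ofHom p, ofHom i ≫ r, ?_, ?_⟩⟩
  · rw [Category.assoc, ← Category.assoc (ofHom p), ← ofHom_comp, hpi, hg, Category.assoc, hr,
      Category.comp_id, hr]
  · rw [Category.assoc, ← Category.assoc r, ← hg, ← ofHom_comp, ← ofHom_comp, ← hpi]
    rw [Category.assoc, hip, Category.comp_id, hip, ofHom_id]

instance : (ofFunctor 𝕜 A).Full where
  map_surjective φ := ofHom_surjective φ

instance : (ofFunctor 𝕜 A).Faithful where
  map_injective h := ofHom_injective h

instance : (ofFunctor 𝕜 A).Additive where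

instance : (ofFunctor 𝕜 A).Linear 𝕜 where

end

end InjAb

/-! ### Corepresentability over finitary categories -/

section Generator

variable (𝕜 : Type w) [Field 𝕜] {A : Type u} [Category.{v} A] [Preadditive A] [Linear 𝕜 A]

/-- The endomorphisms of `X` which factor through a direct sum of copies of `G`. -/
def factorsThrough (G X : A) : Submodule 𝕜 (X ⟶ X) :=
  Submodule.span 𝕜 {e | ∃ (s : X ⟶ G) (r : G ⟶ X), e = s ≫ r}

variable {𝕜}

lemma comp_mem_factorsThrough {G X Y : A} {e : Y ⟶ Y} (he : e ∈ factorsThrough 𝕜 G Y)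
    (p : X ⟶ Y) (i : Y ⟶ X) : p ≫ e ≫ i ∈ factorsThrough 𝕜 G X := by
  have : factorsThrough 𝕜 G Y ≤ (factorsThrough 𝕜 G X).comap
      ((Linear.leftComp 𝕜 X p).comp (Linear.rightComp 𝕜 Y i)) := by
    refine Submodule.span_le.2 ?_
    rintro _ ⟨s, r, rfl⟩
    exact Submodule.subset_span ⟨p ≫ s, r ≫ i, by simp⟩
  exact this he

lemma retract_mem_factorsThrough {G X Y : A} (he : 𝟙 Y ∈ factorsThrough 𝕜 G Y)
    (p : X ⟶ Y) (i : Y ⟶ X) : p ≫ i ∈ factorsThrough 𝕜 G X := by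
  simpa using comp_mem_factorsThrough he p i

variable (𝕜 A) in
/-- A finitary category has an object such that all objects are direct summands of direct sums of
copies of it. -/
theorem IsFinitary.exists_generator [IsFinitary 𝕜 A] :
    ∃ G : A, ∀ X : A, 𝟙 X ∈ factorsThrough 𝕜 G X := by
  have := hasBinaryBiproducts_of_finite_biproducts A
  obtain ⟨S, hS, h⟩ := IsFinitary.finite_indecomposables (𝕜 := 𝕜) (A := A)
  have := hS.to_subtype
  let G : A := ⨁ fun Y : S => Y.1
  have hfin : ∀ X Y : A, Module.Finite 𝕜 (X ⟶ Y) := IsFinitary.finite_hom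
  refine ⟨G, fun X => ?_⟩
  induction hn : Module.finrank 𝕜 (X ⟶ X) using Nat.strong_induction_on generalizing X with
  | _ n ih =>
    by_cases hX : IsZero X
    · rw [hX.eq_of_src (𝟙 X) 0]
      exact Submodule.zero_mem _
    by_cases hind : Indecomposable X
    · obtain ⟨Y, hY, ⟨e⟩⟩ := h X hind
      refine Submodule.subset_span ⟨e.hom ≫ biproduct.ι (fun Y : S => Y.1) ⟨Y, hY⟩,
        biproduct.π (fun Y : S => Y.1) ⟨Y, hY⟩ ≫ e.inv, ?_⟩
      simp
    · unfold Indecomposable at hind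
      push Not at hind
      obtain ⟨Y, Z, e, hY, hZ⟩ := hind hX
      -- Block diagonal endomorphisms embed into those of `X ≅ Y ⊞ Z`. Both summands are non-zero,
      -- so each has an endomorphism algebra of strictly smaller dimension, and the induction
      -- applies.
      let L : ((Y ⟶ Y) × (Z ⟶ Z)) →ₗ[𝕜] (X ⟶ X) :=
        { toFun := fun f => e.hom ≫ biprod.map f.1 f.2 ≫ e.inv
          map_add' := fun f g => by
            rw [← Preadditive.comp_add, ← Preadditive.add_comp]
            congr 2
            ext <;> simp
          map_smul' := fun a f => by
            rw [RingHom.id_apply, ← Linear.comp_smul, ← Linear.smul_comp]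
            congr 2
            ext <;> simp }
      have hL : Function.Injective L := by
        rintro ⟨f, g⟩ ⟨f', g'⟩ hfg
        have hfg : e.hom ≫ biprod.map f g ≫ e.inv = e.hom ≫ biprod.map f' g' ≫ e.inv := hfg
        rw [cancel_epi, cancel_mono] at hfg
        have h₁ := congr(biprod.inl ≫ $hfg ≫ biprod.fst)
        have h₂ := congr(biprod.inr ≫ $hfg ≫ biprod.snd)
        simp only [biprod.map_fst, biprod.map_snd, biprod.inl_fst_assoc, biprod.inr_snd_assoc]
          at h₁ h₂
        rw [h₁, h₂]
      have hle := LinearMap.finrank_le_finrank_of_injective hL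
      rw [Module.finrank_prod] at hle
      have hpos : ∀ W : A, ¬ IsZero W → 0 < Module.finrank 𝕜 (W ⟶ W) := fun W hW => by
        have : Nontrivial (W ⟶ W) := ⟨𝟙 W, 0, fun h => hW ((IsZero.iff_id_eq_zero W).2 h)⟩
        exact Module.finrank_pos
      have hY' := ih _ (by have := hpos Z hZ; omega) Y rfl
      have hZ' := ih _ (by have := hpos Y hY; omega) Z rfl
      have : 𝟙 X = (e.hom ≫ biprod.fst) ≫ (biprod.inl ≫ e.inv) +
          (e.hom ≫ biprod.snd) ≫ (biprod.inr ≫ e.inv) := by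
        have h : 𝟙 X = e.hom ≫ 𝟙 _ ≫ e.inv := by rw [Category.id_comp, e.hom_inv_id]
        rw [h, ← biprod.total, Preadditive.add_comp, Preadditive.comp_add]
        simp only [Category.assoc]
      rw [this]
      exact Submodule.add_mem _ (retract_mem_factorsThrough hY' _ _)
        (retract_mem_factorsThrough hZ' _ _)

end Generator

namespace InjAb

universe v' u'

variable {𝕜 : Type w} {A : Type u} [Category.{v} A] [Preadditive A]
  {D : Type u'} [Category.{v'} D] [Preadditive D]

/-- A functor on the abelianization which preserves formal kernels. -/
structure PreservesFormalKernels [CommRing 𝕜] [Linear 𝕜 A] (T : InjAb 𝕜 A ⥤ D) : Prop where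
  mono (P : InjAb 𝕜 A) : Mono (T.map (incl P))
  lift (P : InjAb 𝕜 A) {X : D} (x : X ⟶ T.obj (of 𝕜 P.X))
    (h : ∀ b, x ≫ T.map (ofHom (P.f b)) = 0) : ∃ y, y ≫ T.map (incl P) = x

variable [Field 𝕜] [Linear 𝕜 A] {T : InjAb 𝕜 A ⥤ D}

/-- If `T` preserves formal kernels, then a morphism to the values of `T` which is universal with
respect to objects of `A` is universal. -/
theorem PreservesFormalKernels.bijective [T.Additive] (hT : PreservesFormalKernels T) {X : D}
    {P : InjAb 𝕜 A} (t : X ⟶ T.obj P)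
    (h : ∀ Z : A, Function.Bijective fun φ : P ⟶ of 𝕜 Z => t ≫ T.map φ) (Q : InjAb 𝕜 A) :
    Function.Bijective fun φ : P ⟶ Q => t ≫ T.map φ := by
  have := hT.mono
  constructor
  · intro φ ψ hφψ
    rw [← cancel_mono (incl Q)]
    refine (h _).1 ?_
    dsimp only at hφψ ⊢
    rw [T.map_comp, T.map_comp, ← Category.assoc, hφψ, Category.assoc]
  · intro y
    obtain ⟨x, hx : t ≫ T.map x = y ≫ T.map (incl Q)⟩ := (h _).2 (y ≫ T.map (incl Q))
    -- The factorization `x` to the ambient object of `Q` satisfies the equations that define `Q`,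
    -- since they hold after `t` and factorizations to objects of `A` are unique.
    obtain ⟨φ, rfl⟩ := exists_lift x fun b => (h _).1 (by
      dsimp only
      rw [T.map_comp, ← Category.assoc, hx, Category.assoc, ← T.map_comp, incl_comp_ofHom,
        T.map_zero, T.map_zero, comp_zero, comp_zero])
    refine ⟨φ, ?_⟩
    rw [← cancel_mono (T.map (incl Q)), ← hx, T.map_comp, Category.assoc]

/-- Corepresentability of `Hom(X, T -)`, if `T` preserves formal kernels and morphism spaces are
finite dimensional. -/
theorem PreservesFormalKernels.exists_universal [Linear 𝕜 D] [IsFinitary 𝕜 A] [T.Additive] [T.Linear 𝕜]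
    (hT : PreservesFormalKernels T) (X : D)
    (hfin : ∀ Z : A, Module.Finite 𝕜 (X ⟶ T.obj (of 𝕜 Z))) :
    ∃ (P : InjAb 𝕜 A) (t : X ⟶ T.obj P),
      ∀ Q : InjAb 𝕜 A, Function.Bijective fun φ : P ⟶ Q => t ≫ T.map φ := by
  obtain ⟨G, hG⟩ := IsFinitary.exists_generator 𝕜 A
  have hfinA : ∀ X Y : A, Module.Finite 𝕜 (X ⟶ Y) := IsFinitary.finite_hom
  obtain ⟨n, v, hv⟩ := Submodule.fg_iff_exists_fin_generating_family.1 (hfin G).1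
  let H : A := ⨁ fun _ : Fin n => G
  -- The generators `v` of `Hom(X, T G)` are assembled into one morphism to `T (G ⊕ … ⊕ G)`, through
  -- which all morphisms `X ⟶ T Z` factor: for `Z = G` by choice of `v`, then for every `Z` because
  -- `G` is a generator.
  let t₀ : X ⟶ T.obj (of 𝕜 H) := ∑ a, v a ≫ T.map (ofHom (biproduct.ι (fun _ : Fin n => G) a))
  let L (Z : A) : (H ⟶ Z) →ₗ[𝕜] (X ⟶ T.obj (of 𝕜 Z)) :=
    { toFun := fun g => t₀ ≫ T.map (ofHom g)
      map_add' := fun g g' => by rw [ofHom_add, T.map_add, Preadditive.comp_add]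
      map_smul' := fun a g => by rw [ofHom_smul, T.map_smul, Linear.comp_smul]; rfl }
  have hLdef (Z : A) (g : H ⟶ Z) : L Z g = t₀ ≫ T.map (ofHom g) := rfl
  have hLG : LinearMap.range (L G) = ⊤ := by
    rw [eq_top_iff, ← hv, Submodule.span_le]
    rintro _ ⟨a, rfl⟩
    refine ⟨biproduct.π _ a, ?_⟩
    rw [hLdef, Preadditive.sum_comp, Finset.sum_eq_single a]
    · rw [Category.assoc, ← T.map_comp, ← ofHom_comp, biproduct.ι_π_self, ofHom_id, T.map_id,
        Category.comp_id]
    · intro b _ hb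
      rw [Category.assoc, ← T.map_comp, ← ofHom_comp, biproduct.ι_π_ne _ hb]
      have : ofHom (𝕜 := 𝕜) (0 : G ⟶ G) = 0 := rfl
      rw [this, T.map_zero, comp_zero]
    · simp
  have hL (Z : A) : Function.Surjective (L Z) := by
    intro y
    have key : ∀ e ∈ factorsThrough 𝕜 G Z, y ≫ T.map (ofHom e) ∈ LinearMap.range (L Z) := by
      have : factorsThrough 𝕜 G Z ≤ (LinearMap.range (L Z)).comap
          ({  toFun := fun e => y ≫ T.map (ofHom e)
              map_add' := fun g g' => by rw [ofHom_add, T.map_add, Preadditive.comp_add]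
              map_smul' := fun a g => by
                rw [ofHom_smul, T.map_smul, Linear.comp_smul]
                rfl } : (Z ⟶ Z) →ₗ[𝕜] (X ⟶ T.obj (of 𝕜 Z))) := by
        refine Submodule.span_le.2 ?_
        rintro _ ⟨s, r, rfl⟩
        obtain ⟨g, hg⟩ : y ≫ T.map (ofHom s) ∈ LinearMap.range (L G) := hLG ▸ trivial
        refine ⟨g ≫ r, ?_⟩
        change t₀ ≫ T.map (ofHom (g ≫ r)) = y ≫ T.map (ofHom (s ≫ r))
        rw [ofHom_comp, ofHom_comp, T.map_comp, T.map_comp, ← Category.assoc, ← hLdef, hg,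
          Category.assoc]
      exact fun e he => this he
    have := key _ (hG Z)
    rwa [ofHom_id, T.map_id, Category.comp_id] at this
  -- The relations: finitely many morphisms `H ⟶ G` span those killed by `t₀`. Taken as a family
  -- they define the formal kernel `P`, and again `G` controls the relations with any target `Z`.
  obtain ⟨m, k, hk⟩ := Submodule.fg_iff_exists_fin_generating_family.1
    (IsNoetherian.noetherian (LinearMap.ker (L G)))
  let P : InjAb 𝕜 A := ⟨H, m, fun _ => G, k⟩
  have hLk (a : Fin m) : t₀ ≫ T.map (ofHom (k a)) = 0 := by
    have : k a ∈ LinearMap.ker (L G) := hk ▸ Submodule.subset_span ⟨a, rfl⟩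
    exact this
  have hker (Z : A) (g : H ⟶ Z) (hg : L Z g = 0) : g ∈ null P Z := by
    have key : ∀ e ∈ factorsThrough 𝕜 G Z, g ≫ e ∈ null P Z := by
      have : factorsThrough 𝕜 G Z ≤ (null P Z).comap (Linear.leftComp 𝕜 Z g) := by
        refine Submodule.span_le.2 ?_
        rintro _ ⟨s, r, rfl⟩
        have hgs : g ≫ s ∈ Submodule.span 𝕜 (Set.range k) := by
          rw [hk, LinearMap.mem_ker, hLdef, ofHom_comp, T.map_comp, ← Category.assoc, ← hLdef, hg,
            zero_comp]
        have hle : Submodule.span 𝕜 (Set.range k) ≤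
            (null P Z).comap (Linear.rightComp 𝕜 H r) := by
          refine Submodule.span_le.2 ?_
          rintro _ ⟨a, rfl⟩
          exact f_comp_mem P a r
        have := hle hgs
        change g ≫ s ≫ r ∈ null P Z
        rw [← Category.assoc]
        exact this
      exact fun e he => this he
    have := key _ (hG Z)
    rwa [Category.comp_id] at this
  obtain ⟨t, ht⟩ := hT.lift P t₀ hLk
  refine ⟨P, t, hT.bijective t fun Z => ⟨?_, ?_⟩⟩
  · intro φ ψ h
    rw [← sub_eq_zero]
    replace h : t ≫ T.map (φ - ψ) = 0 := by
      rw [T.map_sub, Preadditive.comp_sub]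
      exact sub_eq_zero.2 h
    obtain ⟨g, hφ⟩ := exists_eq_incl_comp_ofHom (φ - ψ)
    rw [hφ, T.map_comp, ← Category.assoc, ht] at h
    rw [hφ]
    exact incl_comp_ofHom_eq_zero (hker Z g h)
  · intro y
    obtain ⟨g, hg⟩ := hL Z y
    refine ⟨incl P ≫ ofHom g, ?_⟩
    dsimp only
    rw [T.map_comp, ← Category.assoc, ht, ← hg, hLdef]

end InjAb

/-! ### Evaluation of abelianized 2-representations -/

namespace InjAb

variable {𝕜 : Type w} [CommRing 𝕜] {A : Type u} [Category.{v} A] [Preadditive A] [Linear 𝕜 A]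

lemma homMk_sum_of_isEmpty {P W : InjAb 𝕜 A} [IsEmpty (Fin W.k)] {ι : Type*} (s : Finset ι)
    (g : ι → (P.X ⟶ W.X)) :
    homMk (∑ a ∈ s, g a) (mem_adm_of_isEmpty _) = ∑ a ∈ s, homMk (g a) (mem_adm_of_isEmpty _) :=
  map_sum (AddMonoidHom.mk' (fun g : P.X ⟶ W.X => homMk (Q := W) g (mem_adm_of_isEmpty g))
    fun _ _ => homMk_add _ _) g s

instance {K : Type w} [Field K] [Linear K A] (P Q : InjAb K A) [Module.Finite K (P.X ⟶ Q.X)] :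
    Module.Finite K (P ⟶ Q) :=
  inferInstanceAs (Module.Finite K (adm P Q ⧸ (null P Q.X).comap (adm P Q).subtype))

end InjAb

/-! ### Evaluation at an object of `M`: formal kernels and exactness. -/

namespace AbRep

open InjAb

universe v' u'

variable {𝕜 : Type w} [CommRing 𝕜] {C : Type u} [Bicategory.{v, v} C]
  [∀ i j : C, Preadditive (i ⟶ j)] [∀ i j : C, Linear 𝕜 (i ⟶ j)]
  {M : C ⥤ᵖ Cat.{v', u'}} [∀ i, Preadditive (M.obj i)] [∀ i, Linear 𝕜 (M.obj i)]
  [IsLinearRep 𝕜 M] {i : C} (N : M.obj i)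

variable (𝕜) in
/-- The functor `F ↦ F N` on the abelianization, for an object `N` of `M`. -/
def eval (j : C) : InjAb 𝕜 (i ⟶ j) ⥤ InjAb 𝕜 (M.obj j) where
  obj P := act P (of 𝕜 N)
  map φ := (actTrans (M := M) φ).app (of 𝕜 N)
  map_id P := homMk_congr congr(($(M.map₂_id P.X)).toNatTrans.app N)
  map_comp φ ψ := by
    obtain ⟨g, hg, rfl⟩ := exists_rep φ
    obtain ⟨g', hg', rfl⟩ := exists_rep ψ
    exact homMk_congr congr(($(M.map₂_comp g g')).toNatTrans.app N)

variable {j : C}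

instance : (eval 𝕜 N j).Additive where
  map_add {P Q φ ψ} := by
    obtain ⟨g, hg, rfl⟩ := exists_rep φ
    obtain ⟨g', hg', rfl⟩ := exists_rep ψ
    exact homMk_congr (IsLinearRep.map₂_add 𝕜 g g' N)

instance : (eval 𝕜 N j).Linear 𝕜 where
  map_smul {P Q} φ r := by
    obtain ⟨g, hg, rfl⟩ := exists_rep φ
    exact homMk_congr (IsLinearRep.map₂_smul r g N)

instance (F : i ⟶ j) : IsEmpty (Fin ((eval 𝕜 N j).obj (of 𝕜 F)).k) :=
  inferInstanceAs (IsEmpty (Fin 0))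

lemma eval_map_incl_comp {P : InjAb 𝕜 (i ⟶ j)} {W : InjAb 𝕜 (M.obj j)} [IsEmpty (Fin W.k)]
    (g : (M.map P.X).toFunctor.obj N ⟶ W.X) :
    (eval 𝕜 N j).map (incl P) ≫ homMk (P := (eval 𝕜 N j).obj (of 𝕜 P.X)) g (mem_adm_of_isEmpty _) =
      homMk (P := (eval 𝕜 N j).obj P) g (mem_adm_of_isEmpty _) := by
  refine homMk_congr ?_
  change (M.map₂ (𝟙 P.X)).toNatTrans.app N ≫ g = g
  rw [RepEval.map₂_id_app, Category.id_comp]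

lemma comp_eval_map_incl {P : InjAb 𝕜 (i ⟶ j)} {Q : InjAb 𝕜 (M.obj j)}
    (g : Q.X ⟶ (M.map P.X).toFunctor.obj N) (hg : g ∈ adm Q ((eval 𝕜 N j).obj P)) :
    homMk (Q := (eval 𝕜 N j).obj P) g hg ≫ (eval 𝕜 N j).map (incl P) =
      homMk (Q := (eval 𝕜 N j).obj (of 𝕜 P.X)) g (mem_adm_of_isEmpty _) := by
  refine homMk_congr ?_
  change g ≫ (M.map₂ (𝟙 P.X)).toNatTrans.app N = g
  rw [RepEval.map₂_id_app, Category.comp_id]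

/-- As `N` has an empty family, the family of `P N` consists only of the evaluations of the family
of `P`. So `P N` is the formal kernel of the evaluated family. -/
lemma preservesFormalKernels_eval : PreservesFormalKernels (eval 𝕜 N j) where
  mono P :=
    { right_cancellation := fun {Q} φ ψ h => by
        obtain ⟨g, hg, rfl⟩ := exists_rep φ
        obtain ⟨g', hg', rfl⟩ := exists_rep ψ
        replace h := (comp_eval_map_incl (P := P) N g hg).symm.trans
          (h.trans (comp_eval_map_incl (P := P) N g' hg'))
        exact homMk_eq_homMk.2
          ((homMk_eq_homMk (Q := (eval 𝕜 N j).obj (of 𝕜 P.X)) (g := g) (g' := g')).1 h) }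
  lift P {X} x h := by
    obtain ⟨g, hg, rfl⟩ := exists_rep x
    have hg' : g ∈ adm X ((eval 𝕜 N j).obj P) :=
      append_mem_adm (fun a => a.elim0) fun b => homMk_eq_zero.1 (h b)
    exact ⟨homMk g hg', comp_eval_map_incl (P := P) N g hg'⟩

lemma exists_extension_eval {P : InjAb 𝕜 (i ⟶ j)} {W : InjAb 𝕜 (M.obj j)} [IsEmpty (Fin W.k)]
    (y : (eval 𝕜 N j).obj P ⟶ W) :
    ∃ x : (eval 𝕜 N j).obj (of 𝕜 P.X) ⟶ W, (eval 𝕜 N j).map (incl P) ≫ x = y := by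
  obtain ⟨g, hg, rfl⟩ := exists_rep y
  exact ⟨_, eval_map_incl_comp (P := P) N g⟩

/-- With `exists_extension_eval`, this presents `Hom(P N, W)` as the cokernel of the map from the
sum of the spaces `Hom(G_b N, W)` to `Hom(F N, W)`, where `P` is the formal kernel of a family `F ⟶
G_b`. -/
lemma exists_eq_sum_eval {P : InjAb 𝕜 (i ⟶ j)} {W : InjAb 𝕜 (M.obj j)} [IsEmpty (Fin W.k)]
    (x : (eval 𝕜 N j).obj (of 𝕜 P.X) ⟶ W) (hx : (eval 𝕜 N j).map (incl P) ≫ x = 0) :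
    ∃ q : ∀ b, (eval 𝕜 N j).obj (of 𝕜 (P.Y b)) ⟶ W,
      x = ∑ b, (eval 𝕜 N j).map (ofHom (P.f b)) ≫ q b := by
  obtain ⟨g, hg, rfl⟩ := exists_rep x
  replace hx := homMk_eq_zero.1 ((eval_map_incl_comp (P := P) N g).symm.trans hx)
  let K : InjAb 𝕜 (M.obj j) := ⟨(M.map P.X).toFunctor.obj N, P.k, _,
    fun b => (M.map₂ (P.f b)).toNatTrans.app N⟩
  have hle : null ((eval 𝕜 N j).obj P) W.X ≤ null K W.X :=
    append_null_le (fun a => a.elim0) fun b q => f_comp_mem K b q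
  obtain ⟨q, hq⟩ := hle hx
  refine ⟨fun b => homMk (P := (eval 𝕜 N j).obj (of 𝕜 (P.Y b))) (q b) (mem_adm_of_isEmpty _), ?_⟩
  exact (homMk_congr hq).trans (homMk_sum_of_isEmpty (P := (eval 𝕜 N j).obj (of 𝕜 P.X))
    Finset.univ fun b => (M.map₂ (P.f b)).toNatTrans.app N ≫ q b)

end AbRep

/-! ### Extending 2-morphisms from a formal kernel to its ambient 1-morphism. -/

namespace AbBicat

open InjAb

variable {𝕜 : Type w} [CommRing 𝕜] {C : Type u} [Bicategory.{v, v} C]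
  [∀ i j : C, Preadditive (i ⟶ j)] [∀ i j : C, Linear 𝕜 (i ⟶ j)] [PreadditiveBicategory C]
  [LinearBicategory 𝕜 C] {i j k : AbBicat 𝕜 C}

/-- The inclusion of a formal kernel in the abelianization of a bicategory. -/
def inclHom (F : i ⟶ j) : F ⟶ (InjAb.of 𝕜 (InjAb.X F) : i ⟶ j) := InjAb.incl (𝕜 := 𝕜) F

/-- Replacing `F` by its ambient 1-morphism does not change the first component of the source, and
the target imposes no condition, so the same representative serves. -/
lemma exists_extension_whiskerLeft (A : i ⟶ j) (F : j ⟶ k) (G : i.as ⟶ k.as)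
    (y : A ≫ F ⟶ (InjAb.of 𝕜 G : i ⟶ k)) :
    ∃ x : A ≫ (InjAb.of 𝕜 (InjAb.X F) : j ⟶ k) ⟶ (InjAb.of 𝕜 G : i ⟶ k), y = A ◁ inclHom F ≫ x := by
  obtain ⟨g, hg, rfl⟩ := exists_rep (𝕜 := 𝕜) (A := i.as ⟶ k.as) y
  refine ⟨homMk (𝕜 := 𝕜) (A := i.as ⟶ k.as) (P := AbBicat.comp A (InjAb.of 𝕜 (InjAb.X F))) (Q := InjAb.of 𝕜 G) g
    (mem_adm_of_isEmpty _), ?_⟩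
  refine homMk_congr ?_
  change g = InjAb.X A ◁ 𝟙 (InjAb.X F) ≫ g
  rw [Bicategory.whiskerLeft_id, Category.id_comp]

end AbBicat

/-! ### Existence of internal homs, and the internal homs from `N` to the objects `F N`. -/

namespace AbRep

open InjAb RepEval

universe v' u'

section

variable {𝕜 : Type w} [Field 𝕜] {C : Type u} [Bicategory.{v, v} C]
  [∀ i j : C, Preadditive (i ⟶ j)] [∀ i j : C, Linear 𝕜 (i ⟶ j)] [PreadditiveBicategory C]
  [LinearBicategory 𝕜 C]
  {M : C ⥤ᵖ Cat.{v', u'}} [∀ i, Preadditive (M.obj i)] [∀ i, Linear 𝕜 (M.obj i)]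
  [IsLinearRep 𝕜 M] {i j : AbBicat 𝕜 C}

variable (𝕜) in
/-- The object of the abelianization of `M` given by an object of `M`. -/
abbrev ofObj (N : M.obj i.as) : (abRep 𝕜 M).obj i := of 𝕜 N

variable (𝕜 M) in
lemma map₂_sub_app {F G : i ⟶ j} (φ ψ : F ⟶ G) (X : M.obj i.as) :
    ((abRep 𝕜 M).map₂ (φ - ψ)).toNatTrans.app (ofObj 𝕜 X) =
      ((abRep 𝕜 M).map₂ φ).toNatTrans.app (ofObj 𝕜 X) -
        ((abRep 𝕜 M).map₂ ψ).toNatTrans.app (ofObj 𝕜 X) :=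
  (eval 𝕜 X j.as).map_sub (X := F) (Y := G) (f := φ) (g := ψ)

variable (𝕜 M) in
lemma map₂_add_app {F G : i ⟶ j} (φ ψ : F ⟶ G) (X : M.obj i.as) :
    ((abRep 𝕜 M).map₂ (φ + ψ)).toNatTrans.app (ofObj 𝕜 X) =
      ((abRep 𝕜 M).map₂ φ).toNatTrans.app (ofObj 𝕜 X) +
        ((abRep 𝕜 M).map₂ ψ).toNatTrans.app (ofObj 𝕜 X) :=
  (eval 𝕜 X j.as).map_add (X := F) (Y := G) (f := φ) (g := ψ)

variable (M) in
lemma map₂_smul_app {F G : i ⟶ j} (r : 𝕜) (φ : F ⟶ G) (X : M.obj i.as) :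
    ((abRep 𝕜 M).map₂ (r • φ)).toNatTrans.app (ofObj 𝕜 X) =
      r • ((abRep 𝕜 M).map₂ φ).toNatTrans.app (ofObj 𝕜 X) :=
  (eval 𝕜 X j.as).map_smul (R := 𝕜) (X := F) (Y := G) r φ

variable (𝕜 M) in
lemma map₂_sum_app {F G : i ⟶ j} {ι : Type*} (s : Finset ι) (φ : ι → (F ⟶ G)) (X : M.obj i.as) :
    ((abRep 𝕜 M).map₂ (∑ b ∈ s, φ b)).toNatTrans.app (ofObj 𝕜 X) =
      ∑ b ∈ s, ((abRep 𝕜 M).map₂ (φ b)).toNatTrans.app (ofObj 𝕜 X) :=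
  (eval 𝕜 X j.as).map_sum (X := F) (Y := G) φ s

variable {N : M.obj i.as}

lemma isUniversal_of_bijective {X : (abRep 𝕜 M).obj j} {H : i ⟶ j}
    (t : X ⟶ ((abRep 𝕜 M).map H).toFunctor.obj (ofObj 𝕜 N))
    (h : ∀ G : i.as ⟶ j.as, Function.Bijective fun φ : H ⟶ (of 𝕜 G : i ⟶ j) =>
      t ≫ ((abRep 𝕜 M).map₂ φ).toNatTrans.app (ofObj 𝕜 N)) : IsUniversal t :=
  fun F => (preservesFormalKernels_eval N).bijective (P := H) t h F

/-- Finitarity of the 1-morphism category supplies the generator, and that of `M` the finite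
dimension of the spaces `Hom(X, F N)`. -/
lemma exists_isUniversal [IsFinitary 𝕜 (i.as ⟶ j.as)] [IsFinitary 𝕜 (M.obj j.as)]
    (N : M.obj i.as) (X : (abRep 𝕜 M).obj j) :
    ∃ (H : i ⟶ j) (t : X ⟶ ((abRep 𝕜 M).map H).toFunctor.obj (ofObj 𝕜 N)), IsUniversal t := by
  have hfin : ∀ X Y : M.obj j.as, Module.Finite 𝕜 (X ⟶ Y) := IsFinitary.finite_hom
  have hfin' : ∀ P Q : InjAb 𝕜 (M.obj j.as), Module.Finite 𝕜 (P ⟶ Q) := fun _ _ => inferInstance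
  obtain ⟨P, t, h⟩ := (preservesFormalKernels_eval (𝕜 := 𝕜) (j := j.as) N).exists_universal X
    fun Z => hfin' X _
  exact ⟨P, t, fun F => h F⟩

/-- The morphisms `F N ⟶ F A N` induced by a universal morphism `N ⟶ A N` are universal, if
1-morphisms of `C` have right adjoints. -/
theorem isUniversal_ext {A : i ⟶ i}
    {c : ofObj 𝕜 N ⟶ ((abRep 𝕜 M).map A).toFunctor.obj (ofObj 𝕜 N)} (hc : IsUniversal c)
    (hadj : ∀ F : i.as ⟶ j.as, ∃ F' : j.as ⟶ i.as, Nonempty (Bicategory.Adjunction F F'))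
    (F : i ⟶ j) : IsUniversal (RepEval.ext c F) := by
  -- For the original 1-morphisms the adjunction argument applies. A general `F` is a formal kernel
  -- of such 1-morphisms, and the rest compares presentations of `Hom(F A, G)` and `Hom(F N, G N)`.
  have hof (F : i.as ⟶ j.as) : IsUniversal (RepEval.ext c (of 𝕜 F : i ⟶ j)) := by
    obtain ⟨F', ⟨adj⟩⟩ := hadj F
    exact hc.ext ((AbBicat.incl 𝕜 C).mapAdjunction adj)
  refine isUniversal_of_bijective _ fun G => ⟨?_, ?_⟩
  · intro φ ψ h
    replace h : RepEval.ext c F ≫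
        ((abRep 𝕜 M).map₂ (φ - ψ)).toNatTrans.app (ofObj 𝕜 N) = 0 := by
      rw [map₂_sub_app, Preadditive.comp_sub]
      exact sub_eq_zero.2 h
    rw [← sub_eq_zero]
    obtain ⟨x, hx⟩ := AbBicat.exists_extension_whiskerLeft A F G (φ - ψ)
    rw [hx, map₂_comp_app, ← Category.assoc, ext_whiskerLeft, Category.assoc] at h
    obtain ⟨q, hq⟩ := exists_eq_sum_eval (P := F)
      (W := (eval 𝕜 N j.as).obj (of 𝕜 G)) N _ h
    choose p hp using fun b => (hof (InjAb.Y F b) (of 𝕜 G)).2 (q b)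
    let δ (b : Fin (InjAb.k F)) : (of 𝕜 (InjAb.X F) : i ⟶ j) ⟶ of 𝕜 (InjAb.Y F b) :=
      ofHom (𝕜 := 𝕜) (InjAb.f F b)
    have hδ (b) : AbBicat.inclHom F ≫ δ b = 0 := incl_comp_ofHom (𝕜 := 𝕜) F b
    -- The expression of `x` through the family of `F` is lifted from morphisms at `N` to
    -- 2-morphisms. Each `δ b` vanishes on `F`, hence so does `x`.
    have hxs : x = ∑ b, A ◁ δ b ≫ p b := by
      refine (hof (InjAb.X F)).hom_ext (hq.trans ?_)
      rw [map₂_sum_app, Preadditive.comp_sum]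
      refine Finset.sum_congr rfl fun b _ => ?_
      rw [map₂_comp_app, ← Category.assoc, ext_whiskerLeft, Category.assoc]
      exact congrArg (_ ≫ ·) (hp b).symm
    rw [hx, hxs, Preadditive.comp_sum]
    refine Finset.sum_eq_zero fun b _ => ?_
    rw [← Category.assoc, ← Bicategory.whiskerLeft_comp, hδ]
    exact (congr($((AbBicat.whiskerLeftₗ 𝕜 A F (of 𝕜 (InjAb.Y F b) : i ⟶ j)).map_zero) ≫ p b)).trans
      zero_comp
  · intro y
    obtain ⟨x', hx'⟩ := exists_extension_eval (P := F) (W := (eval 𝕜 N j.as).obj (of 𝕜 G)) N y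
    obtain ⟨x, rfl⟩ := (hof (InjAb.X F) (of 𝕜 G)).2 x'
    refine ⟨A ◁ AbBicat.inclHom F ≫ x, ?_⟩
    dsimp only
    rw [map₂_comp_app, ← Category.assoc, ext_whiskerLeft, Category.assoc]
    exact hx'

end

end AbRep

/-! ### The kernel attached to a comodule, and detection by the objects `F N`. -/

namespace AbRep

open InjAb RepEval

universe v' u'

section

variable {𝕜 : Type w} [Field 𝕜] {C : Type u} [Bicategory.{v, v} C]
  [∀ i j : C, Preadditive (i ⟶ j)] [∀ i j : C, Linear 𝕜 (i ⟶ j)] [PreadditiveBicategory C]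
  [LinearBicategory 𝕜 C]
  {M : C ⥤ᵖ Cat.{v', u'}} [∀ i, Preadditive (M.obj i)] [∀ i, Linear 𝕜 (M.obj i)]
  [IsLinearRep 𝕜 M] {i j : AbBicat 𝕜 C} {N : M.obj i.as}
  {A : i ⟶ i} [Comonad A] {c : ofObj 𝕜 N ⟶ ((abRep 𝕜 M).map A).toFunctor.obj (ofObj 𝕜 N)}

lemma exists_kernel_abRep {P Q : (abRep 𝕜 M).obj j} (φ : P ⟶ Q) (N : M.obj i.as) :
    ∃ (E : (abRep 𝕜 M).obj j) (κ : E ⟶ P), κ ≫ φ = 0 ∧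
      (∀ {S : (abRep 𝕜 M).obj j} (ψ : S ⟶ P), ψ ≫ φ = 0 → ∃ χ : S ⟶ E, χ ≫ κ = ψ) ∧
      ∀ G : i.as ⟶ j.as,
        (∀ y : E ⟶ ((abRep 𝕜 M).map (of 𝕜 G : i ⟶ j)).toFunctor.obj (ofObj 𝕜 N),
          ∃ x, κ ≫ x = y) ∧
        ∀ x : P ⟶ ((abRep 𝕜 M).map (of 𝕜 G : i ⟶ j)).toFunctor.obj (ofObj 𝕜 N),
          κ ≫ x = 0 → ∃ q, x = φ ≫ q := by
  obtain ⟨E, κ, hκ, hlift, hW⟩ := exists_kernel (𝕜 := 𝕜) (A := M.obj j.as) φ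
  exact ⟨E, κ, hκ, hlift, fun G => hW ((eval 𝕜 N j.as).obj (of 𝕜 G))⟩

/-- The embedding of an object of the abelianization into an object of `M`. -/
def inclObj (X : (abRep 𝕜 M).obj j) : X ⟶ ofObj 𝕜 (InjAb.X X) := incl (𝕜 := 𝕜) X

instance (X : (abRep 𝕜 M).obj j) : Mono (inclObj X) :=
  mono_incl (𝕜 := 𝕜) (A := M.obj j.as) X

lemma isIso_of_bijective_abRep {X Y : (abRep 𝕜 M).obj j} (u : X ⟶ Y)
    (h : ∀ Z : M.obj j.as, Function.Bijective fun q : Y ⟶ ofObj 𝕜 Z => u ≫ q) : IsIso u :=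
  isIso_of_bijective (𝕜 := 𝕜) u h

/-- The difference of the two morphisms `H N ⟶ H A N`, for a comodule 1-morphism `H`. -/
def coactSubExt (c : ofObj 𝕜 N ⟶ ((abRep 𝕜 M).map A).toFunctor.obj (ofObj 𝕜 N))
    (Y : RightComod A j) : ((abRep 𝕜 M).map Y.obj).toFunctor.obj (ofObj 𝕜 N) ⟶
      ((abRep 𝕜 M).map (A ≫ Y.obj)).toFunctor.obj (ofObj 𝕜 N) :=
  ((abRep 𝕜 M).map₂ Y.coact).toNatTrans.app (ofObj 𝕜 N) - RepEval.ext c Y.obj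

lemma comp_coactSubExt_eq_zero {Y : RightComod A j} {X : (abRep 𝕜 M).obj j}
    (y : X ⟶ ((abRep 𝕜 M).map Y.obj).toFunctor.obj (ofObj 𝕜 N)) :
    y ≫ coactSubExt c Y = 0 ↔
      y ≫ ((abRep 𝕜 M).map₂ Y.coact).toNatTrans.app (ofObj 𝕜 N) = y ≫ RepEval.ext c Y.obj := by
  rw [coactSubExt, Preadditive.comp_sub, sub_eq_zero]

/-- The kernel of the difference of the two morphisms `H N ⟶ H A N`, for a comodule 1-morphism
`H`, is universal. -/
theorem exists_comodule_kernel (hcan : IsCanonical c)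
    (hext : ∀ F : i ⟶ j, IsUniversal (RepEval.ext c F)) (Y : RightComod A j) :
    ∃ (E : (abRep 𝕜 M).obj j)
      (κ : E ⟶ ((abRep 𝕜 M).map Y.obj).toFunctor.obj (ofObj 𝕜 N)), IsUniversal κ ∧
      κ ≫ coactSubExt c Y = 0 ∧
      ∀ {S : (abRep 𝕜 M).obj j}
        (ψ : S ⟶ ((abRep 𝕜 M).map Y.obj).toFunctor.obj (ofObj 𝕜 N)),
        ψ ≫ coactSubExt c Y = 0 → ∃ χ : S ⟶ E, χ ≫ κ = ψ := by
  obtain ⟨E, κ, hκ, hlift, hW⟩ := exists_kernel_abRep (coactSubExt c Y) N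
  refine ⟨E, κ, isUniversal_of_bijective κ fun G => ?_, hκ, hlift⟩
  obtain ⟨hsurj, hker⟩ := hW G
  have hκ' := (comp_coactSubExt_eq_zero κ).1 hκ
  constructor
  · intro φ ψ h
    replace h : κ ≫ ((abRep 𝕜 M).map₂ (φ - ψ)).toNatTrans.app (ofObj 𝕜 N) = 0 := by
      rw [map₂_sub_app, Preadditive.comp_sub]
      exact sub_eq_zero.2 h
    rw [← sub_eq_zero]
    generalize φ - ψ = θ at h ⊢
    obtain ⟨q, hq⟩ := hker _ h
    -- The 1-morphism here is `A ≫ Y.obj`, itself only an object of the abelianization. This is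
    -- where universality of `ext c F` beyond the original 1-morphisms is needed.
    obtain ⟨p, rfl⟩ := (hext _ (of 𝕜 G)).2 q
    have key : Comonad.counit ▷ Y.obj ≫ (λ_ Y.obj).hom ≫ θ =
        A ◁ Y.coact ≫ p - Comonad.comul ▷ Y.obj ≫ (α_ A A Y.obj).hom ≫ p := by
      refine (hext Y.obj).hom_ext ?_
      rw [map₂_sub_app]
      simp only [map₂_comp_app]
      rw [← Category.assoc ((abRep 𝕜 M).map₂ (Comonad.counit ▷ Y.obj) |>.toNatTrans.app _),
        ← Category.assoc (RepEval.ext c Y.obj), hcan.ext_counit, Category.id_comp]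
      refine hq.trans ?_
      rw [Preadditive.comp_sub, coactSubExt]
      dsimp only
      rw [← Category.assoc (RepEval.ext c Y.obj) (((abRep 𝕜 M).map₂ (A ◁ Y.coact)).toNatTrans.app _),
        ext_whiskerLeft,
        ← Category.assoc ((abRep 𝕜 M).map₂ (Comonad.comul ▷ Y.obj) |>.toNatTrans.app _),
        ← Category.assoc (RepEval.ext c Y.obj), hcan.ext_comul]
      refine (Preadditive.sub_comp _ _ _).trans ?_
      rw [Category.assoc, Category.assoc]
    -- The contraction: after the coaction, the left side of `key` is `θ` by counitality, and the
    -- two terms on the right agree by coassociativity.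
    have h₁ := congr(Y.coact ≫ $key)
    rw [Preadditive.comp_sub, ← Category.assoc Y.coact (A ◁ Y.coact), Y.coassoc] at h₁
    have h₂ := congr($(Y.counit) ≫ θ)
    simp only [Category.assoc, Category.id_comp] at h₁ h₂
    rw [← h₂, h₁, sub_self]
  · intro y
    obtain ⟨x, hx⟩ := hsurj y
    obtain ⟨χ, rfl⟩ := (hext _ (of 𝕜 G)).2 x
    -- On the kernel, the coaction and `ext c Y.obj` agree, so `Y.coact ≫ χ` restricts to the same
    -- morphism as `ext c Y.obj` followed by `χ`, namely `y`.
    refine ⟨Y.coact ≫ χ, ?_⟩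
    dsimp only
    rw [map₂_comp_app, ← Category.assoc, hκ', Category.assoc]
    exact hx

/-- If every object is a direct summand of a direct sum of objects `F N`, then morphisms from `Y`
to objects of `M` are determined by morphisms to the objects `F N`. -/
lemma exists_decomposition {Z : M.obj j.as} (hZ : (generated M N).prop j.as Z) :
    ∃ (n : ℕ) (F : Fin n → (i ⟶ j))
      (s : ∀ a, ofObj 𝕜 Z ⟶ ((abRep 𝕜 M).map (F a)).toFunctor.obj (ofObj 𝕜 N))
      (r : ∀ a, ((abRep 𝕜 M).map (F a)).toFunctor.obj (ofObj 𝕜 N) ⟶ ofObj 𝕜 Z),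
      ∑ a, s a ≫ r a = 𝟙 (ofObj 𝕜 Z) := by
  obtain ⟨n, F, s, r, h⟩ := hZ
  refine ⟨n, fun a => of 𝕜 (F a), fun a => homMk (P := of 𝕜 Z)
    (Q := (eval 𝕜 N j.as).obj (of 𝕜 (F a))) (s a) (mem_adm_of_isEmpty _),
    fun a => homMk (P := (eval 𝕜 N j.as).obj (of 𝕜 (F a))) (Q := of 𝕜 Z) (r a)
      (mem_adm_of_isEmpty _), ?_⟩
  exact (ofHom_sum 𝕜 Finset.univ fun a => s a ≫ r a).symm.trans congr(ofHom $h)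

variable (hgen : ∀ Z : M.obj j.as, (generated M N).prop j.as Z)
include hgen

/-- `X` embeds into an object of `M`, which is a summand of a finite sum of objects `F N`, and every
morphism from `X` to such an `F N` factors through `t`. -/
lemma mono_of_isUniversal {X : (abRep 𝕜 M).obj j} {H : i ⟶ j}
    {t : X ⟶ ((abRep 𝕜 M).map H).toFunctor.obj (ofObj 𝕜 N)} (ht : IsUniversal t) : Mono t where
  right_cancellation {S} f g h := by
    rw [← cancel_mono (inclObj X)]
    obtain ⟨n, F, s, r, hsr⟩ := exists_decomposition (𝕜 := 𝕜) (hgen (InjAb.X X))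
    have key (a : Fin n) : f ≫ inclObj X ≫ s a = g ≫ inclObj X ≫ s a := by
      rw [← ht.fac (inclObj X ≫ s a), ← Category.assoc, h, Category.assoc]
    rw [← Category.comp_id (inclObj X), ← hsr]
    simp only [Preadditive.comp_sum]
    refine Finset.sum_congr rfl fun a _ => ?_
    simpa only [Category.assoc] using congr($(key a) ≫ r a)

/-- Morphisms to `F N` from either object are the 2-morphisms `H ⟶ F`, compatibly with `u`. Passing
to summands, `u` induces bijections on morphisms to all objects of `M`, which suffices by
`isIso_of_bijective`. -/
lemma isIso_of_isUniversal {X E : (abRep 𝕜 M).obj j} {H : i ⟶ j}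
    {t : X ⟶ ((abRep 𝕜 M).map H).toFunctor.obj (ofObj 𝕜 N)} (ht : IsUniversal t)
    {κ : E ⟶ ((abRep 𝕜 M).map H).toFunctor.obj (ofObj 𝕜 N)} (hκ : IsUniversal κ) (u : X ⟶ E)
    (hu : u ≫ κ = t) : IsIso u := by
  refine isIso_of_bijective_abRep u fun Z => ?_
  obtain ⟨n, F, s, r, hsr⟩ := exists_decomposition (𝕜 := 𝕜) (hgen Z)
  constructor
  · intro y y' h
    have key (a : Fin n) : y ≫ s a = y' ≫ s a := by
      have : hκ.desc (y ≫ s a) = hκ.desc (y' ≫ s a) := by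
        refine ht.hom_ext ?_
        rw [← hu, Category.assoc, hκ.fac, Category.assoc, hκ.fac, ← Category.assoc,
          ← Category.assoc]
        exact congr($h ≫ s a)
      rw [← hκ.fac (y ≫ s a), this, hκ.fac]
    rw [← Category.comp_id y, ← Category.comp_id y', ← hsr, Preadditive.comp_sum,
      Preadditive.comp_sum]
    refine Finset.sum_congr rfl fun a _ => ?_
    rw [← Category.assoc, key, Category.assoc]
  · intro y
    refine ⟨∑ a, (κ ≫ ((abRep 𝕜 M).map₂ (ht.desc (y ≫ s a))).toNatTrans.app _) ≫ r a, ?_⟩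
    have hy : y = ∑ a, y ≫ s a ≫ r a := by rw [← Preadditive.comp_sum, hsr, Category.comp_id]
    refine Eq.trans ?_ hy.symm
    dsimp only
    rw [Preadditive.comp_sum]
    refine Finset.sum_congr rfl fun a _ => ?_
    rw [← Category.assoc, ← Category.assoc, hu, ht.fac, Category.assoc]

end

end AbRep

/-! ### The internal hom functor is an equivalence onto comodules. -/

namespace AbRep

open InjAb RepEval

section

variable {𝕜 : Type w} [Field 𝕜] {C : Type u} [Bicategory.{v, v} C]
  [∀ i j : C, Preadditive (i ⟶ j)] [∀ i j : C, Linear 𝕜 (i ⟶ j)] [PreadditiveBicategory C]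
  [LinearBicategory 𝕜 C]
  {M : C ⥤ᵖ Cat.{v, v}} [∀ i, Preadditive (M.obj i)] [∀ i, Linear 𝕜 (M.obj i)]
  [IsLinearRep 𝕜 M] {i : AbBicat 𝕜 C} {N : M.obj i.as}
  {A : i ⟶ i} [Comonad A] {c : ofObj 𝕜 N ⟶ ((abRep 𝕜 M).map A).toFunctor.obj (ofObj 𝕜 N)}

/-- The universal morphism out of an object with internal hom `Y` is a kernel of the difference of
the two morphisms given by the coaction on `Y`. -/
lemma exists_lift_of_isUniversal (hcan : IsCanonical c) {j : AbBicat 𝕜 C}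
    (hext : ∀ F : i ⟶ j, IsUniversal (RepEval.ext c F))
    (hgen : ∀ Z : M.obj j.as, (generated M N).prop j.as Z) (Y : RightComod A j)
    {Y' : (abRep 𝕜 M).obj j} {t : Y' ⟶ ((abRep 𝕜 M).map Y.obj).toFunctor.obj (ofObj 𝕜 N)}
    (ht : IsUniversal t) (h : t ≫ coactSubExt c Y = 0) {S : (abRep 𝕜 M).obj j}
    (ψ : S ⟶ ((abRep 𝕜 M).map Y.obj).toFunctor.obj (ofObj 𝕜 N)) (hψ : ψ ≫ coactSubExt c Y = 0) :
    ∃ f : S ⟶ Y', f ≫ t = ψ := by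
  obtain ⟨E, κ, hκ, -, hlift⟩ := exists_comodule_kernel hcan hext Y
  -- The comparison of `Y'` with the kernel `E`. Both carry universal morphisms to the same `Y.obj`,
  -- so it is invertible and the lifting property transfers from `E` to `Y'`.
  obtain ⟨u, hu⟩ := hlift t h
  obtain ⟨u', -, hu'⟩ := isIso_of_isUniversal hgen ht hκ u hu
  obtain ⟨χ, hχ⟩ := hlift ψ hψ
  refine ⟨χ ≫ u', ?_⟩
  rw [← hχ, ← hu, Category.assoc, ← Category.assoc u', hu', Category.id_comp]

/-- Morphisms of comodule 1-morphisms between internal homs come from morphisms of objects. -/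
lemma exists_of_hom (hcan : IsCanonical c) {j : AbBicat 𝕜 C}
    (hext : ∀ F : i ⟶ j, IsUniversal (RepEval.ext c F))
    (hgen : ∀ Z : M.obj j.as, (generated M N).prop j.as Z) {Y Y' : RightComod A j}
    {X X' : (abRep 𝕜 M).obj j} {t : X ⟶ ((abRep 𝕜 M).map Y.obj).toFunctor.obj (ofObj 𝕜 N)}
    (hc : t ≫ ((abRep 𝕜 M).map₂ Y.coact).toNatTrans.app (ofObj 𝕜 N) = t ≫ RepEval.ext c Y.obj)
    {t' : X' ⟶ ((abRep 𝕜 M).map Y'.obj).toFunctor.obj (ofObj 𝕜 N)} (ht' : IsUniversal t')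
    (hc' : t' ≫ ((abRep 𝕜 M).map₂ Y'.coact).toNatTrans.app (ofObj 𝕜 N) =
      t' ≫ RepEval.ext c Y'.obj) (φ : Y ⟶ Y') :
    ∃ f : X ⟶ X', f ≫ t' = t ≫ ((abRep 𝕜 M).map₂ φ.hom).toNatTrans.app (ofObj 𝕜 N) := by
  refine exists_lift_of_isUniversal hcan hext hgen Y' ht'
    ((comp_coactSubExt_eq_zero t').2 hc') _ ((comp_coactSubExt_eq_zero _).2 ?_)
  rw [Category.assoc, ← map₂_comp_app, φ.comm, map₂_comp_app, ← Category.assoc, hc,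
    Category.assoc, ext_whiskerLeft, Category.assoc]

variable (hcan : IsCanonical c)
  {C' : Type*} [Bicategory C'] {I : C' ⥤ᵖ AbBicat 𝕜 C}
  {H : ∀ {j : C'} (_ : (abRep 𝕜 M).obj (I.obj j)), i ⟶ I.obj j}
  {t : ∀ {j : C'} (X : (abRep 𝕜 M).obj (I.obj j)),
    X ⟶ ((abRep 𝕜 M).map (H X)).toFunctor.obj (ofObj 𝕜 N)}
  (ht : ∀ {j : C'} (X : (abRep 𝕜 M).obj (I.obj j)), IsUniversal (t X)) (j : C')

lemma homFunctor_additive : (homFunctor (I := I) hcan ht j).Additive where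
  map_add {X Y f g} := RightComod.Hom.ext <| (ht X).hom_ext (by
    change t X ≫ ((abRep 𝕜 M).map₂ ((ht X).desc ((f + g) ≫ t Y))).toNatTrans.app (ofObj 𝕜 N) =
      t X ≫ ((abRep 𝕜 M).map₂ ((ht X).desc (f ≫ t Y) +
        (ht X).desc (g ≫ t Y))).toNatTrans.app (ofObj 𝕜 N)
    rw [map₂_add_app, Preadditive.comp_add, (ht X).fac, (ht X).fac, (ht X).fac,
      Preadditive.add_comp])

lemma homFunctor_linear : (homFunctor (I := I) hcan ht j).Linear 𝕜 where
  map_smul {X Y} f r := RightComod.Hom.ext <| (ht X).hom_ext (by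
    change t X ≫ ((abRep 𝕜 M).map₂ ((ht X).desc ((r • f) ≫ t Y))).toNatTrans.app (ofObj 𝕜 N) =
      t X ≫ ((abRep 𝕜 M).map₂ (r • (ht X).desc (f ≫ t Y))).toNatTrans.app (ofObj 𝕜 N)
    rw [map₂_smul_app, Linear.comp_smul, (ht X).fac, (ht X).fac, Linear.smul_comp])

variable (hext : ∀ F : i ⟶ I.obj j, IsUniversal (RepEval.ext c F))

-- The preimage of `Y` is the kernel attached to it, whose internal hom is `Y` by
-- `exists_comodule_kernel`.
include hext in
lemma homFunctor_essSurj : (homFunctor (I := I) hcan ht j).EssSurj where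
  mem_essImage Y := by
    obtain ⟨E, κ, hκ, hκ₀, -⟩ := exists_comodule_kernel hcan hext Y
    refine ⟨E, ⟨RightComod.isoMk ((ht E).iso hκ) ?_⟩⟩
    refine comm_of_isUniversal hcan (ht E) Y _ ?_
    change t E ≫ ((abRep 𝕜 M).map₂ ((ht E).desc κ)).toNatTrans.app (ofObj 𝕜 N) ≫ _ =
      t E ≫ ((abRep 𝕜 M).map₂ ((ht E).desc κ)).toNatTrans.app (ofObj 𝕜 N) ≫ _
    rw [(ht E).fac_assoc, (ht E).fac_assoc]
    exact (comp_coactSubExt_eq_zero κ).1 hκ₀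

variable (hgen : ∀ Z : M.obj (I.obj j).as, (generated M N).prop (I.obj j).as Z)

-- The image of `f` determines `f ≫ t Y`, and `t Y` is a monomorphism.
include hgen in
lemma homFunctor_faithful : (homFunctor (I := I) hcan ht j).Faithful where
  map_injective {X Y f g} h := by
    have := mono_of_isUniversal hgen (ht Y)
    rw [← cancel_mono (t Y)]
    have h : (ht X).desc (f ≫ t Y) = (ht X).desc (g ≫ t Y) := congr(($h).hom)
    rw [← (ht X).fac (f ≫ t Y), h, (ht X).fac]

include hext hgen in
lemma homFunctor_full : (homFunctor (I := I) hcan ht j).Full where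
  map_surjective {X Y} φ := by
    obtain ⟨f, hf⟩ := exists_of_hom hcan hext hgen (Y := comodule hcan (ht X))
      (Y' := comodule hcan (ht Y)) (t := t X) (comodule_coact_fac hcan (ht X)) (t' := t Y) (ht Y)
      (comodule_coact_fac hcan (ht Y)) φ
    exact ⟨f, RightComod.Hom.ext ((ht X).hom_ext (((ht X).fac (f ≫ t Y)).trans hf))⟩

include hext hgen in
lemma homFunctor_isEquivalence : (homFunctor (I := I) hcan ht j).IsEquivalence where
  faithful := homFunctor_faithful hcan ht j hgen
  full := homFunctor_full hcan ht j hext hgen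
  essSurj := homFunctor_essSurj hcan ht j hext

end

end AbRep

/-! ### Lifting a morphism of 2-representations to a full subrepresentation. -/

namespace RepLift

section

variable {C : Type*} [Bicategory C] {M R : C ⥤ᵖ Cat} (P : R.ObjectProperty)
  [P.IsClosedUnderMapObj] (τ : M ⟶ R) (h : ∀ j X, P.prop j ((τ.app j).toFunctor.obj X))

/-- The isomorphism of functors that lifts the naturality isomorphism. -/
def natIso {j k : C} (F : j ⟶ k) :
    (M.map F).toFunctor ⋙ (P.prop k).lift (τ.app k).toFunctor (h k) ≅
      (P.prop j).lift (τ.app j).toFunctor (h j) ⋙ P.map F :=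
  NatIso.ofComponents (fun X => ObjectProperty.isoMk _
    ((Cat.Hom.toNatIso (τ.naturality F)).app X)) (fun f =>
      ObjectProperty.hom_ext _ ((τ.naturality F).hom.toNatTrans.naturality f))

/-- A morphism of 2-representations lifts to a subrepresentation given by a property of objects. -/
def lift : M ⟶ P.fullsubcategory where
  app j := ((P.prop j).lift (τ.app j).toFunctor (h j)).toCatHom
  naturality F := Cat.Hom.isoMk (natIso P τ h F)
  naturality_naturality η := Cat.Hom₂.ext <| NatTrans.ext <| funext fun X =>
    ObjectProperty.hom_ext _ congr(($(τ.naturality_naturality η)).toNatTrans.app X)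
  naturality_id j := Cat.Hom₂.ext <| NatTrans.ext <| funext fun X =>
    ObjectProperty.hom_ext _ congr(($(τ.naturality_id j)).toNatTrans.app X)
  naturality_comp F G := Cat.Hom₂.ext <| NatTrans.ext <| funext fun X =>
    ObjectProperty.hom_ext _ congr(($(τ.naturality_comp F G)).toNatTrans.app X)

/-- The lift followed by the inclusion. -/
def liftι : lift P τ h ≫ P.ι ≅ τ :=
  Pseudofunctor.StrongTrans.isoMk (fun j => Cat.Hom.isoMk (NatIso.ofComponents (fun X => Iso.refl _)
    (fun f => (Category.comp_id _).trans (Category.id_comp _).symm)))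
    (fun F => Cat.Hom₂.ext <| NatTrans.ext <| funext fun X => by
      have : 𝟙 _ ≫ (τ.naturality F).hom.toNatTrans.app X =
          (𝟙 _ ≫ (τ.naturality F).hom.toNatTrans.app X ≫ 𝟙 _ ≫ 𝟙 _ ≫ 𝟙 _) ≫
            (R.map F).toFunctor.map (𝟙 _) := by simp
      exact this)

end

end RepLift

/-! ### Restricting the equivalence to injective objects. -/

namespace RepLift

universe v' u'

section

variable {𝕜 : Type w} [Field 𝕜] {C : Type u} [Bicategory.{v, v} C]

/-- A morphism of `𝕜`-linear 2-representations given by fully faithful functors is an equivalence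
with a subrepresentation, if the latter contains its image and all of its objects are isomorphic
to objects in the image. -/
lemma lift_isRepEquivalence {M R : C ⥤ᵖ Cat.{v', u'}} [∀ i, Preadditive (M.obj i)]
    [∀ i, Linear 𝕜 (M.obj i)] [∀ i, Preadditive (R.obj i)]
    [∀ i, Linear 𝕜 (R.obj i)] (P : R.ObjectProperty) [P.IsClosedUnderMapObj] (τ : M ⟶ R)
    (h : ∀ j X, P.prop j ((τ.app j).toFunctor.obj X)) (hfull : ∀ j, (τ.app j).toFunctor.Full)
    (hfaithful : ∀ j, (τ.app j).toFunctor.Faithful)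
    (hadd : ∀ j, (τ.app j).toFunctor.Additive) (hlin : ∀ j, (τ.app j).toFunctor.Linear 𝕜)
    (hess : ∀ j (J : R.obj j), P.prop j J → ∃ X, Nonempty ((τ.app j).toFunctor.obj X ≅ J)) :
    IsRepEquivalence 𝕜 (lift P τ h) where
  isEquivalence j :=
    { faithful := inferInstanceAs ((P.prop j).lift (τ.app j).toFunctor (h j)).Faithful
      full := inferInstanceAs ((P.prop j).lift (τ.app j).toFunctor (h j)).Full
      essSurj := ⟨fun J => by
        obtain ⟨X, ⟨e⟩⟩ := hess j J.obj J.property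
        exact ⟨X, ⟨ObjectProperty.isoMk _ e⟩⟩⟩ }
  additive j := ⟨fun {_ _ _ _} => ObjectProperty.hom_ext _ (hadd j).map_add⟩
  linear j := ⟨fun _ _ => ObjectProperty.hom_ext _ ((hlin j).map_smul _ _)⟩

variable [∀ i j : C, Preadditive (i ⟶ j)] [∀ i j : C, Linear 𝕜 (i ⟶ j)]
  [PreadditiveBicategory C] [LinearBicategory 𝕜 C]
  {M : C ⥤ᵖ Cat.{v', max u' v'}} [∀ i, Preadditive (M.obj i)] [∀ i, Linear 𝕜 (M.obj i)]
  [IsLinearRep 𝕜 M] {R : C ⥤ᵖ Cat.{v', max u' v'}} [∀ i, Preadditive (R.obj i)]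
  [∀ i, Linear 𝕜 (R.obj i)] {Θ : (AbBicat.incl 𝕜 C).comp (abRep.{u, v, w, v', max u' v'} 𝕜 M) ⟶ R}
  (hΘ : IsRepEquivalence 𝕜 Θ)
include hΘ

lemma injective_obj (j : C) (X : M.obj j) :
    Injective (((toAbRep 𝕜 M ≫ Θ).app j).toFunctor.obj X) := by
  have := hΘ.isEquivalence j
  have : Injective (InjAb.of 𝕜 X) := InjAb.injective_of_isEmpty _
  exact ((Θ.app j).toFunctor.asEquivalence.map_injective_iff _).2 this

/-- Equivalences preserve and reflect injectivity, so this reduces to the description of the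
injective objects of the abelianization. -/
lemma exists_iso_of_injective (j : C) [IsIdempotentComplete (M.obj j)] (J : R.obj j)
    (hJ : Injective J) :
    ∃ X, Nonempty (((toAbRep 𝕜 M ≫ Θ).app j).toFunctor.obj X ≅ J) := by
  have := hΘ.isEquivalence j
  let e := (Θ.app j).toFunctor.objObjPreimageIso J
  let I : InjAb 𝕜 (M.obj j) := (Θ.app j).toFunctor.objPreimage J
  have : Injective I := ((Θ.app j).toFunctor.asEquivalence.map_injective_iff _).1 (Injective.of_iso e.symm hJ)
  obtain ⟨Z, ⟨e'⟩⟩ := InjAb.exists_iso_of_injective I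
  exact ⟨Z, ⟨(Θ.app j).toFunctor.mapIso e'.symm ≪≫ e⟩⟩

/-- An equivalence from the abelianization of `M` restricts to an equivalence from `M` to the
injective objects. -/
theorem exists_equivalence_injectiveObjects (hM : ∀ j, IsIdempotentComplete (M.obj j)) :
    ∃ (_ : (injectiveObjects R).IsClosedUnderMapObj)
      (Ψ : M ⟶ (injectiveObjects R).fullsubcategory),
      IsRepEquivalence 𝕜 Ψ ∧ Nonempty (Ψ ≫ (injectiveObjects R).ι ≅ toAbRep 𝕜 M ≫ Θ) := by
  -- An injective `J` is the image of some `X` in `M`, so `F J` is isomorphic to the image of `F X`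
  -- and is again injective.
  have hcl : (injectiveObjects R).IsClosedUnderMapObj := ⟨fun {j k} J hJ F => by
    obtain ⟨X, ⟨e⟩⟩ := exists_iso_of_injective hΘ j J hJ
    exact Injective.of_iso ((Cat.Hom.toNatIso ((toAbRep 𝕜 M ≫ Θ).naturality F)).app X ≪≫
      (R.map F).toFunctor.mapIso e) (injective_obj hΘ k ((M.map F).toFunctor.obj X))⟩
  refine ⟨hcl, lift _ (toAbRep 𝕜 M ≫ Θ) (injective_obj hΘ), lift_isRepEquivalence _ _ _
    (fun j => ?_) (fun j => ?_) (fun j => ?_) (fun j => ?_)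
    (fun j J => exists_iso_of_injective hΘ j J), ⟨liftι _ _ _⟩⟩
  · let T : InjAb 𝕜 (M.obj j) ⥤ R.obj j := (Θ.app j).toFunctor
    have : T.IsEquivalence := hΘ.isEquivalence j
    exact inferInstanceAs ((InjAb.ofFunctor 𝕜 (M.obj j) ⋙ T).Full)
  · let T : InjAb 𝕜 (M.obj j) ⥤ R.obj j := (Θ.app j).toFunctor
    have : T.IsEquivalence := hΘ.isEquivalence j
    exact inferInstanceAs ((InjAb.ofFunctor 𝕜 (M.obj j) ⋙ T).Faithful)
  · let T : InjAb 𝕜 (M.obj j) ⥤ R.obj j := (Θ.app j).toFunctor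
    have : T.Additive := hΘ.additive j
    exact inferInstanceAs ((InjAb.ofFunctor 𝕜 (M.obj j) ⋙ T).Additive)
  · let T : InjAb 𝕜 (M.obj j) ⥤ R.obj j := (Θ.app j).toFunctor
    have : T.Linear 𝕜 := hΘ.linear j
    exact inferInstanceAs ((InjAb.ofFunctor 𝕜 (M.obj j) ⋙ T).Linear 𝕜)

end

end RepLift

/-! ### Transitivity in terms of direct summands. -/

namespace AbRep

open RepEval

universe v' u'

/-- Essential surjectivity of the inclusion gives an object of the additive closure isomorphic to
`Z`, and its decomposition is transported along the isomorphism. -/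
lemma generated_of_isTransitive {𝕜 : Type w} [Field 𝕜] {C : Type u} [Bicategory.{v, v} C]
    [∀ i j : C, Preadditive (i ⟶ j)] [∀ i j : C, Linear 𝕜 (i ⟶ j)]
    {M : C ⥤ᵖ Cat.{v', u'}} [∀ i, Preadditive (M.obj i)] [∀ i, Linear 𝕜 (M.obj i)]
    [IsLinearRep 𝕜 M] [IsTransitive 𝕜 M] {i : C} {N : M.obj i} (hN : ¬ IsZero N) (j : C)
    (Z : M.obj j) : (generated M N).prop j Z := by
  have := generated_isClosedUnderMapObj 𝕜 M N
  have h : ((generated M N).ι.app j).toFunctor.IsEquivalence :=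
    IsTransitive.isEquivalence (𝕜 := 𝕜) N hN j
  let Y : ((generated M N).prop j).FullSubcategory :=
    ((generated M N).ι.app j).toFunctor.objPreimage Z
  let e : Y.obj ≅ Z := ((generated M N).ι.app j).toFunctor.objObjPreimageIso Z
  obtain ⟨n, F, s, r, hsr⟩ := Y.property
  refine ⟨n, F, fun a => e.inv ≫ s a, fun a => r a ≫ e.hom, ?_⟩
  simp only [Category.assoc]
  rw [← Preadditive.comp_sum]
  simp only [← Category.assoc (s _)]
  rw [← Preadditive.sum_comp, hsr, Category.id_comp, e.inv_hom_id]

end AbRep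

end

/-! ### The main theorem. -/

open RepEval AbRep in
theorem theorem4p5 {𝕜 : Type w} [Field 𝕜] [IsAlgClosed 𝕜]
    {C : Type u} [Bicategory.{u, u} C] [∀ i j : C, Preadditive (i ⟶ j)] [PreadditiveBicategory C]
    [∀ i j : C, Linear 𝕜 (i ⟶ j)] [LinearBicategory 𝕜 C] [IsFiat 𝕜 C]
    (M : C ⥤ᵖ Cat.{u, u}) [∀ i, Preadditive (M.obj i)] [∀ i, Linear 𝕜 (M.obj i)]
    [IsLinearRep 𝕜 M] [IsTransitive 𝕜 M] {i : C} (N : M.obj i) (hN : ¬ IsZero N) :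
    (∃ A : (AbBicat.of i : AbBicat 𝕜 C) ⟶ AbBicat.of i,
      Nonempty (InternalHom (R := abRep 𝕜 M) (InjAb.of 𝕜 N) (InjAb.of 𝕜 N) A)) ∧
    ∀ (A : (AbBicat.of i : AbBicat 𝕜 C) ⟶ AbBicat.of i)
      (e : InternalHom (R := abRep 𝕜 M) (InjAb.of 𝕜 N) (InjAb.of 𝕜 N) A),
      ∃ _ : Comonad A, e.IsCanonicalCoalgebra ∧
        ∃ Θ : (AbBicat.incl 𝕜 C).comp (abRep 𝕜 M) ⟶ (AbBicat.incl 𝕜 C).comp (comod A),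
          Nonempty (InternalHomTrans e Θ) ∧
          IsRepEquivalence 𝕜 Θ ∧
          ∃ (_ : (injectiveObjects ((AbBicat.incl 𝕜 C).comp (comod A))).IsClosedUnderMapObj)
            (Ψ : M ⟶ (injectiveObjects ((AbBicat.incl 𝕜 C).comp (comod A))).fullsubcategory),
            IsRepEquivalence 𝕜 Ψ ∧
            Nonempty (Ψ ≫ (injectiveObjects ((AbBicat.incl 𝕜 C).comp (comod A))).ι ≅
              toAbRep 𝕜 M ≫ Θ) := by
  have hM (j : C) : IsFinitary 𝕜 (M.obj j) := IsTransitive.finitary j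
  have hC (j k : C) : IsFinitary 𝕜 (j ⟶ k) := IsFinitaryBicategory.finitary_hom j k
  obtain ⟨S⟩ := IsFiat.nonempty_fiatStructure (𝕜 := 𝕜) (C := C)
  have hex (j : AbBicat 𝕜 C) (X : (abRep 𝕜 M).obj j) :
      ∃ (H : AbBicat.of i ⟶ j) (t : X ⟶ ((abRep 𝕜 M).map H).toFunctor.obj (ofObj 𝕜 N)),
        IsUniversal t := by
    have := hM j.as
    have := hC i j.as
    exact exists_isUniversal (i := AbBicat.of i) N X
  constructor
  · obtain ⟨A, c, hc⟩ := hex (AbBicat.of i) (ofObj 𝕜 N)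
    exact ⟨A, ⟨hc.internalHom⟩⟩
  · intro A e
    have hc : IsUniversal (R := abRep 𝕜 M) e.coev := isUniversal_coev e
    let := hc.comonad
    have hcan := hc.isCanonical
    -- The internal homs are chosen independently of `A`: the one chosen for `N` itself need not be
    -- `A`, which does no harm because coactions are defined through `e.coev` alone.
    choose H t ht using hex
    have hext {j k : C} (F : j ⟶ k) (X : (abRep 𝕜 M).obj ((AbBicat.incl 𝕜 C).obj j)) :
        IsUniversal (RepEval.ext (t _ X) ((AbBicat.incl 𝕜 C).map F)) :=
      -- The adjunction `F ⊣ F*` persists in the abelianization because pseudofunctors preserve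
      -- adjunctions.
      (ht _ X).ext ((AbBicat.incl 𝕜 C).mapAdjunction (S.adj F))
    let Θ := homTrans (I := AbBicat.incl 𝕜 C) hcan (fun X => ht _ X) hext
    have hΘ : IsRepEquivalence 𝕜 Θ :=
      { isEquivalence := fun j => homFunctor_isEquivalence hcan (fun X => ht _ X) j
          (isUniversal_ext hc fun F => ⟨_, ⟨S.adj F⟩⟩)
          (generated_of_isTransitive (𝕜 := 𝕜) hN j)
        additive := homFunctor_additive hcan (fun X => ht _ X)
        linear := homFunctor_linear hcan (fun X => ht _ X) }
    exact ⟨inferInstance, isCanonicalCoalgebra hcan, Θ,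
      ⟨homTransData (I := AbBicat.incl 𝕜 C) (fun X => ht _ X) hext hcan⟩, hΘ,
      RepLift.exists_equivalence_injectiveObjects hΘ fun j => (hM j).toIsIdempotentComplete⟩
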